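/- **Conventions.** All products, smash products and quotients are formed in compactly generated spaces, and $[A,B]$ is the set of pointed homotopy classes of pointed maps. For a pointed space $Y$, $Y^{(k)}$ is the $k$-fold self smash product. $J(Y)$ is the James construction: the set of words in $Y\setminus\{*\}$ with concatenation as product and the quotient topology from $\bigsqcup_m Y^m$. $J_n(Y)\subseteq J(Y)$ is the set of words of length at most $n$, with the quotient topology from $Y^n$, and $E\colon Y\to J(Y)$ is the inclusion. $[A,J(Y)]$ carries the pointwise product. *Combinatorial groups.* For a finite index set $S$, let $K_S(k)$ be the group with generators $\{x_{i_1}|\cdots|x_{i_k}\}$, $i_1,\dots,i_k\in S$, and relations, where $[x,y]=x^{-1}y^{-1}xy$ and $[[a_1,\dots,a_r]=[\cdots[a_1,a_2],\cdots,a_r]$ with $r\ge1$: 1. $\{x_{i_1}|\cdots|x_{i_k}\}=1$ if two of its indices are equal; 2. $[[g_1,\dots,g_r]=1$ for generators $g_1,\dots,g_r$ whose $kr$ indices are not pairwise distinct; 3. $[[g_1^{m_1},\dots,g_r^{m_r}]=[[g_1,\dots,g_r]^{m_1\cdots m_r}$ for generators $g_i$ and $m_i\in\mathbb Z$. Take $S=\{1,\dots,n\}\times\{1,\dots,l\}$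 and write $K_{ln}(k)$ for $K_S(k)$; the pair $(s,j)$ is the $j$-th index of the $s$-th block of length $l$. For $T\subseteq S$ let $\varepsilon_T\colon K_{ln}(k)\to K_{ln}(k)$ send a generator to $1$ if it involves an index in $T$ and to itself otherwise. Let $D_s\colon K_{ln}(k)\to K_{l(n-1)}(k)$ send a generator to $1$ if it involves an index of block $s$, and otherwise move the blocks after $s$ down by one. With $B_s$ the set of indices of block $s$, put $$\mathcal H^{(l)(k)}_n=\{a\in K_{ln}(k):\ \varepsilon_{\{(s,j)\}}a=\varepsilon_{B_s}a\ \text{for all }(s,j),\quad D_sa=D_ta\ \text{for all }s,t\}.$$ *Geometric groups.* For a pointed space $X$, $\{x_{i_1}|\cdots|x_{i_k}\}\in[X^{ln},J(X^{(k)})]$ is the class of $x\mapsto E(x_{i_1}\wedge\cdots\wedge x_{i_k})$, and $K_{ln}(k)(X)$ is the subgroup generated by these classes. Let $\varepsilon_T$ on $[X^{ln},J(X^{(k)})]$ be induced by the self-map of $X^{ln}$ replacing the coordinates in $T$ by the base point, and $D_s$ by the map $X^{l(n-1)}\to X^{ln}$ inserting a block of base points in place $s$. Let $q\colon X^{ln}\to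 (X^{(l)})^n\to J_n(X^{(l)})$ be the quotient map. Then $\mathcal H^{(l)(k)}_n(X)$ is the subgroup of those $\alpha\in[J_n(X^{(l)}),J(X^{(k)})]$ for which $q^*\alpha$ lies in $K_{ln}(k)(X)$ and satisfies $\varepsilon_{\{(s,j)\}}q^*\alpha=\varepsilon_{B_s}q^*\alpha$ for all $(s,j)$ and $D_sq^*\alpha=D_tq^*\alpha$ for all $s,t$. **Proposition.** Let $X$ be a path connected, compactly generated space with non-degenerate base point (that is, $(X,*)$ is an NDR pair) and weak LS-category less than $2$ (that is, the reduced diagonal $X\to X\wedge X$ is null homotopic as a pointed map). Let $n\ge0$ and $l,k\ge1$. Then $[X^{ln},J(X^{(k)})]$ and $[J_n(X^{(l)}),J(X^{(k)})]$ are groups, and $q^*\colon[J_n(X^{(l)}),J(X^{(k)})]\to[X^{ln},J(X^{(k)})]$ is a monomorphism. There is a homomorphism $e_X\colon K_{ln}(k)\to[X^{ln},J(X^{(k)})]$ with $e_X(\{x_{i_1}|\cdots|x_{i_k}\})=\{x_{i_1}|\cdots|x_{i_k}\}$ on generators, and there is a homomorphism $$e_X\colon\mathcal H^{(l)(k)}_n\longrightarrow\mathcal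 H^{(l)(k)}_n(X)\subseteq[J_n(X^{(l)}),J(X^{(k)})]$$ such that $q^*\circ e_X\colon\mathcal H^{(l)(k)}_n\to[X^{ln},J(X^{(k)})]$ is the restriction of $e_X\colon K_{ln}(k)\to[X^{ln},J(X^{(k)})]$ to $\mathcal H^{(l)(k)}_n$. Moreover, if $a\in\mathcal H^{(l)(k)}_n$ satisfies $\varepsilon_{\{(s,j)\}}a=1$ for all $(s,j)$, then $\varepsilon_{\{(s,j)\}}q^*e_X(a)=1$ for all $(s,j)$. -/

import Mathlib

universe u

open Topology Set

noncomputable section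

namespace GeoReal

/-! ### Compactly generated spaces, powers and smash powers -/

/-- A choice of base point. -/
class BasePoint (X : Type u) where
  /-- The base point. -/
  pt : X

/-- The base point of `X`. -/
abbrev pt {X : Type u} [BasePoint X] : X := BasePoint.pt

/-- The set `Y` with the compactly generated topology attached to the topology of `Y`. -/
def KIfy (Y : Type u) : Type u := Y

instance {Y : Type u} [TopologicalSpace Y] : TopologicalSpace (KIfy Y) :=
  TopologicalSpace.compactlyGenerated.{u} Y

/-- The identity map `KIfy Y → Y`. -/
def KIfy.out {Y : Type u} (y : KIfy Y) : Y := y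

/-- The identity map `Y → KIfy Y`. -/
def KIfy.of {Y : Type u} (y : Y) : KIfy Y := y

theorem KIfy.continuous_out {Y : Type u} [TopologicalSpace Y] :
    Continuous (KIfy.out : KIfy Y → Y) :=
  continuous_from_compactlyGenerated (Y := Y) id fun _ g => g.continuous

theorem KIfy.continuous_test {Y : Type u} [TopologicalSpace Y] (S : CompHaus.{u}) (g : C(S, Y)) :
    Continuous fun s => KIfy.of (g s) := by
  have h : Continuous fun x : (Σ i : (S : CompHaus.{u}) × C(S, Y), i.fst) =>
      (KIfy.of (x.1.2 x.2) : KIfy Y) := continuous_coinduced_rng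
  exact (continuous_sigma_iff.1 h) ⟨S, g⟩

instance {Y : Type u} [TopologicalSpace Y] : CompactlyGeneratedSpace (KIfy Y) :=
  uCompactlyGeneratedSpace_of_continuous_maps fun {_} _ f hf =>
    continuous_from_compactlyGenerated (X := Y) f fun S g =>
      hf S ⟨fun s => KIfy.of (g s), KIfy.continuous_test S g⟩

/-- A continuous map from a compactly generated space to `Y` is continuous as a map to `KIfy Y`. -/
theorem KIfy.continuous_of {A Y : Type u} [TopologicalSpace A] [CompactlyGeneratedSpace A]
    [TopologicalSpace Y] {f : A → Y} (hf : Continuous f) : Continuous fun a => KIfy.of (f a) :=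
  continuous_from_uCompactlyGeneratedSpace _ fun S g =>
    KIfy.continuous_test S ⟨fun s => f (g s), hf.comp g.continuous⟩

/-- The product of a compactly generated space with a compact Hausdorff space is compactly
generated. -/
theorem cg_prod {A K : Type u} [TopologicalSpace A] [CompactlyGeneratedSpace A]
    [TopologicalSpace K] [CompactSpace K] [T2Space K] : CompactlyGeneratedSpace (A × K) := by
  refine compactlyGeneratedSpace_of_continuous_maps fun {Y} _ f hf => ?_
  have h1 : ∀ (L : Type u) [TopologicalSpace L] [CompactSpace L] [T2Space L] (g : L → A),
      Continuous g → Continuous fun p : L × K => f (g p.1, p.2) := fun L _ _ _ g hg =>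
    hf (L × K) (fun p => (g p.1, p.2)) (by fun_prop)
  have h2 : ∀ a : A, Continuous fun y : K => f (a, y) := fun a =>
    hf K (fun y => (a, y)) (by fun_prop)
  let G : A → C(K, Y) := fun a => ⟨_, h2 a⟩
  have hG : Continuous G := by
    refine continuous_from_compactlyGeneratedSpace G fun L _ _ _ g hg => ?_
    exact (ContinuousMap.curry ⟨_, h1 L g hg⟩).continuous
  exact ContinuousMap.continuous_uncurry_of_continuous ⟨G, hG⟩

/-- The product of the unit interval with a compactly generated space is compactly generated. -/
theorem cg_interval {A : Type u} [TopologicalSpace A] [CompactlyGeneratedSpace A] :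
    CompactlyGeneratedSpace (unitInterval × A) := by
  have h : CompactlyGeneratedSpace (A × ULift.{u} unitInterval) := cg_prod
  let e : A × ULift.{u} unitInterval ≃ₜ unitInterval × A :=
    ((Homeomorph.refl A).prodCongr Homeomorph.ulift).trans (Homeomorph.prodComm _ _)
  exact compactlyGeneratedSpace_of_coinduced e.continuous e.isQuotientMap.eq_coinduced

/-- The Cartesian power `X ^ ι`, formed in compactly generated spaces. -/
abbrev Power (ι : Type) (X : Type u) : Type u := KIfy (ι → X)

section Power

variable {ι κ : Type} {X : Type u}

instance [BasePoint X] : BasePoint (Power ι X) := ⟨KIfy.of fun _ => pt⟩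

variable [TopologicalSpace X]

theorem Power.continuous_apply (i : ι) : Continuous fun x : Power ι X => x.out i :=
  (_root_.continuous_apply i).comp KIfy.continuous_out

theorem Power.continuous_mk {A : Type u} [TopologicalSpace A] [CompactlyGeneratedSpace A]
    {f : A → ι → X} (hf : ∀ i, Continuous fun a => f a i) :
    Continuous fun a => (KIfy.of (f a) : Power ι X) :=
  KIfy.continuous_of (continuous_pi hf)

end Power

/-- The relation on `X ^ k` collapsing the fat wedge (the tuples with some coordinate equal to the
base point) to a point. -/
def smashSetoid (k : ℕ) (X : Type u) [BasePoint X] : Setoid (Power (Fin k) X) where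
  r x y := x = y ∨ ((∃ i, x.out i = pt) ∧ ∃ i, y.out i = pt)
  iseqv :=
    ⟨fun _ => Or.inl rfl, by rintro x y (rfl | h); exacts [Or.inl rfl, Or.inr ⟨h.2, h.1⟩], by
      rintro x y z (rfl | h) (rfl | h')
      exacts [Or.inl rfl, Or.inr h', Or.inr h, Or.inr ⟨h.1, h'.2⟩]⟩

/-- The `k`-fold self smash product `X^{(k)}` of a pointed space (for `k ≥ 1`). -/
def Smash (k : ℕ) (X : Type u) [BasePoint X] : Type u := Quotient (smashSetoid k X)

section Smash

variable {k : ℕ} {X : Type u} [TopologicalSpace X] [BasePoint X]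

instance : TopologicalSpace (Smash k X) :=
  inferInstanceAs (TopologicalSpace (Quotient (smashSetoid k X)))

instance : CompactlyGeneratedSpace (Smash k X) :=
  inferInstanceAs (CompactlyGeneratedSpace (Quotient (smashSetoid k X)))

/-- The point `x₁ ∧ ⋯ ∧ x_k`. -/
def Smash.mk (x : Power (Fin k) X) : Smash k X := Quotient.mk (smashSetoid k X) x

theorem Smash.continuous_mk : Continuous (Smash.mk : Power (Fin k) X → Smash k X) :=
  continuous_quotient_mk'

instance : BasePoint (Smash k X) := ⟨Smash.mk pt⟩

end Smash

/-! ### The James construction -/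

open Classical in
/-- The reduced word of a tuple: delete all letters equal to the base point. -/
def reduceWord {X : Type u} [BasePoint X] {n : ℕ} (x : Fin n → X) : List X :=
  (List.ofFn x).filter (fun a => a ≠ pt)

theorem pt_notMem_reduceWord {X : Type u} [BasePoint X] {n : ℕ} (x : Fin n → X) :
    pt ∉ reduceWord x := by
  simp [reduceWord]

theorem reduceWord_get {X : Type u} [BasePoint X] (L : List X) (h : pt ∉ L) :
    reduceWord L.get = L := by
  unfold reduceWord
  rw [List.ofFn_get, List.filter_eq_self]
  intro a ha
  simpa using fun e : a = pt => h (e ▸ ha)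

theorem reduceWord_append {X : Type u} [BasePoint X] {m n : ℕ} (x : Fin m → X) (y : Fin n → X) :
    reduceWord (Fin.append x y) = reduceWord x ++ reduceWord y := by
  simp [reduceWord, List.ofFn_fin_append]

/-- The James construction `J(X)`: the words `x₁ x₂ ⋯ x_n` in letters of `X`, none of them the base
point, multiplied by concatenation. -/
def James (X : Type u) [BasePoint X] : Type u := {L : List X // pt ∉ L}

/-- The stage `J_n(X)` of the James filtration: words of length at most `n`. -/
def JamesFil (n : ℕ) (X : Type u) [BasePoint X] : Type u :=
  {L : List X // pt ∉ L ∧ L.length ≤ n}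

section James

variable {X : Type u} [BasePoint X]

instance : Monoid (James X) where
  mul a b := ⟨a.1 ++ b.1, by simpa using ⟨a.2, b.2⟩⟩
  one := ⟨[], by simp⟩
  mul_assoc a b c := Subtype.ext (List.append_assoc _ _ _)
  one_mul a := Subtype.ext (List.nil_append _)
  mul_one a := Subtype.ext (List.append_nil _)

instance : BasePoint (James X) := ⟨1⟩

instance {n : ℕ} : BasePoint (JamesFil n X) := ⟨⟨[], by simp⟩⟩

/-- The projection `⨆ₙ Xⁿ → J(X)`. -/
def James.word (x : Σ n : ℕ, Power (Fin n) X) : James X :=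
  ⟨reduceWord x.2.out, pt_notMem_reduceWord _⟩

/-- The projection `q_n : Xⁿ → J_n(X)`. -/
def JamesFil.word {n : ℕ} (x : Power (Fin n) X) : JamesFil n X :=
  ⟨reduceWord x.out, pt_notMem_reduceWord _,
    (List.length_filter_le _ _).trans (by simp)⟩

variable [TopologicalSpace X]

/-- `J(X)` has the quotient topology from the disjoint union of all powers of `X`. -/
instance : TopologicalSpace (James X) := TopologicalSpace.coinduced James.word inferInstance

/-- `J_n(X)` has the quotient topology from `Xⁿ`. -/
instance {n : ℕ} : TopologicalSpace (JamesFil n X) :=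
  TopologicalSpace.coinduced JamesFil.word inferInstance

theorem James.continuous_word : Continuous (James.word (X := X)) := continuous_coinduced_rng

theorem JamesFil.continuous_word {n : ℕ} : Continuous (JamesFil.word (X := X) (n := n)) :=
  continuous_coinduced_rng

instance {n : ℕ} : CompactlyGeneratedSpace (JamesFil n X) :=
  compactlyGeneratedSpace_of_coinduced JamesFil.continuous_word rfl

theorem James.isQuotientMap_word : IsQuotientMap (James.word (X := X)) :=
  ⟨⟨rfl⟩, fun a => ⟨⟨a.1.length, KIfy.of a.1.get⟩, Subtype.ext (reduceWord_get a.1 a.2)⟩⟩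

/-- Multiplication in `J(X)` is continuous on compact Hausdorff test spaces, that is, on the product
formed in compactly generated spaces. -/
theorem James.continuous_mul_of_compact {K : Type u} [TopologicalSpace K] [CompactSpace K]
    [T2Space K] {f g : K → James X} (hf : Continuous f) (hg : Continuous g) :
    Continuous fun x => f x * g x := by
  have s1 : ∀ (L : Type u) [TopologicalSpace L] [CompactSpace L] [T2Space L] (m n : ℕ)
      (a : L → Power (Fin m) X) (b : L → Power (Fin n) X), Continuous a → Continuous b →
      Continuous fun x => James.word ⟨m, a x⟩ * James.word ⟨n, b x⟩ := by
    intro L _ _ _ m n a b ha hb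
    have e : (fun x => James.word ⟨m, a x⟩ * James.word ⟨n, b x⟩) =
        fun x => James.word ⟨m + n, KIfy.of (Fin.append (a x).out (b x).out)⟩ := by
      funext x
      exact Subtype.ext (reduceWord_append _ _).symm
    rw [e]
    refine James.continuous_word.comp (continuous_sigmaMk.comp (Power.continuous_mk fun i => ?_))
    refine Fin.addCases (fun i => ?_) (fun i => ?_) i
    · simp only [Fin.append_left]
      exact (Power.continuous_apply i).comp ha
    · simp only [Fin.append_right]
      exact (Power.continuous_apply i).comp hb
  have s2 : ∀ (L : Type u) [TopologicalSpace L] [CompactSpace L] [T2Space L] (m : ℕ)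
      (a : L → Power (Fin m) X) (b : L → James X), Continuous a → Continuous b →
      Continuous fun x => James.word ⟨m, a x⟩ * b x := by
    intro L _ _ _ m a b ha hb
    have h : Continuous fun p : James X × L => James.word ⟨m, a p.2⟩ * p.1 := by
      refine James.isQuotientMap_word.continuous_lift_prod_left ?_
      refine (Homeomorph.sigmaProdDistrib (X := fun n : ℕ => Power (Fin n) X)
        (Y := L)).symm.isQuotientMap.continuous_iff.2 (continuous_sigma fun n => ?_)
      have : CompactlyGeneratedSpace (Power (Fin n) X × L) := cg_prod
      refine continuous_from_compactlyGeneratedSpace _ fun M _ _ _ g hg => ?_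
      exact s1 M m n (fun y => a (g y).2) (fun y => (g y).1) (by fun_prop) (by fun_prop)
    exact h.comp (hb.prodMk continuous_id)
  have h : Continuous fun p : James X × K => p.1 * g p.2 := by
    refine James.isQuotientMap_word.continuous_lift_prod_left ?_
    refine (Homeomorph.sigmaProdDistrib (X := fun n : ℕ => Power (Fin n) X)
      (Y := K)).symm.isQuotientMap.continuous_iff.2 (continuous_sigma fun n => ?_)
    have : CompactlyGeneratedSpace (Power (Fin n) X × K) := cg_prod
    refine continuous_from_compactlyGeneratedSpace _ fun M _ _ _ g' hg' => ?_
    exact s2 M n (fun y => (g' y).1) (fun y => g (g' y).2) (by fun_prop) (by fun_prop)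
  exact h.comp (hf.prodMk continuous_id)

/-- The pointwise product of continuous maps from a compactly generated space to `J(X)` is
continuous. -/
theorem James.continuous_mul {A : Type u} [TopologicalSpace A] [CompactlyGeneratedSpace A]
    {f g : A → James X} (hf : Continuous f) (hg : Continuous g) :
    Continuous fun x => f x * g x :=
  continuous_from_compactlyGeneratedSpace _ fun _ _ _ _ _ hk =>
    James.continuous_mul_of_compact (hf.comp hk) (hg.comp hk)

/-- The canonical inclusion `E : X → J(X)`. -/
def James.incl (x : X) : James X := James.word ⟨1, KIfy.of fun _ => x⟩

theorem James.continuous_incl [CompactlyGeneratedSpace X] :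
    Continuous (James.incl : X → James X) :=
  James.continuous_word.comp (continuous_sigmaMk.comp (Power.continuous_mk fun _ => continuous_id))

end James

/-! ### Pointed homotopy classes -/

/-- Pointed continuous maps. -/
def PMap (A B : Type u) [TopologicalSpace A] [BasePoint A] [TopologicalSpace B] [BasePoint B] :
    Type u := {f : C(A, B) // f pt = pt}

/-- Pointed homotopy of pointed maps. -/
def pmapSetoid (A B : Type u) [TopologicalSpace A] [BasePoint A] [TopologicalSpace B]
    [BasePoint B] : Setoid (PMap A B) where
  r f g := f.1.HomotopicRel g.1 {pt}
  iseqv := ⟨fun f => .refl f.1, fun h => h.symm, fun h h' => h.trans h'⟩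

/-- The set `[A, B]` of pointed homotopy classes of pointed maps. -/
def PClass (A B : Type u) [TopologicalSpace A] [BasePoint A] [TopologicalSpace B] [BasePoint B] :
    Type u := Quotient (pmapSetoid A B)

section PClass

variable {A A' B X : Type u} [TopologicalSpace A] [BasePoint A] [TopologicalSpace A']
  [BasePoint A'] [TopologicalSpace B] [BasePoint B] [TopologicalSpace X] [BasePoint X]

/-- The class of a pointed map. -/
def PClass.mk (f : PMap A B) : PClass A B := Quotient.mk (pmapSetoid A B) f

/-- Composition of pointed maps. -/
def PMap.comp (f : PMap A' B) (φ : PMap A A') : PMap A B :=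
  ⟨f.1.comp φ.1, by rw [ContinuousMap.comp_apply, φ.2, f.2]⟩

/-- The pointwise product of pointed maps into `J(X)`. -/
def PMap.mul [CompactlyGeneratedSpace A] (f g : PMap A (James X)) : PMap A (James X) :=
  ⟨⟨fun a => f.1 a * g.1 a, James.continuous_mul f.1.continuous g.1.continuous⟩, by
    change f.1 pt * g.1 pt = pt
    rw [f.2, g.2]
    exact one_mul (1 : James X)⟩

/-- The constant map to the unit of `J(X)`. -/
def PMap.one : PMap A (James X) := ⟨ContinuousMap.const A 1, rfl⟩

/-- `[A, J(X)]` is a monoid under pointwise multiplication. -/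
instance [CompactlyGeneratedSpace A] : Monoid (PClass A (James X)) where
  mul := Quotient.map₂ PMap.mul <| by
    rintro f f' ⟨F⟩ g g' ⟨G⟩
    have : CompactlyGeneratedSpace (unitInterval × A) := cg_interval
    exact ⟨{
      toFun := fun p => F p * G p
      continuous_toFun := James.continuous_mul F.continuous G.continuous
      map_zero_left := fun a => by
        change F (0, a) * G (0, a) = f.1 a * g.1 a
        rw [F.apply_zero, G.apply_zero]
      map_one_left := fun a => by
        change F (1, a) * G (1, a) = f'.1 a * g'.1 a
        rw [F.apply_one, G.apply_one]
      prop' := fun t a ha => by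
        change F (t, a) * G (t, a) = f.1 a * g.1 a
        rw [F.eq_fst t ha, G.eq_fst t ha] }⟩
  one := PClass.mk PMap.one
  mul_assoc := by
    rintro ⟨f⟩ ⟨g⟩ ⟨h⟩
    exact congrArg PClass.mk (Subtype.ext (ContinuousMap.ext fun a => mul_assoc _ _ _))
  one_mul := by
    rintro ⟨f⟩
    exact congrArg PClass.mk (Subtype.ext (ContinuousMap.ext fun a => one_mul _))
  mul_one := by
    rintro ⟨f⟩
    exact congrArg PClass.mk (Subtype.ext (ContinuousMap.ext fun a => mul_one _))

/-- The homomorphism `φ^* : [A', J(X)] → [A, J(X)]` induced by a pointed map `φ : A → A'`. -/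
def pullback [CompactlyGeneratedSpace A] [CompactlyGeneratedSpace A'] (φ : PMap A A') :
    PClass A' (James X) →* PClass A (James X) where
  toFun := Quotient.map (fun f => f.comp φ) <| by
    rintro f g ⟨F⟩
    exact ⟨{
      toFun := fun p => F (p.1, φ.1 p.2)
      continuous_toFun := by fun_prop
      map_zero_left := fun a => F.apply_zero _
      map_one_left := fun a => F.apply_one _
      prop' := fun t a ha => F.eq_fst t (by rw [mem_singleton_iff.1 ha]; exact φ.2) }⟩
  map_one' := rfl
  map_mul' := by rintro ⟨f⟩ ⟨g⟩; rfl

/-- The group of invertible pointed homotopy classes of maps `A → J(X)`; it is the whole of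
`[A, J(X)]` as soon as every class is invertible. -/
abbrev HGroup (A X : Type u) [TopologicalSpace A] [BasePoint A] [CompactlyGeneratedSpace A]
    [TopologicalSpace X] [BasePoint X] : Type u := (PClass A (James X))ˣ

/-- The homomorphism `φ^*` on groups of homotopy classes. -/
abbrev gpullback [CompactlyGeneratedSpace A] [CompactlyGeneratedSpace A'] (φ : PMap A A') :
    HGroup A' X →* HGroup A X := Units.map (pullback φ)

end PClass

/-! ### Hypotheses on the space -/

/-- The base point is non-degenerate: `(X, pt)` is an NDR pair. -/
def NondegenerateBasePoint (X : Type u) [TopologicalSpace X] [BasePoint X] : Prop :=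
  ∃ (v : C(X, unitInterval)) (h : C(unitInterval × X, X)),
    (∀ x, v x = 0 ↔ x = pt) ∧ (∀ x, h (0, x) = x) ∧ (∀ t, h (t, pt) = pt) ∧
      ∀ x, v x < 1 → h (1, x) = pt

/-- The reduced diagonal `X → X ∧ X`. -/
def reducedDiagonal (X : Type u) [TopologicalSpace X] [CompactlyGeneratedSpace X] [BasePoint X] :
    PMap X (Smash 2 X) :=
  ⟨⟨fun x => Smash.mk (KIfy.of fun _ => x),
    Smash.continuous_mk.comp (Power.continuous_mk fun _ => continuous_id)⟩, rfl⟩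

/-- Weak Lusternik–Schnirelmann category less than 2: the reduced diagonal is null homotopic. -/
def WeakCatLtTwo (X : Type u) [TopologicalSpace X] [CompactlyGeneratedSpace X] [BasePoint X] :
    Prop :=
  (reducedDiagonal X).1.HomotopicRel (ContinuousMap.const X pt) {pt}

/-! ### The combinatorial groups -/

section Combinatorial

/-- The commutator `[x, y] = x⁻¹ y⁻¹ x y`. -/
def comm {G : Type*} [Group G] (x y : G) : G := x⁻¹ * y⁻¹ * x * y

/-- The iterated commutator `[⋯[[a, b₁], b₂], ⋯, b_m]`. -/
def iterComm {G : Type*} [Group G] (a : G) (b : List G) : G := b.foldl comm a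

variable {ι κ : Type} {k : ℕ}

/-- The defining relators of `K(k)` with indices in `ι`; the generator `{x_{i₁}|⋯|x_{i_k}}` is the
index tuple `(i₁, …, i_k)`. -/
inductive CohenRel (ι : Type) (k : ℕ) : FreeGroup (Fin k → ι) → Prop
  /-- A generator with a repeated index is trivial. -/
  | gen (I : Fin k → ι) (h : ¬ Function.Injective I) : CohenRel ι k (FreeGroup.of I)
  /-- An iterated commutator of generators in which some index occurs twice is trivial. -/
  | comm (I : Fin k → ι) (w : List (Fin k → ι)) (h : ¬ ((I :: w).flatMap List.ofFn).Nodup) :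
      CohenRel ι k (iterComm (FreeGroup.of I) (w.map FreeGroup.of))
  /-- Iterated commutators of powers of generators. -/
  | pow (I : Fin k → ι) (m : ℤ) (w : List ((Fin k → ι) × ℤ)) :
      CohenRel ι k (iterComm (FreeGroup.of I ^ m) (w.map fun p => FreeGroup.of p.1 ^ p.2) *
        (iterComm (FreeGroup.of I) (w.map fun p => FreeGroup.of p.1) ^
          (m * (w.map Prod.snd).prod))⁻¹)

/-- The combinatorial group `K_N(k)`, with the index set `{1, …, N}` replaced by any set `ι`. -/
abbrev CohenGroup (ι : Type) (k : ℕ) : Type := PresentedGroup {r | CohenRel ι k r}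

/-- The generator `{x_{i₁}|⋯|x_{i_k}}`. -/
def cgen (I : Fin k → ι) : CohenGroup ι k := PresentedGroup.of I

/-- Renaming of indices along a partially defined map `f : ι → κ`; a generator that involves an
index on which `f` is undefined goes to `1`. -/
def renameGen (f : ι → Option κ) (I : Fin k → ι) : CohenGroup κ k :=
  if h : ∀ j, (f (I j)).isSome then cgen fun j => (f (I j)).get (h j) else 1

theorem iterComm_eq_one {G : Type*} [Group G] (b : List G) (a : G) (h : a = 1 ∨ (1 : G) ∈ b) :
    iterComm a b = 1 := by
  induction b generalizing a with
  | nil => simpa [iterComm] using h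
  | cons c b ih =>
    refine ih (GeoReal.comm a c) ?_
    rcases h with rfl | h
    · left; simp [GeoReal.comm]
    · rcases List.mem_cons.1 h with rfl | h
      · left; simp [GeoReal.comm]
      · exact Or.inr h

theorem map_iterComm {G H : Type*} [Group G] [Group H] (φ : G →* H) (a : G) (b : List G) :
    φ (iterComm a b) = iterComm (φ a) (b.map φ) := by
  induction b generalizing a with
  | nil => rfl
  | cons c b ih =>
    refine (ih (GeoReal.comm a c)).trans ?_
    simp [iterComm, GeoReal.comm]

theorem cohen_one_of_rel {r : FreeGroup (Fin k → ι)} (h : CohenRel ι k r) :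
    FreeGroup.lift (cgen : (Fin k → ι) → CohenGroup ι k) r = 1 := by
  have e : FreeGroup.lift (cgen : (Fin k → ι) → CohenGroup ι k) =
      PresentedGroup.mk {r | CohenRel ι k r} := by
    ext I
    simp [cgen, PresentedGroup.of]
  rw [e]
  exact PresentedGroup.one_of_mem h

theorem rename_rel (f : ι → Option κ) {r : FreeGroup (Fin k → ι)} (h : CohenRel ι k r) :
    FreeGroup.lift (renameGen f) r = 1 := by
  classical
  have dead : ∀ I : Fin k → ι, (¬ ∀ j, (f (I j)).isSome) →
      renameGen f I = (1 : CohenGroup κ k) := fun I hI => dif_neg hI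
  have live : ∀ (I : Fin k → ι) (I' : Fin k → κ), (∀ j, f (I j) = some (I' j)) →
      renameGen f I = cgen I' := by
    intro I I' hI
    have h1 : ∀ j, (f (I j)).isSome := fun j => by rw [hI j]; rfl
    unfold renameGen
    rw [dif_pos h1]
    congr 1
    funext j
    simp [hI j]
  have choose : ∀ I : Fin k → ι, (∀ j, (f (I j)).isSome) →
      ∃ I' : Fin k → κ, ∀ j, f (I j) = some (I' j) := fun I hI =>
    ⟨fun j => (f (I j)).get (hI j), fun j => by simp⟩
  induction h with
  | gen I h =>
    rw [FreeGroup.lift_apply_of]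
    by_cases hI : ∀ j, (f (I j)).isSome
    · obtain ⟨I', hI'⟩ := choose I hI
      rw [live I I' hI', ← FreeGroup.lift_apply_of (f := (cgen : (Fin k → κ) → CohenGroup κ k))]
      refine cohen_one_of_rel (.gen I' fun hinj => h fun a b hab => hinj ?_)
      have := hI' a
      rw [hab, hI' b] at this
      exact (Option.some.inj this).symm
    · exact dead I hI
  | comm I w h =>
    by_cases hall : ∀ J ∈ I :: w, ∀ j, (f (J j)).isSome
    · have hw : ∀ v : List (Fin k → ι), (∀ J ∈ v, ∀ j, (f (J j)).isSome) →
          ∃ v' : List (Fin k → κ),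
            (v.flatMap List.ofFn).map f = (v'.flatMap List.ofFn).map some ∧
            v.map (renameGen f) = v'.map cgen := by
        intro v hv
        induction v with
        | nil => exact ⟨[], rfl, rfl⟩
        | cons J v ih =>
          obtain ⟨v', h1, h2⟩ := ih fun J' hJ' => hv J' (List.mem_cons_of_mem _ hJ')
          obtain ⟨J', hJ'⟩ := choose J (hv J List.mem_cons_self)
          refine ⟨J' :: v', ?_, ?_⟩
          · have : f ∘ J = some ∘ J' := funext hJ'
            simp [h1, this, List.map_ofFn]
          · simp [h2, live J J' hJ']
      obtain ⟨I', hI'⟩ := choose I (hall I List.mem_cons_self)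
      obtain ⟨w', h1, h2⟩ := hw w fun J hJ => hall J (List.mem_cons_of_mem _ hJ)
      have key : FreeGroup.lift (cgen : (Fin k → κ) → CohenGroup κ k)
          (iterComm (FreeGroup.of I') (w'.map FreeGroup.of)) = 1 := by
        refine cohen_one_of_rel (.comm I' w' fun hnd => h ?_)
        have e : ((I :: w).flatMap List.ofFn).map f = ((I' :: w').flatMap List.ofFn).map some := by
          have : f ∘ I = some ∘ I' := funext hI'
          simp [h1, this, List.map_ofFn]
        refine List.Nodup.of_map f ?_
        rw [e]
        exact hnd.map (Option.some_injective κ)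
      rw [map_iterComm, FreeGroup.lift_apply_of, List.map_map] at key ⊢
      have e1 : (⇑(FreeGroup.lift (renameGen (k := k) f)) ∘ FreeGroup.of) = renameGen f :=
        funext fun _ => FreeGroup.lift_apply_of
      have e2 : (⇑(FreeGroup.lift (cgen : (Fin k → κ) → CohenGroup κ k)) ∘ FreeGroup.of) = cgen :=
        funext fun _ => FreeGroup.lift_apply_of
      rw [e2] at key
      rw [e1, h2, live I I' hI', key]
    · push Not at hall
      obtain ⟨J, hJ, hJd⟩ := hall
      have hd := dead J (by push Not; exact hJd)
      rw [map_iterComm, FreeGroup.lift_apply_of]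
      refine iterComm_eq_one _ _ ?_
      rcases List.mem_cons.1 hJ with rfl | hJ
      · exact Or.inl hd
      · refine Or.inr (List.mem_map.2 ⟨FreeGroup.of J, List.mem_map.2 ⟨J, hJ, rfl⟩, ?_⟩)
        rw [FreeGroup.lift_apply_of, hd]
  | pow I m w =>
    have e1 : ∀ v : List ((Fin k → ι) × ℤ),
        (v.map fun p => FreeGroup.of p.1 ^ p.2).map (FreeGroup.lift (renameGen (k := k) f)) =
          v.map fun p => renameGen f p.1 ^ p.2 := by
      intro v; simp
    have e2 : ∀ v : List ((Fin k → ι) × ℤ),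
        (v.map fun p => FreeGroup.of p.1).map (FreeGroup.lift (renameGen (k := k) f)) =
          v.map fun p => renameGen f p.1 := by
      intro v; simp
    rw [map_mul, map_inv, map_zpow, map_iterComm, map_iterComm, map_zpow, FreeGroup.lift_apply_of,
      e1, e2]
    by_cases hall : (∀ j, (f (I j)).isSome) ∧ ∀ p ∈ w, ∀ j, (f (p.1 j)).isSome
    · have hw : ∀ v : List ((Fin k → ι) × ℤ), (∀ p ∈ v, ∀ j, (f (p.1 j)).isSome) →
          ∃ v' : List ((Fin k → κ) × ℤ), v.map Prod.snd = v'.map Prod.snd ∧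
            (v.map fun p => renameGen f p.1 ^ p.2) = (v'.map fun p => cgen p.1 ^ p.2) ∧
            (v.map fun p => renameGen f p.1) = v'.map fun p => cgen p.1 := by
        intro v hv
        induction v with
        | nil => exact ⟨[], rfl, rfl, rfl⟩
        | cons p v ih =>
          obtain ⟨v', h1, h2, h3⟩ := ih fun J' hJ' => hv J' (List.mem_cons_of_mem _ hJ')
          obtain ⟨J', hJ'⟩ := choose p.1 (hv p List.mem_cons_self)
          refine ⟨(J', p.2) :: v', ?_, ?_, ?_⟩
          · simp [h1]
          · simp [h2, live p.1 J' hJ']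
          · simp [h3, live p.1 J' hJ']
      obtain ⟨I', hI'⟩ := choose I hall.1
      obtain ⟨w', h1, h2, h3⟩ := hw w hall.2
      have key := cohen_one_of_rel (CohenRel.pow I' m w')
      rw [map_mul, map_inv, map_zpow, map_iterComm, map_iterComm, map_zpow,
        FreeGroup.lift_apply_of] at key
      simp only [List.map_map, Function.comp_def, map_zpow, FreeGroup.lift_apply_of] at key
      rw [live I I' hI', h1, h2, h3]
      exact key
    · have hd : renameGen f I = (1 : CohenGroup κ k) ∨ ∃ p ∈ w,
          renameGen f p.1 = (1 : CohenGroup κ k) := by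
        by_cases hI : ∀ j, (f (I j)).isSome
        · have : ¬ ∀ p ∈ w, ∀ j, (f (p.1 j)).isSome := fun h => hall ⟨hI, h⟩
          push Not at this
          obtain ⟨p, hp, hpd⟩ := this
          exact Or.inr ⟨p, hp, dead p.1 (by push Not; exact hpd)⟩
        · exact Or.inl (dead I hI)
      have a1 : iterComm (renameGen f I ^ m : CohenGroup κ k)
          (w.map fun p => renameGen f p.1 ^ p.2) = 1 := by
        refine iterComm_eq_one _ _ ?_
        rcases hd with h | ⟨p, hp, h⟩
        · left; rw [h, one_zpow]
        · exact Or.inr (List.mem_map.2 ⟨p, hp, by rw [h, one_zpow]⟩)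
      have a2 : iterComm (renameGen f I : CohenGroup κ k)
          (w.map fun p => renameGen f p.1) = 1 := by
        refine iterComm_eq_one _ _ ?_
        rcases hd with h | ⟨p, hp, h⟩
        · exact Or.inl h
        · exact Or.inr (List.mem_map.2 ⟨p, hp, h⟩)
      rw [a1, a2, one_zpow, inv_one, one_mul]

/-- The homomorphism of combinatorial groups renaming indices along a partial map. -/
def rename (f : ι → Option κ) : CohenGroup ι k →* CohenGroup κ k :=
  PresentedGroup.toGroup (f := renameGen f) fun _ h => rename_rel f h

open Classical in
/-- The partial identity of `ι` that is undefined on `T`. -/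
def kill (T : Set ι) (i : ι) : Option ι := if i ∈ T then none else some i

/-- The indices of the block `s`, that is, `x_{sl+1}, …, x_{sl+l}`. -/
def block {n l : ℕ} (s : Fin n) : Set (Fin n × Fin l) := {p | p.1 = s}

/-- The partial map `{1, …, n} × {1, …, l} → {1, …, n-1} × {1, …, l}` that is undefined on the block
`s` and moves the later blocks down by one. -/
def dropBlock {n l : ℕ} (s : Fin n) (p : Fin n × Fin l) : Option (Fin (n - 1) × Fin l) :=
  if h : p.1 < s then some (⟨p.1, by omega⟩, p.2)
  else if h' : p.1 = s then none
  else some (⟨p.1 - 1, by omega⟩, p.2)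

/-- The combinatorial group `H_n^{(l)(k)}`, a subgroup of `K_{ln}(k)`; the `ln` indices are written
as pairs `(s, j)` of a block `s` and a position `j` in it. It consists of the elements `a` such
that killing a single index `(s, j)` has the same effect on `a` as killing the whole block `s`, and
whose images under the projections `D_s : K_{ln}(k) → K_{l(n-1)}(k)` all agree. -/
def HComb (n l k : ℕ) : Subgroup (CohenGroup (Fin n × Fin l) k) :=
  (⨅ p : Fin n × Fin l,
      (rename (k := k) (kill {p})).eqLocus (rename (kill (block p.1)))) ⊓
    ⨅ (s : Fin n) (t : Fin n), (rename (k := k) (dropBlock s)).eqLocus (rename (dropBlock t))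

end Combinatorial

/-! ### The geometric groups -/

section Geometric

variable {ι κ : Type} (k n l : ℕ) (X : Type u) [TopologicalSpace X] [BasePoint X]

/-- The coordinate inclusion `X ^ κ → X ^ ι` of a partial map `f : ι → κ`: the coordinate `i` of the
image is the coordinate `f i`, and the base point if `f i` is undefined. -/
def insertPt (f : ι → Option κ) : PMap (Power κ X) (Power ι X) :=
  ⟨⟨fun y => KIfy.of fun i => (f i).elim pt y.out, Power.continuous_mk fun i => by
      cases f i with
      | none => exact continuous_const
      | some c => exact Power.continuous_apply c⟩, by
    refine congrArg KIfy.of (funext fun i => ?_)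
    change (f i).elim pt (fun _ => pt) = pt
    cases f i <;> rfl⟩

variable {k}

/-- The composite `E ∘ p_{i₁⋯i_k} : X ^ ι → X^{(k)} → J(X^{(k)})`,
`x ↦ x_{i₁} ∧ ⋯ ∧ x_{i_k}`. -/
def genMap (I : Fin k → ι) : PMap (Power ι X) (James (Smash k X)) :=
  ⟨⟨fun x => James.incl (Smash.mk (KIfy.of fun j => x.out (I j))),
    James.continuous_incl.comp (Smash.continuous_mk.comp
      (Power.continuous_mk fun j => Power.continuous_apply (I j)))⟩, by
    refine Subtype.ext ?_
    change reduceWord (fun _ : Fin 1 => (pt : Smash k X)) = []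
    simp [reduceWord]⟩

/-- The homotopy class `{x_{i₁}|⋯|x_{i_k}}` in `[X ^ ι, J(X^{(k)})]`. -/
def geoGen (I : Fin k → ι) : PClass (Power ι X) (James (Smash k X)) := PClass.mk (genMap X I)

variable (k) (ι)

/-- The subgroup `K(k)(X)` of `[X ^ ι, J(X^{(k)})]` generated by the classes
`{x_{i₁}|⋯|x_{i_k}}`. -/
def KGeo : Subgroup (HGroup (Power ι X) (Smash k X)) :=
  Subgroup.closure {a | ∃ I : Fin k → ι, (a : PClass _ _) = geoGen X I}

/-- The quotient map `X^{ln} → (X^{(l)})^n → J_n(X^{(l)})`. -/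
def quotMap : PMap (Power (Fin n × Fin l) X) (JamesFil n (Smash l X)) :=
  ⟨⟨fun x => JamesFil.word (KIfy.of fun s => Smash.mk (KIfy.of fun j => x.out (s, j))),
    JamesFil.continuous_word.comp (Power.continuous_mk fun s => Smash.continuous_mk.comp
      (Power.continuous_mk fun j => Power.continuous_apply (s, j)))⟩, by
    refine Subtype.ext ?_
    change reduceWord (fun _ : Fin n => (pt : Smash l X)) = []
    simp [reduceWord]⟩

/-- The group `H_n^{(l)(k)}(X)`: the subgroup of `[J_n(X^{(l)}), J(X^{(k)})]` of the classes whose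
restriction to `X^{ln}` lies in `K_{ln}(k)(X)` and satisfies the same conditions as in the
combinatorial group, the projections being induced by coordinate inclusions. -/
def HGeo : Subgroup (HGroup (JamesFil n (Smash l X)) (Smash k X)) :=
  Subgroup.comap (gpullback (quotMap n l X)) <|
    KGeo (Fin n × Fin l) k X ⊓
    (⨅ p : Fin n × Fin l, (gpullback (X := Smash k X) (insertPt X (kill {p}))).eqLocus
        (gpullback (insertPt X (kill (block p.1))))) ⊓
      ⨅ (s : Fin n) (t : Fin n), (gpullback (X := Smash k X)
        (insertPt X (dropBlock (l := l) s))).eqLocus (gpullback (insertPt X (dropBlock t)))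

end Geometric

end GeoReal
end

open Topology Set

namespace GeoReal
set_option linter.unusedSectionVars false
noncomputable section

/-! ### Compactly generated spaces and quotient maps -/

/-! Write Z for the k-fold smash power of X. The proof needs inverses up to homotopy in J(Z), a
supply of commuting classes, and a description of the classes that factor through q.

Inverses. A null homotopy F of the reduced diagonal starts at x ∧ x. As long as F stays off the base
point its two coordinates are defined, and following one of them moves x into the NDR neighbourhood,
hence to the base point. This gives countably many cozero sets contractible in X
(`exists_cover_of_weakCatLtTwo`). Over the resulting cover of X^k the map to J(Z) is null homotopic,
so the constant 1 is a local right inverse of it. These local inverses, with their null homotopies,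
are glued by an explicit deformation (`exists_rightInverse_of_cover`) and extended to words letter
by letter in reverse order (`RightInv.nonempty_of_incl`). Every class in [A, J(Z)] then has a right
inverse, so this monoid is a group.

Relations. If a class dies when either of two coordinates is killed, it has a representative that is
strictly trivial there, and identifying the two coordinates makes it factor through the reduced
diagonal, hence die (`pullback_insertPt_eq_one`). Applied to a commutator with one coordinate
doubled, this shows that the kernel of killing coordinate i is an abelian normal subgroup
(`commute_of_kill_eq_one`). A generator lies in the kernel of each of its indices, and the relations
of the combinatorial group follow by commutator algebra (`lift_geoGen_eq_one`).

Injectivity of q^*. By induction on n a class in the kernel may be taken trivial on the image of the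
fat wedge. The group structure makes its null homotopy upstairs trivial on the fat wedge too, so
that it descends (`eq_one_of_pullback_quotMap`).

Descent. Given a class a satisfying the conditions, the common value of the D_s a comes from
J(X^{(l)}) by induction. Dividing a by the pullback of that extension leaves a class that dies on
the fat wedge. It extends over J(X^{(l)}) by the ordered product over subwords, as for James–Hopf
maps (`James.exists_extension`, `exists_gpullback_jamesQuot`). Restricting to J_n gives the required
lift, and injectivity makes the lifts a homomorphism. -/

instance instCompactlyGeneratedInterval {A : Type u} [TopologicalSpace A]
    [CompactlyGeneratedSpace A] : CompactlyGeneratedSpace (unitInterval × A) := cg_interval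

/-- Testing on `Z = Y` with the coinduced topology and `f = id` suffices: continuity says that the
given topology is at least as fine as the coinduced one. -/
theorem isQuotientMap_of_lift {A Y : Type u} [TopologicalSpace A] [TopologicalSpace Y] {q : A → Y}
    (hq : Continuous q) (hs : Function.Surjective q)
    (h : ∀ {Z : Type u} [TopologicalSpace Z] (f : Y → Z), Continuous (f ∘ q) → Continuous f) :
    IsQuotientMap q := by
  refine ⟨⟨le_antisymm ?_ hq.coinduced_le⟩, hs⟩
  let t : TopologicalSpace Y := TopologicalSpace.coinduced q inferInstance
  exact continuous_id_iff_le.1 (@h Y t id continuous_coinduced_rng)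

/-- Finite powers of a quotient map of compactly generated spaces are quotient maps. -/
theorem isQuotientMap_powerMap {ι : Type} [Finite ι] {A Y : Type u} [TopologicalSpace A]
    [CompactlyGeneratedSpace A] [TopologicalSpace Y] {q : A → Y} (hq : IsQuotientMap q) :
    IsQuotientMap (fun x : Power ι A => (KIfy.of fun i => q (x.out i) : Power ι Y)) := by
  classical
  refine isQuotientMap_of_lift
    (Power.continuous_mk fun i => hq.continuous.comp (Power.continuous_apply i)) ?_ ?_
  · intro y
    choose a ha using fun i => hq.surjective (y.out i)
    exact ⟨KIfy.of a, funext ha⟩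
  intro Z _ F hF
  have := Fintype.ofFinite ι
  -- `S` contains the coordinates not yet known to lift to `A`. They are lifted one at a time: for
  -- compact `K` the map `q × id` on `A × K` is still a quotient map, and over compact test spaces
  -- of `A × K` coordinate `j` has a lift.
  have key : ∀ (S : Finset ι) (K : Type u) [TopologicalSpace K] [CompactSpace K] [T2Space K]
      (y : K → ι → Y), (∀ i, Continuous fun k => y k i) →
      (∀ i, i ∉ S → ∃ a : K → A, Continuous a ∧ ∀ k, y k i = q (a k)) →
      Continuous fun k => F (KIfy.of (y k)) := by
    intro S
    induction S using Finset.induction_on with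
    | empty =>
      intro K _ _ _ y hy h
      choose a ha hay using fun i => h i (Finset.notMem_empty i)
      have e : (fun k => F (KIfy.of (y k))) = fun k =>
          (F ∘ fun x : Power ι A => (KIfy.of fun i => q (x.out i) : Power ι Y))
            (KIfy.of fun i => a i k) := by
        funext k
        exact congrArg F (funext fun i => hay i k)
      rw [e]
      exact hF.comp (Power.continuous_mk ha)
    | insert j S hj ih =>
      intro K _ _ _ y hy h
      have hg : Continuous fun p : Y × K => F (KIfy.of (Function.update (y p.2) j p.1)) := by
        refine hq.continuous_lift_prod_left ?_
        have : CompactlyGeneratedSpace (A × K) := cg_prod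
        refine continuous_from_compactlyGeneratedSpace _ fun L _ _ _ g hg => ?_
        refine ih L (fun s => Function.update (y (g s).2) j (q (g s).1)) (fun i => ?_)
          (fun i hi => ?_)
        · by_cases hij : i = j
          · subst hij
            simpa [Function.comp_def] using hq.continuous.comp (continuous_fst.comp hg)
          · simpa [Function.update_of_ne hij, Function.comp_def] using
              (hy i).comp (continuous_snd.comp hg)
        · by_cases hij : i = j
          · subst hij
            exact ⟨fun s => (g s).1, continuous_fst.comp hg, fun s => by simp⟩
          · obtain ⟨a, ha, hay⟩ := h i (by simp [hij, hi])
            exact ⟨fun s => a (g s).2, ha.comp (continuous_snd.comp hg), fun s => by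
              rw [Function.update_of_ne hij, hay]⟩
      have := hg.comp ((hy j).prodMk continuous_id)
      simpa [Function.comp_def] using this
  refine continuous_from_compactlyGeneratedSpace F fun K _ _ _ g hg => ?_
  exact key Finset.univ K (fun k => (g k).out) (fun i => (Power.continuous_apply i).comp hg)
    fun i hi => absurd (Finset.mem_univ i) hi

/-! ### Smash powers, words and blocks as quotients of powers -/

section Smash

variable {k : ℕ} {X : Type u} [TopologicalSpace X] [BasePoint X]

theorem Smash.isQuotientMap_mk : IsQuotientMap (Smash.mk : Power (Fin k) X → Smash k X) :=
  isQuotientMap_quotient_mk'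

theorem Smash.mk_eq_pt {x : Power (Fin k) X} (h : ∃ i, x.out i = pt) :
    Smash.mk x = (pt : Smash k X) :=
  Quotient.sound (Or.inr ⟨h, h.imp fun _ _ => rfl⟩)

theorem Smash.mk_eq_mk_iff {x y : Power (Fin k) X} :
    Smash.mk x = Smash.mk y ↔ x = y ∨ ((∃ i, x.out i = pt) ∧ ∃ i, y.out i = pt) :=
  ⟨fun h => Quotient.exact h, fun h => Quotient.sound h⟩

/-- For `k = 0` the only tuple represents the base point although its fat wedge is empty; hence `1 ≤
k`. -/
theorem Smash.mk_eq_pt_iff (hk : 1 ≤ k) {x : Power (Fin k) X} :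
    Smash.mk x = (pt : Smash k X) ↔ ∃ i, x.out i = pt := by
  refine ⟨fun h => ?_, Smash.mk_eq_pt⟩
  rcases Smash.mk_eq_mk_iff.1 h with rfl | h
  · exact ⟨⟨0, hk⟩, rfl⟩
  · exact h.1

end Smash

section James

variable {X : Type u} [BasePoint X]

theorem James.incl_val [DecidableEq X] (x : X) :
    (James.incl x).1 = if x = pt then [] else [x] := by
  change reduceWord (fun _ : Fin 1 => x) = _
  by_cases h : x = pt <;> simp [reduceWord, h]

@[simp]
theorem James.incl_pt : James.incl (pt : X) = 1 := by
  classical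
  exact Subtype.ext (by rw [James.incl_val, if_pos rfl]; rfl)

variable [TopologicalSpace X]

instance instCompactlyGeneratedJames : CompactlyGeneratedSpace (James X) :=
  compactlyGeneratedSpace_of_coinduced James.continuous_word rfl

theorem JamesFil.isQuotientMap_word {n : ℕ} :
    IsQuotientMap (JamesFil.word : Power (Fin n) X → JamesFil n X) := by
  classical
  refine ⟨⟨rfl⟩, fun a => ?_⟩
  -- Pad the word with base points up to length `n`; the reduction deletes them again.
  refine ⟨KIfy.of fun i => if h : i.1 < a.1.length then a.1.get ⟨i, h⟩ else pt, Subtype.ext ?_⟩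
  change reduceWord (fun i : Fin n => if h : i.1 < a.1.length then a.1.get ⟨i, h⟩ else pt) = a.1
  obtain ⟨m, hm⟩ := Nat.exists_eq_add_of_le a.2.2
  have e : List.ofFn (fun i : Fin n => if h : i.1 < a.1.length then a.1.get ⟨i, h⟩ else pt) =
      a.1 ++ List.replicate m pt := by
    refine List.ext_getElem (by simp [hm]) fun i h1 h2 => ?_
    simp only [List.getElem_ofFn, List.get_eq_getElem]
    split_ifs with h
    · rw [List.getElem_append_left h]
    · rw [List.getElem_append_right (not_lt.1 h), List.getElem_replicate]
  unfold reduceWord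
  rw [e, List.filter_append, List.filter_eq_self.2, List.filter_eq_nil_iff.2, List.append_nil]
  · intro x hx
    simp [List.eq_of_mem_replicate hx]
  · intro x hx
    simpa using fun h : x = pt => a.2.1 (h ▸ hx)

end James

section Blocks

variable (ι : Type) (l : ℕ) (X : Type u) [TopologicalSpace X] [BasePoint X]

/-- The map `X^{ι × l} → (X^{(l)})^ι` taking the smash product of each block. -/
def blockMap (x : Power (ι × Fin l) X) : Power ι (Smash l X) :=
  KIfy.of fun s => Smash.mk (KIfy.of fun j => x.out (s, j))

theorem isQuotientMap_blockMap [Finite ι] : IsQuotientMap (blockMap ι l X) := by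
  let e : Power (ι × Fin l) X ≃ₜ Power ι (Power (Fin l) X) :=
    { toFun := fun x => KIfy.of fun s => KIfy.of fun j => x.out (s, j)
      invFun := fun y => KIfy.of fun p => (y.out p.1).out p.2
      left_inv := fun x => rfl
      right_inv := fun x => rfl
      continuous_toFun := Power.continuous_mk fun s => Power.continuous_mk fun j =>
        Power.continuous_apply (s, j)
      continuous_invFun := Power.continuous_mk fun p =>
        (Power.continuous_apply p.2).comp (Power.continuous_apply p.1) }
  exact (isQuotientMap_powerMap (ι := ι) (Smash.isQuotientMap_mk (k := l) (X := X))).comp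
    e.isQuotientMap

theorem isQuotientMap_quotMap (n : ℕ) : IsQuotientMap (quotMap n l X).1 :=
  JamesFil.isQuotientMap_word.comp (isQuotientMap_blockMap (Fin n) l X)

end Blocks

/-! ### Pointed classes and their functoriality -/

section Classes

variable {A B : Type u} [TopologicalSpace A] [BasePoint A] [TopologicalSpace B] [BasePoint B]

theorem PClass.mk_eq_mk_iff {f g : PMap A B} :
    PClass.mk f = PClass.mk g ↔ f.1.HomotopicRel g.1 {pt} :=
  ⟨fun h => Quotient.exact h, fun h => Quotient.sound h⟩

theorem PClass.exists_mk (a : PClass A B) :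
    ∃ f, PClass.mk f = a := Quotient.exists_rep a

theorem PMap.ext {f g : PMap A B}
    (h : ∀ a, f.1 a = g.1 a) : f = g :=
  Subtype.ext (ContinuousMap.ext h)

end Classes

section Functoriality

variable {A A' A'' : Type u} [TopologicalSpace A] [BasePoint A] [TopologicalSpace A']
  [BasePoint A'] [TopologicalSpace A''] [BasePoint A''] [CompactlyGeneratedSpace A]
  [CompactlyGeneratedSpace A'] [CompactlyGeneratedSpace A''] {Z : Type u} [TopologicalSpace Z]
  [BasePoint Z]

@[simp]
theorem pullback_mk (φ : PMap A A') (f : PMap A' (James Z)) :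
    pullback φ (PClass.mk f) = PClass.mk (f.comp φ) := rfl

theorem PClass.mk_mul (f g : PMap A (James Z)) :
    PClass.mk f * PClass.mk g = PClass.mk (f.mul g) := rfl

theorem PClass.one_def : (1 : PClass A (James Z)) = PClass.mk PMap.one := rfl

theorem pullback_pullback (φ : PMap A A') (ψ : PMap A' A'') (a : PClass A'' (James Z)) :
    pullback φ (pullback ψ a) = pullback (ψ.comp φ) a := by
  obtain ⟨f, rfl⟩ := a.exists_mk
  rfl

theorem gpullback_gpullback (φ : PMap A A') (ψ : PMap A' A'') (a : HGroup A'' Z) :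
    gpullback φ (gpullback ψ a) = gpullback (ψ.comp φ) a :=
  Units.ext (pullback_pullback φ ψ a.1)

theorem insertPt_comp {ι κ μ : Type} (X : Type u) [TopologicalSpace X] [BasePoint X]
    (f : ι → Option κ) (g : κ → Option μ) :
    (insertPt X f).comp (insertPt X g) = insertPt X fun i => (f i).bind g := by
  refine PMap.ext fun y => ?_
  refine funext fun i => ?_
  change (f i).elim pt (fun j => (g j).elim pt y) = ((f i).bind g).elim pt y
  cases f i <;> rfl

theorem insertPt_some {ι : Type} (X : Type u) [TopologicalSpace X] [BasePoint X]
    (a : PClass (Power ι X) (James Z)) : pullback (insertPt X (some : ι → Option ι)) a = a := by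
  obtain ⟨f, rfl⟩ := a.exists_mk
  exact congrArg PClass.mk (PMap.ext fun _ => rfl)

end Functoriality

/-! ### Gluing right inverses over a countable numerable cover -/

section Glue

variable {Z : Type u} [BasePoint Z]

/-- The path from `χ` to `1` that first follows `c * χ` backwards, then `γ`. -/
def glueAux (d : ℝ) (c : ℝ → James Z) (p : James Z × (ℝ → James Z)) (x : ℝ) : James Z :=
  if x ≤ d then c (d - x) * p.1 else p.2 (x - d)

/-- The deformation from the section `p` (at `θ = 0`) to the section `(1, c)` (for large `θ`). -/
def glue (d : ℝ) (c : ℝ → James Z) (p : James Z × (ℝ → James Z)) (θ : ℝ) :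
    James Z × (ℝ → James Z) :=
  (glueAux d c p (max (θ - d) 0), fun t =>
    if t ≤ min θ d then c t * glueAux d c p (max (θ - d) 0)
    else glueAux d c p (|θ - d| + t - min θ d))

/-- `p.2` is a path from `f * p.1` to `1` that is stationary outside `[0, ℓ]`. -/
def IsSectionAt (f : James Z) (ℓ : ℝ) (p : James Z × (ℝ → James Z)) : Prop :=
  (∀ t ≤ 0, p.2 t = f * p.1) ∧ ∀ t ≥ ℓ, p.2 t = 1

variable {f : James Z} {ℓ d : ℝ} {c : ℝ → James Z} {p : James Z × (ℝ → James Z)}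

theorem IsSectionAt.mono {ℓ' : ℝ} (hp : IsSectionAt f ℓ p) (h : ℓ ≤ ℓ') : IsSectionAt f ℓ' p :=
  ⟨hp.1, fun t ht => hp.2 t (h.trans ht)⟩

/-- `glueAux` is `1` from time `ℓ + d` on, and its argument `|θ - d| + t - min θ d` is at least `t -
d`; this gives the length `ℓ + 2 * d`. -/
theorem IsSectionAt.glue (hp : IsSectionAt f ℓ p) (hc : IsSectionAt f d (1, c)) (hd : 0 < d)
    (hℓ : 0 < ℓ) {θ : ℝ} (hθ : 0 ≤ θ) : IsSectionAt f (ℓ + 2 * d) (glue d c p θ) := by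
  constructor
  · intro t ht
    simp only [GeoReal.glue]
    rw [if_pos (ht.trans (le_min hθ hd.le)), show c t = f by simpa using hc.1 t ht]
  · intro t ht
    simp only [GeoReal.glue]
    have h1 := min_le_right θ d
    have h2 := abs_nonneg (θ - d)
    rw [if_neg (by linarith), glueAux, if_neg (by linarith), hp.2 _ (by linarith)]

theorem IsSectionAt.glue_zero (hp : IsSectionAt f ℓ p) (hc : IsSectionAt f d (1, c)) (hd : 0 < d) :
    GeoReal.glue d c p 0 = p := by
  have h1 : max (0 - d) 0 = 0 := max_eq_right (by linarith)
  have h0 : glueAux d c p 0 = p.1 := by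
    rw [glueAux, if_pos hd.le, sub_zero, show c d = 1 from hc.2 d le_rfl, one_mul]
  refine Prod.ext ?_ (funext fun t => ?_)
  · simp only [GeoReal.glue, h1, h0]
  · simp only [GeoReal.glue, h1, h0, min_eq_left hd.le]
    rw [zero_sub, abs_neg, abs_of_pos hd, sub_zero]
    split_ifs with ht
    · rw [hp.1 t ht, show c t = f by simpa using hc.1 t ht]
    · rw [glueAux, if_neg (by linarith), add_sub_cancel_left]

theorem IsSectionAt.glue_of_le (hp : IsSectionAt f ℓ p) (hc : IsSectionAt f d (1, c)) (hd : 0 < d)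
    (hℓ : 0 < ℓ) {θ : ℝ} (hθ : ℓ + 2 * d ≤ θ) : GeoReal.glue d c p θ = (1, c) := by
  have h1 : max (θ - d) 0 = θ - d := max_eq_left (by linarith)
  have h0 : glueAux d c p (θ - d) = 1 := by
    rw [glueAux, if_neg (by linarith), hp.2 _ (by linarith)]
  refine Prod.ext ?_ (funext fun t => ?_)
  · simp only [GeoReal.glue, h1, h0]
  · simp only [GeoReal.glue, h1, h0, min_eq_right (show d ≤ θ by linarith),
      abs_of_pos (show 0 < θ - d by linarith)]
    split_ifs with ht
    · rw [mul_one]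
    · rw [glueAux, if_neg (by linarith), hp.2 _ (by linarith),
        show c t = 1 from hc.2 t (by change d ≤ t; linarith)]

/-- One step of the gluing: keep `p` where `2 * lam ≤ S`, use `(1, c)` where `S ≤ lam`, and
interpolate in between. -/
def glueStep (d S lam : ℝ) (c : ℝ → James Z) (p : James Z × (ℝ → James Z)) :
    James Z × (ℝ → James Z) :=
  if 2 * lam ≤ S then p else if S ≤ lam then (1, c)
  else glue d c p (10 * ((2 * lam - S) / lam))

theorem IsSectionAt.glueStep {S lam : ℝ} (hS' : 0 < S + lam)
    (hp : 0 < S → IsSectionAt f ℓ p)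
    (hc : 0 < lam → IsSectionAt f d (1, c)) (hd : 0 < d) (hℓ : 0 < ℓ) :
    IsSectionAt f (ℓ + 2 * d) (glueStep d S lam c p) := by
  unfold GeoReal.glueStep
  split_ifs with h1 h2
  · exact (hp (by linarith)).mono (by linarith)
  · exact (hc (by linarith)).mono (by linarith)
  · exact (hp (by linarith)).glue (hc (by linarith)) hd hℓ
      (mul_nonneg (by norm_num) (div_nonneg (by linarith) (by linarith)))

/-- Where both weights are positive the three cases become one formula with a clamped parameter,
since `glue` has reached `p` at parameter `0` and `(1, c)` at every parameter from `ℓ + 2 * d` on.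
The constant `10` only has to exceed the lengths, which stay below `4` in `glueSeq`. -/
theorem glueStep_eq {S lam : ℝ} (hlam : 0 < lam) (hp : IsSectionAt f ℓ p)
    (hc : IsSectionAt f d (1, c)) (hd : 0 < d) (hℓ : 0 < ℓ) (hb : ℓ + 2 * d ≤ 10) :
    glueStep d S lam c p = glue d c p (10 * max 0 (min 1 ((2 * lam - S) / lam))) := by
  unfold glueStep
  split_ifs with h1 h2
  · rw [max_eq_left, mul_zero, hp.glue_zero hc hd]
    exact (min_le_right _ _).trans (div_nonpos_of_nonpos_of_nonneg (by linarith) hlam.le)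
  · have : 1 ≤ (2 * lam - S) / lam := by rw [le_div_iff₀ hlam]; linarith
    rw [min_eq_left this, max_eq_right zero_le_one, hp.glue_of_le hc hd hℓ (by linarith)]
  · have h3 : (2 * lam - S) / lam ≤ 1 := by rw [div_le_one hlam]; linarith
    rw [min_eq_right h3, max_eq_right (div_nonneg (by linarith) hlam.le)]

variable [TopologicalSpace Z] {W : Type u} [TopologicalSpace W] [CompactlyGeneratedSpace W]

/-- Continuity of a family of pairs of a point and a path. -/
def ContinuousSection (s : W → James Z × (ℝ → James Z)) : Prop :=
  (Continuous fun w => (s w).1) ∧ ∀ t : W → ℝ, Continuous t → Continuous fun w => (s w).2 (t w)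

/-- For `θ ≤ d` the path follows `c * χ` up to time `θ`, turns back, and continues along the path of
`s`. For `θ ≥ d` the inverse itself moves along `glueAux` from `χ` to `1`. Continuity is the
agreement of the branches at the switching times. -/
theorem ContinuousSection.glue {d ℓ : ℝ} {c : W → ℝ → James Z} {s : W → James Z × (ℝ → James Z)}
    {f : W → James Z} {θ : W → ℝ} (hs : ContinuousSection s)
    (hc : ∀ t : W → ℝ, Continuous t → Continuous fun w => c w (t w)) (hθ : Continuous θ)
    (hsv : ∀ w, IsSectionAt (f w) ℓ (s w)) (hcv : ∀ w, IsSectionAt (f w) d (1, c w))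
    (hd : 0 < d) (hθ0 : ∀ w, 0 ≤ θ w) : ContinuousSection fun w => glue d (c w) (s w) (θ w) := by
  have hβ : ∀ x : W → ℝ, Continuous x → Continuous fun w => glueAux d (c w) (s w) (x w) := by
    intro x hx
    refine Continuous.if_le (James.continuous_mul (hc _ (by fun_prop)) hs.1)
      (hs.2 _ (by fun_prop)) hx continuous_const fun w hw => ?_
    rw [hw, sub_self, (hsv w).1 0 le_rfl, show c w 0 = f w by simpa using (hcv w).1 0 le_rfl]
  refine ⟨hβ _ (by fun_prop), fun t ht => ?_⟩
  refine Continuous.if_le (James.continuous_mul (hc _ ht) (hβ _ (by fun_prop)))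
    (hβ _ (by fun_prop)) ht (by fun_prop) fun w hw => ?_
  rw [hw, add_sub_cancel_right]
  rcases le_total (θ w) d with h | h
  · have h0 := hθ0 w
    rw [min_eq_left h, max_eq_right (by linarith), abs_of_nonpos (by linarith), glueAux,
      if_pos hd.le, glueAux, if_pos (by linarith), sub_zero,
      show c w d = 1 from (hcv w).2 d le_rfl, one_mul, neg_sub, sub_sub_cancel]
  · rw [min_eq_right h, max_eq_left (by linarith), abs_of_nonneg (by linarith),
      show c w d = 1 from (hcv w).2 d le_rfl, one_mul]

end Glue

theorem continuous_of_local {W Y : Type*} [TopologicalSpace W] [TopologicalSpace Y] {g : W → Y}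
    (h : ∀ w, ∃ U : Set W, IsOpen U ∧ w ∈ U ∧ Continuous fun x : U => g x) : Continuous g := by
  refine continuous_iff_continuousAt.2 fun w => ?_
  obtain ⟨U, hU, hw, hg⟩ := h w
  exact (continuousOn_iff_continuous_domRestrict.2 hg).continuousAt (hU.mem_nhds hw)

/-! ### The limit of the glued partial sections -/

section Cover

variable {A Z : Type u} [TopologicalSpace A] [TopologicalSpace Z] [BasePoint Z]

/-- The sequence of partial sections glued from the paths `c`. -/
def glueSeq (lam : ℕ → A → ℝ) (c : ℕ → A → ℝ → James Z) : ℕ → A → James Z × (ℝ → James Z)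
  | 0 => fun a => (1, c 0 a)
  | j + 1 => fun a => glueStep ((1 / 2) ^ (j + 1)) (∑ i ∈ Finset.range (j + 1), lam i a)
      (lam (j + 1) a) (c (j + 1) a) (glueSeq lam c j a)

variable {f : A → James Z} {lam : ℕ → A → ℝ} {c : ℕ → A → ℝ → James Z}

/-- Step `j + 1` adds twice `(1 / 2) ^ (j + 1)`, so the lengths `2, 3, 7/2, …` stay below `4` and
all the sections can be run on a common interval. -/
theorem isSectionAt_glueSeq
    (hcv : ∀ i a, 0 < lam i a → IsSectionAt (f a) ((1 / 2) ^ i) (1, c i a)) (j : ℕ) (a : A)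
    (ha : 0 < ∑ i ∈ Finset.range (j + 1), lam i a) :
    IsSectionAt (f a) (4 - 2 * (1 / 2) ^ j) (glueSeq lam c j a) := by
  induction j with
  | zero =>
    rw [Finset.sum_range_one] at ha
    exact (hcv 0 a ha).mono (by norm_num)
  | succ j ih =>
    rw [Finset.sum_range_succ] at ha
    have hj : ((1 : ℝ) / 2) ^ j ≤ 1 := pow_le_one₀ (by norm_num) (by norm_num)
    refine (IsSectionAt.glueStep ha ih (hcv _ a) (by positivity)
      (by linarith)).mono (le_of_eq ?_)
    rw [pow_succ]; ring

/-- Locally compact Hausdorff test spaces are used because the induction passes to open subsets,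
which compact spaces do not allow, while pointwise products in `J(Z)` need a compactly generated
source. -/
theorem continuousSection_glueSeq (hlam : ∀ i, Continuous (lam i)) (h0 : ∀ i a, 0 ≤ lam i a)
    (hcv : ∀ i a, 0 < lam i a → IsSectionAt (f a) ((1 / 2) ^ i) (1, c i a))
    (hc : ∀ (i : ℕ) (W : Type u) [TopologicalSpace W] [LocallyCompactSpace W] [T2Space W]
      (p : W → A) (t : W → ℝ), Continuous p → Continuous t → (∀ w, 0 < lam i (p w)) →
      Continuous fun w => c i (p w) (t w)) (j : ℕ) :
    ∀ (W : Type u) [TopologicalSpace W] [LocallyCompactSpace W] [T2Space W] (p : W → A),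
      Continuous p → (∀ w, 0 < ∑ i ∈ Finset.range (j + 1), lam i (p w)) →
      ContinuousSection fun w => glueSeq lam c j (p w) := by
  induction j with
  | zero =>
    intro W _ _ _ p hp hw
    simp only [zero_add, Finset.sum_range_one] at hw
    exact ⟨continuous_const, fun t ht => hc 0 W p t hp ht hw⟩
  | succ j ih =>
    intro W _ _ _ p hp hw
    let S : W → ℝ := fun w => ∑ i ∈ Finset.range (j + 1), lam i (p w)
    let L : W → ℝ := fun w => lam (j + 1) (p w)
    have hS : Continuous S := continuous_finsetSum _ fun i _ => (hlam i).comp hp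
    have hL : Continuous L := (hlam (j + 1)).comp hp
    have hS0 : ∀ w, 0 ≤ S w := fun w => Finset.sum_nonneg fun i _ => h0 i _
    have hL0 : ∀ w, 0 ≤ L w := fun w => h0 _ _
    have hSL : ∀ w, 0 < S w + L w := fun w => by
      have := hw w
      rwa [Finset.sum_range_succ] at this
    have hd : (0 : ℝ) < (1 / 2) ^ (j + 1) := by positivity
    have hj : ((1 : ℝ) / 2) ^ j ≤ 1 := pow_le_one₀ (by norm_num) (by norm_num)
    have hj0 : (0 : ℝ) < (1 / 2) ^ j := by positivity
    have hstep : ∀ w, glueSeq lam c (j + 1) (p w) = glueStep ((1 / 2) ^ (j + 1)) (S w) (L w)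
      (c (j + 1) (p w)) (glueSeq lam c j (p w)) := fun w => rfl
    have key : ∀ w, ∃ U : Set W, IsOpen U ∧ w ∈ U ∧
        ContinuousSection fun x : U => glueSeq lam c (j + 1) (p x) := by
      intro w
      -- Three kinds of points: where the new weight vanishes the old section persists nearby, where
      -- the old weights vanish the new section `(1, c)` is used nearby, and where both are positive
      -- `glue` interpolates.
      rcases (hL0 w).eq_or_lt with h | h
      · refine ⟨{x | 2 * L x < S x}, isOpen_lt (by fun_prop) hS, ?_, ?_⟩
        · have := hSL w
          change 2 * L w < S w
          linarith
        · have hU : IsOpen {x | 2 * L x < S x} := isOpen_lt (by fun_prop) hS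
          have := hU.locallyCompactSpace
          have e : (fun x : {x | 2 * L x < S x} => glueSeq lam c (j + 1) (p x)) =
              fun x : {x | 2 * L x < S x} => glueSeq lam c j (p x) := by
            funext x
            rw [hstep, glueStep, if_pos (le_of_lt x.2)]
          rw [e]
          refine ih _ (fun x : {x | 2 * L x < S x} => p x) (hp.comp continuous_subtype_val)
            fun x => ?_
          have h2 : 2 * L x < S x := x.2
          exact lt_of_le_of_lt (by linarith [hL0 x]) h2
      · rcases (hS0 w).eq_or_lt with h' | h'
        · have hU : IsOpen {x | S x < L x} := isOpen_lt hS hL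
          refine ⟨_, hU, ?_, ?_⟩
          · change S w < L w
            linarith
          · have := hU.locallyCompactSpace
            have e : (fun x : {x | S x < L x} => glueSeq lam c (j + 1) (p x)) =
                fun x : {x | S x < L x} => (1, c (j + 1) (p x)) := by
              funext x
              have h2 : S x < L x := x.2
              rw [hstep, glueStep, if_neg (by linarith [hS0 x]), if_pos h2.le]
            rw [e]
            refine ⟨continuous_const, fun t ht => hc (j + 1) _ _ t
              (hp.comp continuous_subtype_val) ht fun x => ?_⟩
            have h2 : S x < L x := x.2
            exact lt_of_le_of_lt (hS0 x) h2
        · have hU : IsOpen ({x | 0 < S x} ∩ {x | 0 < L x}) :=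
            (isOpen_lt continuous_const hS).inter (isOpen_lt continuous_const hL)
          refine ⟨_, hU, ⟨h', h⟩, ?_⟩
          have := hU.locallyCompactSpace
          have hp' : Continuous fun x : ↥({x | 0 < S x} ∩ {x | 0 < L x}) => p x :=
            hp.comp continuous_subtype_val
          have hsec : ∀ x : ↥({x | 0 < S x} ∩ {x | 0 < L x}), IsSectionAt (f (p x))
            (4 - 2 * (1 / 2) ^ j) (glueSeq lam c j (p x)) := fun x =>
              isSectionAt_glueSeq hcv j (p x) x.2.1
          have hcx : ∀ x : ↥({x | 0 < S x} ∩ {x | 0 < L x}), IsSectionAt (f (p x))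
            ((1 / 2) ^ (j + 1)) (1, c (j + 1) (p x)) := fun x => hcv _ _ x.2.2
          have e : (fun x : ↥({x | 0 < S x} ∩ {x | 0 < L x}) => glueSeq lam c (j + 1) (p x)) =
              fun x : ↥({x | 0 < S x} ∩ {x | 0 < L x}) =>
                glue ((1 / 2) ^ (j + 1)) (c (j + 1) (p x)) (glueSeq lam c j (p x))
                (10 * max 0 (min 1 ((2 * L x - S x) / L x))) := by
            funext x
            rw [hstep]
            refine glueStep_eq x.2.2 (hsec x) (hcx x) hd (by linarith) ?_
            rw [pow_succ]; linarith
          rw [e]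
          refine ContinuousSection.glue (ih _ _ hp' fun x => x.2.1)
            (fun t ht => hc (j + 1) _ _ t hp' ht fun x => x.2.2) ?_ hsec hcx hd
            fun x => mul_nonneg (by norm_num) (le_max_left _ _)
          have hd : Continuous fun x : ↥({x | 0 < S x} ∩ {x | 0 < L x}) =>
              (2 * L x - S x) / L x :=
            Continuous.div (by fun_prop) (by fun_prop) fun x => ne_of_gt x.2.2
          fun_prop
    refine ⟨continuous_of_local fun w => ?_, fun t ht => continuous_of_local fun w => ?_⟩
    · obtain ⟨U, hU, hwU, h⟩ := key w
      exact ⟨U, hU, hwU, h.1⟩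
    · obtain ⟨U, hU, hwU, h⟩ := key w
      exact ⟨U, hU, hwU, h.2 _ (ht.comp continuous_subtype_val)⟩

/-- A map to `J(Z)` that is null homotopic on the members of a countable numerable cover has a right
inverse up to homotopy. -/
theorem exists_rightInverse_of_cover [CompactlyGeneratedSpace A] (T : Set A)
    (hlam : ∀ i, Continuous (lam i)) (h0 : ∀ i a, 0 ≤ lam i a)
    (hle : ∀ i a, lam i a ≤ (1 / 2) ^ i) (hcov : ∀ a, ∃ i, 0 < lam i a)
    (hcv : ∀ i a, 0 < lam i a → IsSectionAt (f a) ((1 / 2) ^ i) (1, c i a))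
    (hc : ∀ (i : ℕ) (W : Type u) [TopologicalSpace W] [LocallyCompactSpace W] [T2Space W]
      (p : W → A) (t : W → ℝ), Continuous p → Continuous t → (∀ w, 0 < lam i (p w)) →
      Continuous fun w => c i (p w) (t w))
    (hT : ∀ a ∈ T, ∀ i, lam (i + 1) a = 0) (hTc : ∀ a ∈ T, ∀ t, c 0 a t = 1) :
    ∃ (χ : A → James Z) (N : unitInterval × A → James Z), Continuous χ ∧ Continuous N ∧
      (∀ a, N (0, a) = f a * χ a) ∧ (∀ a, N (1, a) = 1) ∧
      ∀ a ∈ T, χ a = 1 ∧ ∀ t, N (t, a) = 1 := by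
  -- The sequence is eventually constant near `a`: where `lam i₀` exceeds half its value at `a`, the
  -- partial sums are bounded below, while `lam (k + 1)` is at most `(1 / 2) ^ (k + 1)`. For large
  -- `k` every step therefore falls into the first case of `glueStep`.
  have hloc : ∀ a, ∃ (U : Set A) (j : ℕ), IsOpen U ∧ a ∈ U ∧ ∀ b ∈ U,
      (0 < ∑ i ∈ Finset.range (j + 1), lam i b) ∧
      ∀ k ≥ j, glueSeq lam c k b = glueSeq lam c j b := by
    intro a
    obtain ⟨i₀, hi⟩ := hcov a
    obtain ⟨m, hm⟩ := exists_pow_lt_of_lt_one (half_pos hi) (show (1 / 2 : ℝ) < 1 by norm_num)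
    have hpos : ∀ b, lam i₀ a / 2 < lam i₀ b → ∀ k ≥ i₀,
        lam i₀ b ≤ ∑ i ∈ Finset.range (k + 1), lam i b := fun b hb k hk =>
      Finset.single_le_sum (f := fun i => lam i b) (fun i _ => h0 i b)
        (Finset.mem_range.2 (by omega))
    refine ⟨{b | lam i₀ a / 2 < lam i₀ b}, max i₀ m, isOpen_lt continuous_const (hlam i₀),
      half_lt_self hi, fun b hb => ⟨?_, fun k hk => ?_⟩⟩
    · exact ((half_pos hi).trans hb).trans_le (hpos b hb _ (le_max_left _ _))
    · induction k, hk using Nat.le_induction with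
      | base => rfl
      | succ k hk ih =>
        rw [← ih]
        refine if_pos ?_
        have h1 := hle (k + 1) b
        have h2 : ((1 : ℝ) / 2) ^ k ≤ (1 / 2) ^ m :=
          pow_le_pow_of_le_one (by norm_num) (by norm_num) ((le_max_right _ _).trans hk)
        have h3 := hpos b hb k ((le_max_left _ _).trans hk)
        have h4 : lam i₀ a / 2 < lam i₀ b := hb
        rw [pow_succ] at h1
        linarith
  choose U J hU hmem hJ using hloc
  let s : A → James Z × (ℝ → James Z) := fun a => glueSeq lam c (J a) a
  have hs : ∀ a, ∀ b ∈ U a, s b = glueSeq lam c (J a) b := by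
    intro a b hb
    rw [← (hJ a b hb).2 (max (J a) (J b)) (le_max_left _ _),
      (hJ b b (hmem b)).2 (max (J a) (J b)) (le_max_right _ _)]
  have hsv : ∀ a, IsSectionAt (f a) 4 (s a) := fun a =>
    (isSectionAt_glueSeq hcv (J a) a (hJ a a (hmem a)).1).mono (by
      have : (0 : ℝ) < (1 / 2) ^ J a := by positivity
      linarith)
  have hcont : ∀ (K : Type u) [TopologicalSpace K] [CompactSpace K] [T2Space K] (p : K → A),
      Continuous p → ContinuousSection fun w => s (p w) := by
    intro K _ _ _ p hp
    have key : ∀ w, ∃ V : Set K, IsOpen V ∧ w ∈ V ∧ ContinuousSection fun x : V => s (p x) := by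
      intro w
      have hV := (hU (p w)).preimage hp
      refine ⟨_, hV, hmem (p w), ?_⟩
      have := hV.locallyCompactSpace
      have e : (fun x : ↥(p ⁻¹' U (p w)) => s (p x)) =
          fun x : ↥(p ⁻¹' U (p w)) => glueSeq lam c (J (p w)) (p x) :=
        funext fun x => hs _ _ x.2
      rw [e]
      exact continuousSection_glueSeq hlam h0 hcv hc _ _ _ (hp.comp continuous_subtype_val)
        fun x => (hJ (p w) _ x.2).1
    refine ⟨continuous_of_local fun w => ?_, fun t ht => continuous_of_local fun w => ?_⟩
    · obtain ⟨V, hV, hwV, h⟩ := key w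
      exact ⟨V, hV, hwV, h.1⟩
    · obtain ⟨V, hV, hwV, h⟩ := key w
      exact ⟨V, hV, hwV, h.2 _ (ht.comp continuous_subtype_val)⟩
  -- On `T` all later weights vanish, so no step changes the initial section.
  have hTs : ∀ a ∈ T, s a = (1, c 0 a) := by
    intro a ha
    have : ∀ j, glueSeq lam c j a = (1, c 0 a) := by
      intro j
      induction j with
      | zero => rfl
      | succ j ih =>
        refine (if_pos ?_).trans ih
        rw [hT a ha j, mul_zero]
        exact Finset.sum_nonneg fun i _ => h0 i a
    exact this _
  -- All paths end by time `4`, whence the rescaling `4 * q.1`.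
  refine ⟨fun a => (s a).1, fun q => (s q.2).2 (4 * q.1), ?_, ?_, fun a => ?_, fun a => ?_,
    fun a ha => ⟨congrArg Prod.fst (hTs a ha), fun t => ?_⟩⟩
  · exact continuous_from_compactlyGeneratedSpace _ fun K _ _ _ g hg => (hcont K g hg).1
  · refine continuous_from_compactlyGeneratedSpace _ fun K _ _ _ g hg => ?_
    exact (hcont K _ (continuous_snd.comp hg)).2 (fun w => 4 * ((g w).1 : ℝ)) (by fun_prop)
  · exact (hsv a).1 _ (by simp)
  · exact (hsv a).2 _ (by simp)
  · simp only [hTs a ha, hTc a ha]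

end Cover

/-! ### A countable null homotopic cover from the null homotopy of the reduced diagonal -/

section Lift

variable {k : ℕ} {X : Type u} {Y : Type*} [TopologicalSpace X] [BasePoint X]

/-- The map on the smash power induced by a map that is constant on the fat wedge. -/
def Smash.lift (g : Power (Fin k) X → Y) (y₀ : Y) (hg : ∀ x, (∃ i, x.out i = pt) → g x = y₀) :
    Smash k X → Y :=
  Quotient.lift g fun x y h => by
    rcases h with rfl | h
    · rfl
    · rw [hg x h.1, hg y h.2]

theorem Smash.continuous_lift [TopologicalSpace Y] {g : Power (Fin k) X → Y} {y₀ : Y}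
    {hg : ∀ x, (∃ i, x.out i = pt) → g x = y₀} (h : Continuous g) :
    Continuous (Smash.lift g y₀ hg) :=
  Smash.isQuotientMap_mk.continuous_iff.2 h

end Lift

section Weight

variable {ι : Type} [Fintype ι] {X : Type u} [TopologicalSpace X] [BasePoint X]
  (v : C(X, unitInterval))

/-- The product of the values of `v` at the coordinates. -/
def wt (x : Power ι X) : ℝ := ∏ i, (v (x.out i) : ℝ)

theorem continuous_wt : Continuous (wt (ι := ι) v) :=
  continuous_finsetProd _ fun i _ =>
    continuous_subtype_val.comp (v.continuous.comp (Power.continuous_apply i))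

theorem wt_nonneg (x : Power ι X) : 0 ≤ wt v x :=
  Finset.prod_nonneg fun i _ => (v (x.out i)).2.1

theorem wt_le_one (x : Power ι X) : wt v x ≤ 1 :=
  Finset.prod_le_one (fun i _ => (v (x.out i)).2.1) fun i _ => (v (x.out i)).2.2

variable {v}

theorem wt_eq_zero_iff (hv : ∀ x, v x = 0 ↔ x = pt) {x : Power ι X} :
    wt v x = 0 ↔ ∃ i, x.out i = pt := by
  rw [wt, Finset.prod_eq_zero_iff]
  simp only [Finset.mem_univ, true_and, ← hv, Set.Icc.coe_eq_zero]

theorem exists_lt_one_of_wt {x : Power ι X} (h : wt v x < 1) : ∃ i, v (x.out i) < 1 := by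
  by_contra! hc
  refine h.ne (Finset.prod_eq_one fun i _ => ?_)
  exact congrArg Subtype.val (le_antisymm unitInterval.le_one' (hc i))

end Weight

section Cover

variable {X : Type u} [TopologicalSpace X] [CompactlyGeneratedSpace X] [BasePoint X]

/-- The coordinates on the complement of the base point of a smash power. -/
def Smash.coord {k : ℕ} (i : Fin k) : Smash k X → X := by
  classical
  exact Smash.lift (fun x => if ∃ j, x.out j = pt then pt else x.out i) pt
    fun x hx => if_pos hx

theorem Smash.coord_mk {k : ℕ} (i : Fin k) {x : Power (Fin k) X} (hx : ¬ ∃ j, x.out j = pt) :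
    Smash.coord i (Smash.mk x) = x.out i := if_neg hx

/-- The weight on a smash power. -/
def Smash.wt {k : ℕ} (v : C(X, unitInterval)) (hv : ∀ x, v x = 0 ↔ x = pt) : Smash k X → ℝ :=
  Smash.lift (GeoReal.wt v) 0 fun _ hx => (wt_eq_zero_iff hv).2 hx

theorem Smash.continuous_wt {k : ℕ} (v : C(X, unitInterval)) (hv : ∀ x, v x = 0 ↔ x = pt) :
    Continuous (Smash.wt (k := k) v hv) :=
  Smash.continuous_lift (GeoReal.continuous_wt v)

/-- The set pulls back to an open set of tuples missing the fat wedge, on which the default value in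
`Smash.coord` plays no role. -/
theorem Smash.continuousOn_coord {k : ℕ} (v : C(X, unitInterval)) (hv : ∀ x, v x = 0 ↔ x = pt)
    (i : Fin k) : ContinuousOn (Smash.coord (X := X) i) {z | 0 < Smash.wt v hv z} := by
  rw [Smash.isQuotientMap_mk.continuousOn_isOpen_iff
    (isOpen_lt continuous_const (Smash.continuous_wt v hv))]
  refine (Power.continuous_apply i).continuousOn.congr fun x hx => Smash.coord_mk i fun h => ?_
  have h1 : 0 < GeoReal.wt v x := hx
  exact h1.ne' ((wt_eq_zero_iff hv).2 h)

/-- A space with null homotopic reduced diagonal and non-degenerate base point is covered by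
countably many cozero sets that are contractible in the space. -/
theorem exists_cover_of_weakCatLtTwo (v : C(X, unitInterval)) (h : C(unitInterval × X, X))
    (hv : ∀ x, v x = 0 ↔ x = pt) (h0 : ∀ x, h (0, x) = x) (h1 : ∀ x, v x < 1 → h (1, x) = pt)
    (hcat : WeakCatLtTwo X) :
    ∃ (lam : ℕ → X → ℝ) (c : ℕ → X → ℝ → X), (∀ i, Continuous (lam i)) ∧
      (∀ i x, 0 ≤ lam i x) ∧ (∀ i x, lam i x ≤ 1) ∧ (∀ x, v x = 1 → ∃ i, 0 < lam i x) ∧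
      (∀ i x, 0 < lam i x → (∀ t ≤ 0, c i x t = x) ∧ ∀ t ≥ 1, c i x t = pt) ∧
      ∀ (i : ℕ) (W : Type u) [TopologicalSpace W] (p : W → X) (t : W → ℝ), Continuous p →
        Continuous t → (∀ w, 0 < lam i (p w)) → Continuous fun w => c i (p w) (t w) := by
  obtain ⟨F⟩ := hcat
  obtain ⟨e, he⟩ := exists_surjective_nat (ℕ × Fin 2)
  let q : ℕ → unitInterval := TopologicalSpace.denseSeq unitInterval
  let φ : Smash 2 X → ℝ := Smash.wt v hv
  have hφ : Continuous φ := Smash.continuous_wt v hv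
  have hφ0 : ∀ z, 0 ≤ φ z := by rintro ⟨x⟩; exact wt_nonneg v x
  have hφ1 : ∀ z, φ z ≤ 1 := by rintro ⟨x⟩; exact wt_le_one v x
  -- `ψ i` is positive only off the base point and where the `i`-th coordinate lies in the NDR
  -- neighbourhood `v < 1`. The factor `wt v x` makes it well defined and continuous on the smash
  -- product.
  let ψ : Fin 2 → Smash 2 X → ℝ := fun i =>
    Smash.lift (fun x => wt v x * (1 - v (x.out i))) 0 fun x hx => by
      rw [(wt_eq_zero_iff hv).2 hx, zero_mul]
  have hψ : ∀ i, Continuous (ψ i) := fun i => Smash.continuous_lift <| by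
    have := continuous_subtype_val.comp (v.continuous.comp (Power.continuous_apply (X := X) i))
    exact (continuous_wt v).mul (continuous_const.sub this)
  have hψ0 : ∀ i z, 0 ≤ ψ i z := by
    rintro i ⟨x⟩
    exact mul_nonneg (wt_nonneg v x) (sub_nonneg.2 (v _).2.2)
  have hψ1 : ∀ i z, ψ i z ≤ 1 := by
    rintro i ⟨x⟩
    exact mul_le_one₀ (wt_le_one v x) (sub_nonneg.2 (v _).2.2) (sub_le_self _ (v _).2.1)
  -- The minimum of `φ` along `F` up to time `r`. If it is positive, the path stays off the base
  -- point and its coordinates are defined on `[0, r]`.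
  let m : unitInterval → X → ℝ := fun r x =>
    sInf ((fun s : unitInterval => φ (F (r * s, x))) '' univ)
  have hm : ∀ r, Continuous (m r) := fun r =>
    isCompact_univ.continuous_sInf (f := fun x (s : unitInterval) => φ (F (r * s, x)))
      (by fun_prop)
  have hmle : ∀ r x s, m r x ≤ φ (F (r * s, x)) := fun r x s =>
    csInf_le ⟨0, by rintro _ ⟨s, -, rfl⟩; exact hφ0 _⟩ ⟨s, mem_univ s, rfl⟩
  have hm0 : ∀ r x, 0 ≤ m r x := fun r x =>
    le_csInf (univ_nonempty.image _) (by rintro _ ⟨s, -, rfl⟩; exact hφ0 _)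
  have hpos : ∀ r x, (∀ s : unitInterval, 0 < φ (F (r * s, x))) → 0 < m r x := by
    intro r x hs
    have hc : IsCompact ((fun s : unitInterval => φ (F (r * s, x))) '' univ) :=
      isCompact_univ.image (by fun_prop)
    obtain ⟨s, -, hs'⟩ := hc.sInf_mem (univ_nonempty.image _)
    exact (hs s).trans_eq hs'
  have hψpos : ∀ i z, 0 < ψ i z → v (Smash.coord i z) < 1 := by
    rintro i ⟨x⟩ hz
    have hz' : 0 < wt v x * (1 - v (x.out i)) := hz
    have hx : ¬ ∃ j, x.out j = pt := fun hx => by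
      rw [(wt_eq_zero_iff hv).2 hx, zero_mul] at hz'
      exact hz'.false
    have : v (x.out i) < 1 := by
      have := pos_of_mul_pos_right hz' (wt_nonneg v x)
      exact Subtype.coe_lt_coe.1 (show (v (x.out i) : ℝ) < 1 by linarith)
    exact (congrArg v (Smash.coord_mk i hx)).trans_lt this
  have hsplit : ∀ i x, 0 < m (q (e i).1) x * ψ (e i).2 (F (q (e i).1, x)) →
      0 < m (q (e i).1) x ∧ 0 < ψ (e i).2 (F (q (e i).1, x)) := fun i x hx =>
    ⟨pos_of_mul_pos_left hx (hψ0 _ _), pos_of_mul_pos_right hx (hm0 _ _)⟩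
  let σ : ℝ → unitInterval := projIcc 0 1 zero_le_one
  have hσ : Continuous σ := continuous_projIcc
  have hσ0 : ∀ t ≤ 0, σ t = 0 := fun t ht => projIcc_of_le_left _ ht
  have hσ1 : ∀ t ≥ 1, σ t = 1 := fun t ht => projIcc_of_right_le _ ht
  -- An index encodes a time from a dense sequence and one of the two factors. The contraction first
  -- follows that coordinate of `F`, which starts at `x`, up to the chosen time, then applies `h`,
  -- which ends at the base point because `ψ` is positive.
  refine ⟨fun i x => m (q (e i).1) x * ψ (e i).2 (F (q (e i).1, x)),
    fun i x t => h (σ (2 * t - 1), Smash.coord (e i).2 (F (q (e i).1 * σ (2 * t), x))),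
    fun i => (hm _).mul ((hψ _).comp (by fun_prop)),
    fun i x => mul_nonneg (hm0 _ _) (hψ0 _ _), fun i x => ?_, fun x hx => ?_,
    fun i x hix => ⟨fun t ht => ?_, fun t ht => ?_⟩, fun i W _ p t hp ht hw => ?_⟩
  · exact mul_le_one₀ ((hmle _ _ 0).trans (hφ1 _)) (hψ0 _ _) (hψ1 _ _)
  · let g : unitInterval → ℝ := fun t => φ (F (t, x))
    have hg : Continuous g := by fun_prop
    have hg0 : g 0 = 1 := by
      change φ (F (0, x)) = 1
      rw [F.apply_zero]
      change wt v (KIfy.of fun _ : Fin 2 => x) = 1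
      exact Finset.prod_eq_one fun i _ => congrArg Subtype.val hx
    have hg1 : g 1 = 0 := by
      change φ (F (1, x)) = 0
      rw [F.apply_one]
      exact (wt_eq_zero_iff hv (x := (pt : Power (Fin 2) X))).2 ⟨0, rfl⟩
    obtain ⟨t', ht', hmin⟩ := (isClosed_le hg continuous_const).isCompact.exists_isLeast
      (s := {t | g t ≤ 1 / 2}) ⟨1, by simp [hg1]⟩
    obtain ⟨p, hp, hgp⟩ := intermediate_value_Icc' (f := g) (unitInterval.nonneg' : 0 ≤ t')
      hg.continuousOn (show (3 / 4 : ℝ) ∈ Icc (g t') (g 0) from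
        ⟨le_trans ht' (by norm_num), by rw [hg0]; norm_num⟩)
    have hpt : p < t' := lt_of_le_of_ne hp.2 fun h => by
      subst h
      have : g p ≤ 1 / 2 := ht'
      linarith
    obtain ⟨n, hn⟩ := (TopologicalSpace.denseRange_denseSeq unitInterval).exists_mem_open
      ((isOpen_lt continuous_id continuous_const).inter (isOpen_lt hg continuous_const))
      (s := {r | r < t'} ∩ {r | g r < 1}) ⟨p, hpt, show g p < 1 by linarith⟩
    have hgpos : ∀ r < t', 0 < g r := fun r hr => by
      by_contra hc
      exact absurd (hmin (show g r ≤ 1 / 2 by linarith)) (not_le.2 hr)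
    have hmn : 0 < m (q n) x := hpos _ _ fun s => hgpos _
      (lt_of_le_of_lt unitInterval.mul_le_left hn.1)
    obtain ⟨y, hy⟩ := Quotient.exists_rep (F (q n, x))
    have hy' : Smash.mk y = F (q n, x) := hy
    have hwy : wt v y < 1 := by
      have : φ (F (q n, x)) < 1 := hn.2
      rwa [← hy'] at this
    have hwy0 : 0 < wt v y := by
      have : 0 < φ (F (q n, x)) := hgpos _ hn.1
      rwa [← hy'] at this
    obtain ⟨b, hb⟩ := exists_lt_one_of_wt hwy
    obtain ⟨i, hi⟩ := he (n, b)
    refine ⟨i, ?_⟩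
    simp only [hi]
    refine mul_pos hmn ?_
    rw [← hy']
    exact mul_pos hwy0 (sub_pos.2 (Subtype.coe_lt_coe.2 hb))
  · have h2 := (hsplit i x hix).1.trans_le (hmle _ _ 0)
    rw [mul_zero, F.apply_zero] at h2
    have hx : ¬ ∃ j : Fin 2, (KIfy.of fun _ => x : Power (Fin 2) X).out j = pt := fun hx =>
      h2.ne' ((wt_eq_zero_iff hv).2 hx)
    simp only
    rw [hσ0 _ (by linarith), hσ0 _ (by linarith), mul_zero, h0, F.apply_zero]
    exact Smash.coord_mk _ hx
  · simp only
    rw [hσ1 _ (by linarith), hσ1 _ (by linarith), mul_one]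
    exact h1 _ (hψpos _ _ (hsplit i x hix).2)
  · refine h.continuous.comp (Continuous.prodMk (by fun_prop) ?_)
    refine (Smash.continuousOn_coord v hv (e i).2).comp_continuous (by fun_prop) fun w => ?_
    exact (hsplit i _ (hw w)).1.trans_le (hmle _ _ _)

/-- The inclusion `X^{(k)} → J(X^{(k)})` has a right inverse up to pointed homotopy. -/
theorem exists_rightInverse_incl (hX : NondegenerateBasePoint X) (hcat : WeakCatLtTwo X) {k : ℕ}
    (hk : 1 ≤ k) :
    ∃ (χ : Smash k X → James (Smash k X)) (N : unitInterval × Smash k X → James (Smash k X)),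
      Continuous χ ∧ Continuous N ∧ (∀ z, N (0, z) = James.incl z * χ z) ∧ (∀ z, N (1, z) = 1) ∧
      χ pt = 1 ∧ ∀ t, N (t, pt) = 1 := by
  classical
  obtain ⟨v, h, hv, h0, hpt, h1⟩ := hX
  obtain ⟨lam, c, hlam, hl0, hl1, hcov, hcv, hc⟩ :=
    exists_cover_of_weakCatLtTwo v h hv h0 h1 hcat
  let σ : ℝ → unitInterval := projIcc 0 1 zero_le_one
  have hσ : Continuous σ := continuous_projIcc
  have hσ0 : ∀ t ≤ 0, σ t = 0 := fun t ht => projIcc_of_le_left _ ht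
  have hσ1 : ∀ t ≥ 1, σ t = 1 := fun t ht => projIcc_of_right_le _ ht
  let o : Fin k := ⟨0, hk⟩
  let A := Power (Fin k) X
  let f : A → James (Smash k X) := fun x => James.incl (Smash.mk x)
  have hf : Continuous f := James.continuous_incl.comp Smash.continuous_mk
  have hf1 : ∀ x : A, (∃ i, x.out i = pt) → f x = 1 := fun x hx => by
    change James.incl (Smash.mk x) = 1
    rw [Smash.mk_eq_pt hx, James.incl_pt]
  -- Piece `0` lies where some coordinate has `v < 1`: deforming all coordinates by `h` makes the
  -- smash product trivial. Piece `i + 1` contracts the coordinate `o` by `c i`. The powers of `1 /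
  -- 2` provide the bounds on weights and path lengths, and the factor `wt v x` removes the later
  -- pieces from the fat wedge, so that the result descends to the smash power.
  let lamA : ℕ → A → ℝ := fun i => match i with
    | 0 => fun x => 1 - wt v x
    | i + 1 => fun x => (1 / 2) ^ (i + 1) * (lam i (x.out o) * wt v x)
  let cA : ℕ → A → ℝ → James (Smash k X) := fun i => match i with
    | 0 => fun x t => f (KIfy.of fun j => h (σ t, x.out j))
    | i + 1 => fun x t => f (KIfy.of (Function.update x.out o (c i (x.out o) (2 ^ (i + 1) * t))))
  have hpw : ∀ (i : ℕ), (0 : ℝ) < (1 / 2) ^ i := fun i => by positivity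
  have hsplit : ∀ i (x : A), 0 < lamA (i + 1) x → 0 < lam i (x.out o) := fun i x hx =>
    pos_of_mul_pos_left (pos_of_mul_pos_right hx (hpw _).le) (wt_nonneg v x)
  refine (exists_rightInverse_of_cover (f := f) (lam := lamA)
    (c := cA) {x | wt v x = 0} ?_ ?_ ?_ ?_ ?_ ?_ ?_ ?_).elim ?_
  · rintro (_ | i)
    · exact continuous_const.sub (continuous_wt v)
    · exact continuous_const.mul (((hlam i).comp (Power.continuous_apply o)).mul (continuous_wt v))
  · rintro (_ | i) x
    · exact sub_nonneg.2 (wt_le_one v x)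
    · exact mul_nonneg (hpw _).le (mul_nonneg (hl0 _ _) (wt_nonneg v x))
  · rintro (_ | i) x
    · exact (sub_le_self _ (wt_nonneg v x)).trans (by simp)
    · exact mul_le_of_le_one_right (hpw _).le (mul_le_one₀ (hl1 _ _) (wt_nonneg v x)
        (wt_le_one v x))
  · intro x
    rcases (wt_le_one v x).lt_or_eq with hx | hx
    · exact ⟨0, sub_pos.2 hx⟩
    · have hvo : v (x.out o) = 1 := by
        by_contra hne
        have h2 : (v (x.out o) : ℝ) < 1 := lt_of_le_of_ne (v _).2.2 fun h' => hne (Subtype.ext h')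
        have h3 : wt v x ≤ v (x.out o) := by
          rw [wt, ← Finset.mul_prod_erase _ _ (Finset.mem_univ o)]
          exact mul_le_of_le_one_right (v _).2.1 (Finset.prod_le_one (fun i _ => (v _).2.1)
            fun i _ => (v _).2.2)
        linarith
      obtain ⟨i, hi⟩ := hcov _ hvo
      refine ⟨i + 1, mul_pos (hpw _) (mul_pos hi ?_)⟩
      rw [hx]
      exact one_pos
  · rintro (_ | i) x hx
    · refine ⟨fun t ht => ?_, fun t ht => ?_⟩
      · rw [mul_one]
        refine congrArg f (funext fun j => ?_)
        change h (σ t, x.out j) = x.out j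
        rw [hσ0 t ht, h0]
      · rw [pow_zero] at ht
        obtain ⟨j, hj⟩ := exists_lt_one_of_wt (sub_pos.1 hx)
        refine hf1 _ ⟨j, ?_⟩
        change h (σ t, x.out j) = pt
        rw [hσ1 t ht, h1 _ hj]
    · obtain ⟨ha, hb⟩ := hcv i _ (hsplit i x hx)
      refine ⟨fun t ht => ?_, fun t ht => ?_⟩
      · rw [mul_one]
        refine congrArg f ?_
        change Function.update x.out o (c i (x.out o) (2 ^ (i + 1) * t)) = x.out
        rw [ha _ (mul_nonpos_of_nonneg_of_nonpos (by positivity) ht), Function.update_eq_self]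
      · refine hf1 _ ⟨o, ?_⟩
        change Function.update x.out o (c i (x.out o) (2 ^ (i + 1) * t)) o = pt
        rw [Function.update_self, hb]
        have : (2 : ℝ) ^ (i + 1) * (1 / 2) ^ (i + 1) = 1 := by
          rw [← mul_pow]; norm_num
        calc (1 : ℝ) = 2 ^ (i + 1) * (1 / 2) ^ (i + 1) := this.symm
          _ ≤ 2 ^ (i + 1) * t := by gcongr
  · rintro (_ | i) W _ _ _ p t hp ht hw
    · refine hf.comp (Power.continuous_mk fun j => ?_)
      have := (Power.continuous_apply j).comp hp
      exact h.continuous.comp ((hσ.comp ht).prodMk this)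
    · refine hf.comp (Power.continuous_mk fun j => ?_)
      by_cases hj : j = o
      · subst hj
        simp only [Function.update_self]
        exact hc i W (fun w => (p w).out o) (fun w => 2 ^ (i + 1) * t w)
          ((Power.continuous_apply _).comp hp) (by fun_prop) fun w => hsplit i _ (hw w)
      · simp only [Function.update_of_ne hj]
        exact (Power.continuous_apply j).comp hp
  · intro x hx i
    change (1 / 2) ^ (i + 1) * (lam i (x.out o) * wt v x) = 0
    rw [show wt v x = 0 from hx, mul_zero, mul_zero]
  · intro x hx t
    obtain ⟨j, hj⟩ := (wt_eq_zero_iff hv).1 hx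
    refine hf1 _ ⟨j, ?_⟩
    change h (σ t, x.out j) = pt
    rw [hj, hpt]
  · rintro χ ⟨N, hχ, hN, hN0, hN1, hT⟩
    have hT' : ∀ x : A, (∃ i, x.out i = pt) → χ x = 1 ∧ ∀ t, N (t, x) = 1 := fun x hx =>
      hT x ((wt_eq_zero_iff hv).2 hx)
    refine ⟨Smash.lift χ 1 fun x hx => (hT' x hx).1,
      fun p => Smash.lift (fun x => N (p.1, x)) 1 (fun x hx => (hT' x hx).2 p.1) p.2,
      Smash.continuous_lift hχ, ?_, ?_, ?_, (hT' pt ⟨o, rfl⟩).1, (hT' pt ⟨o, rfl⟩).2⟩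
    · exact Smash.isQuotientMap_mk.continuous_lift_prod_right hN
    · rintro ⟨x⟩
      exact hN0 x
    · rintro ⟨x⟩
      exact hN1 x

end Cover

/-! ### Extending the right inverse from `Z` to `J(Z)` -/

/-- A right inverse of the identity of `J(Z)` up to pointed homotopy. -/
structure RightInv (Z : Type u) [TopologicalSpace Z] [BasePoint Z] where
  /-- The inverse. -/
  χ : C(James Z, James Z)
  /-- The null homotopy of `g * χ g`. -/
  N : C(unitInterval × James Z, James Z)
  N_zero : ∀ g, N (0, g) = g * χ g
  N_one : ∀ g, N (1, g) = 1
  N_unit : ∀ t, N (t, 1) = 1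

section Words

variable {Z : Type u} [BasePoint Z]

open Classical in
theorem James.mk_filter_eq_prod (l : List Z) (h : pt ∉ l.filter (fun a => a ≠ pt)) :
    (⟨l.filter (fun a => a ≠ pt), h⟩ : James Z) = (l.map James.incl).prod := by
  induction l with
  | nil => rfl
  | cons z l ih =>
    have h' : pt ∉ l.filter (fun a => a ≠ pt) := by simp
    rw [List.map_cons, List.prod_cons, ← ih h']
    refine Subtype.ext ?_
    change _ = (James.incl z).1 ++ l.filter (fun a => a ≠ pt)
    rw [James.incl_val]
    by_cases hz : z = pt <;> simp [hz]

theorem James.prod_incl (g : James Z) : (g.1.map James.incl).prod = g := by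
  classical
  have h : g.1.filter (fun a => a ≠ pt) = g.1 := by
    rw [List.filter_eq_self]
    intro a ha
    simpa using fun e : a = pt => g.2 (e ▸ ha)
  rw [← James.mk_filter_eq_prod _ (by simp)]
  exact Subtype.ext h

end Words

section Moore

variable {Z : Type u} [BasePoint Z] (L : Z → ℝ) (χ : Z → James Z)
  (N : unitInterval × Z → James Z)

/-- The null homotopy `N`, run on the interval `[0, L z]`. -/
def mooreLetter (z : Z) (s : ℝ) : James Z := N (projIcc 0 1 zero_le_one (s / L z), z)

/-- The length of the null homotopy of a word. -/
def mooreLen (l : List Z) : ℝ := (l.map L).sum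

/-- The inverse of a word. -/
def mooreInv (l : List Z) : James Z := ((l.map χ).reverse).prod

/-- The null homotopy of a word times its inverse: contract the letters one by one, starting with
the last. -/
def moore : List Z → ℝ → James Z
  | [], _ => 1
  | z :: l, s => if s ≤ mooreLen L l then James.incl z * moore l s * χ z
      else mooreLetter L N z (s - mooreLen L l)

variable {L χ N}

@[simp]
theorem mooreLen_cons (z : Z) (l : List Z) : mooreLen L (z :: l) = L z + mooreLen L l := by
  simp [mooreLen]

@[simp]
theorem mooreInv_cons (z : Z) (l : List Z) : mooreInv χ (z :: l) = mooreInv χ l * χ z := by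
  simp [mooreInv]

theorem mooreLen_nonneg (hL : ∀ z, 0 ≤ L z) (l : List Z) : 0 ≤ mooreLen L l :=
  List.sum_nonneg (by simpa using fun z _ => hL z)

theorem mooreLetter_pt (hN : ∀ t, N (t, pt) = 1) (s : ℝ) : mooreLetter L N pt s = 1 := hN _

theorem mooreLetter_zero (hN0 : ∀ z, N (0, z) = James.incl z * χ z) (z : Z) :
    mooreLetter L N z 0 = James.incl z * χ z := by
  rw [mooreLetter, zero_div, projIcc_of_le_left _ le_rfl]
  exact hN0 z

theorem mooreLetter_of_le (hL : ∀ z, 0 ≤ L z) (hL0 : ∀ z, L z = 0 ↔ z = pt)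
    (hN1 : ∀ z, N (1, z) = 1) (hN : ∀ t, N (t, pt) = 1) {z : Z} {s : ℝ} (hs : L z ≤ s) :
    mooreLetter L N z s = 1 := by
  rcases (hL z).eq_or_lt with h | h
  · rw [(hL0 z).1 h.symm, mooreLetter_pt hN]
  · rw [mooreLetter, projIcc_of_right_le _ ((one_le_div h).2 hs)]
    exact hN1 z

theorem moore_zero (hL : ∀ z, 0 ≤ L z) (l : List Z) :
    moore L χ N l 0 = (l.map James.incl).prod * mooreInv χ l := by
  induction l with
  | nil => rfl
  | cons z l ih =>
    rw [moore, if_pos (mooreLen_nonneg hL l), ih, mooreInv_cons, List.map_cons, List.prod_cons]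
    simp only [mul_assoc]

theorem moore_of_le (hL : ∀ z, 0 ≤ L z) (hL0 : ∀ z, L z = 0 ↔ z = pt)
    (hN1 : ∀ z, N (1, z) = 1) (hN : ∀ t, N (t, pt) = 1) (hχ : χ pt = 1) {l : List Z} {s : ℝ}
    (hs : mooreLen L l ≤ s) : moore L χ N l s = 1 := by
  induction l with
  | nil => rfl
  | cons z l ih =>
    rw [mooreLen_cons] at hs
    rw [moore]
    split_ifs with h
    · have hz : z = pt := (hL0 z).1 (le_antisymm (by linarith) (hL z))
      rw [hz, ih (by linarith [hL z]), hχ, James.incl_pt, one_mul, one_mul]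
    · exact mooreLetter_of_le hL hL0 hN1 hN (by linarith)

open Classical in
theorem mooreLen_filter (hL0 : ∀ z, L z = 0 ↔ z = pt) (l : List Z) :
    mooreLen L (l.filter (fun a => a ≠ pt)) = mooreLen L l := by
  induction l with
  | nil => rfl
  | cons z l ih =>
    by_cases hz : z = pt
    · rw [List.filter_cons_of_neg (by simpa using hz), ih, mooreLen_cons, (hL0 z).2 hz, zero_add]
    · rw [List.filter_cons_of_pos (by simpa using hz), mooreLen_cons, ih, mooreLen_cons]

open Classical in
theorem mooreInv_filter (hχ : χ pt = 1) (l : List Z) :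
    mooreInv χ (l.filter (fun a => a ≠ pt)) = mooreInv χ l := by
  induction l with
  | nil => rfl
  | cons z l ih =>
    by_cases hz : z = pt
    · rw [List.filter_cons_of_neg (by simpa using hz), ih, mooreInv_cons, hz, hχ, mul_one]
    · rw [List.filter_cons_of_pos (by simpa using hz), mooreInv_cons, ih, mooreInv_cons]

-- A base-point letter has length `0`, so deleting it changes neither the value nor the timing of
-- the path. This is why each letter runs for time `L z` rather than for unit time, and it makes the
-- homotopy well defined on `J(Z)`.
open Classical in
theorem moore_filter (hL : ∀ z, 0 ≤ L z) (hL0 : ∀ z, L z = 0 ↔ z = pt)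
    (hN1 : ∀ z, N (1, z) = 1) (hN : ∀ t, N (t, pt) = 1) (hχ : χ pt = 1) (l : List Z) (s : ℝ) :
    moore L χ N (l.filter (fun a => a ≠ pt)) s = moore L χ N l s := by
  induction l with
  | nil => rfl
  | cons z l ih =>
    by_cases hz : z = pt
    · rw [List.filter_cons_of_neg (by simpa using hz), ih, moore]
      split_ifs with h
      · rw [hz, hχ, James.incl_pt, one_mul, mul_one]
      · rw [hz, mooreLetter_pt hN, moore_of_le hL hL0 hN1 hN hχ (not_le.1 h).le]
    · rw [List.filter_cons_of_pos (by simpa using hz), moore, moore, ih, mooreLen_filter hL0]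

variable [TopologicalSpace Z]

/-- The quotient `s / L z` is uncontrolled near the base point, but `N (t, pt) = 1` for all `t`;
compactness of the interval puts `N (t, z)` into a given neighbourhood of `1` for all `t` once `z`
is close to `pt`. -/
theorem continuous_mooreLetter (hLc : Continuous L) (hL0 : ∀ z, L z = 0 ↔ z = pt)
    (hNc : Continuous N) (hN : ∀ t, N (t, pt) = 1) :
    Continuous fun p : ℝ × Z => mooreLetter L N p.2 p.1 := by
  refine continuous_iff_continuousAt.2 fun ⟨s, z⟩ => ?_
  by_cases hz : z = pt
  · subst hz
    intro O hO
    have hO1 : O ∈ 𝓝 (1 : James Z) := by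
      change O ∈ 𝓝 (mooreLetter L N pt s) at hO
      rwa [mooreLetter_pt hN] at hO
    have key : ∀ᶠ z in 𝓝 (pt : Z), ∀ t ∈ (univ : Set unitInterval), N (t, z) ∈ O := by
      refine isCompact_univ.eventually_forall_of_forall_eventually fun t _ => ?_
      have : Filter.Tendsto (fun q : Z × unitInterval => N (q.2, q.1)) (𝓝 (pt, t))
          (𝓝 (N (t, pt))) := (hNc.comp continuous_swap).continuousAt
      rw [hN] at this
      exact this hO1
    have := (continuous_snd (X := ℝ) (Y := Z)).continuousAt (x := (s, (pt : Z))) key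
    exact Filter.mem_map.2 (Filter.mem_of_superset (Filter.mem_map.1 this)
      fun p hp => hp _ (mem_univ _))
  · have h1 : ContinuousAt (fun p : ℝ × Z => p.1 / L p.2) (s, z) :=
      continuousAt_fst.div (hLc.comp continuous_snd).continuousAt fun h => hz ((hL0 z).1 h)
    exact ContinuousAt.comp (f := fun p : ℝ × Z => (projIcc 0 1 zero_le_one (p.1 / L p.2), p.2))
      (g := N) hNc.continuousAt
      ((continuous_projIcc.continuousAt.comp h1).prodMk continuousAt_snd)

variable {A : Type u} [TopologicalSpace A] [CompactlyGeneratedSpace A]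

theorem continuous_mooreLen (hLc : Continuous L) {m : ℕ} {x : A → Fin m → Z}
    (hx : ∀ i, Continuous fun a => x a i) : Continuous fun a => mooreLen L (List.ofFn (x a)) := by
  simp only [mooreLen, List.map_ofFn, List.sum_ofFn, Function.comp_def]
  exact continuous_finsetSum _ fun i _ => hLc.comp (hx i)

theorem continuous_mooreInv (hχ : Continuous χ) {m : ℕ} {x : A → Fin m → Z}
    (hx : ∀ i, Continuous fun a => x a i) : Continuous fun a => mooreInv χ (List.ofFn (x a)) := by
  induction m with
  | zero => simpa [mooreInv] using continuous_const
  | succ m ih =>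
    simp only [List.ofFn_succ, mooreInv_cons]
    exact James.continuous_mul (ih fun i => hx i.succ) (hχ.comp (hx 0))

/-- When the tail of the word has just been contracted, what remains is the first letter times its
inverse, which is where `N` starts. -/
theorem continuous_moore [CompactlyGeneratedSpace Z] (hLc : Continuous L) (hL : ∀ z, 0 ≤ L z)
    (hL0 : ∀ z, L z = 0 ↔ z = pt) (hχc : Continuous χ) (hNc : Continuous N)
    (hN0 : ∀ z, N (0, z) = James.incl z * χ z) (hN1 : ∀ z, N (1, z) = 1)
    (hN : ∀ t, N (t, pt) = 1) (hχ : χ pt = 1) {m : ℕ} {x : A → Fin m → Z}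
    (hx : ∀ i, Continuous fun a => x a i) {s : A → ℝ} (hs : Continuous s) :
    Continuous fun a => moore L χ N (List.ofFn (x a)) (s a) := by
  induction m with
  | zero => simpa [moore] using continuous_const
  | succ m ih =>
    simp only [List.ofFn_succ, moore]
    have hlen : Continuous fun a => mooreLen L (List.ofFn fun i : Fin m => x a i.succ) :=
      continuous_mooreLen hLc fun i => hx i.succ
    refine Continuous.if_le (James.continuous_mul (James.continuous_mul
      (James.continuous_incl.comp (hx 0)) (ih fun i => hx i.succ)) (hχc.comp (hx 0)))
      ((continuous_mooreLetter hLc hL0 hNc hN).comp ((hs.sub hlen).prodMk (hx 0))) hs hlen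
      fun a ha => ?_
    rw [ha, sub_self, mooreLetter_zero hN0, moore_of_le hL hL0 hN1 hN hχ le_rfl, mul_one]

/-- A pointed right inverse of the inclusion `Z → J(Z)` extends to one of the identity. -/
theorem RightInv.nonempty_of_incl [CompactlyGeneratedSpace Z] (hLc : Continuous L)
    (hL : ∀ z, 0 ≤ L z) (hL0 : ∀ z, L z = 0 ↔ z = pt) (hχc : Continuous χ) (hNc : Continuous N)
    (hN0 : ∀ z, N (0, z) = James.incl z * χ z) (hN1 : ∀ z, N (1, z) = 1)
    (hN : ∀ t, N (t, pt) = 1) (hχ : χ pt = 1) : Nonempty (RightInv Z) := by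
  classical
  refine ⟨{
    -- Inverses are multiplied in reverse order so that the last letter meets its own inverse first.
    -- The homotopy below is rescaled by the total length of the word.
    χ := ⟨fun g => mooreInv χ g.1, ?_⟩
    N := ⟨fun p => moore L χ N p.2.1 (p.1 * mooreLen L p.2.1), ?_⟩
    N_zero := fun g => ?_
    N_one := fun g => ?_
    N_unit := fun t => rfl }⟩
  · refine James.isQuotientMap_word.continuous_iff.2 (continuous_sigma fun n => ?_)
    have e : (fun x : Power (Fin n) Z => mooreInv χ (James.word ⟨n, x⟩).1) =
        fun x : Power (Fin n) Z => mooreInv χ (List.ofFn x.out) :=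
      funext fun x => mooreInv_filter hχ _
    exact e ▸ continuous_mooreInv hχc fun i => Power.continuous_apply i
  · refine James.isQuotientMap_word.continuous_lift_prod_right ?_
    refine (Homeomorph.isQuotientMap (Homeomorph.prodComm _ _)).continuous_iff.2 ?_
    refine (Homeomorph.sigmaProdDistrib (X := fun n : ℕ => Power (Fin n) Z)
      (Y := unitInterval)).symm.isQuotientMap.continuous_iff.2 (continuous_sigma fun n => ?_)
    refine (Homeomorph.isQuotientMap (Homeomorph.prodComm _ _)).continuous_iff.2 ?_
    have e : (fun p : unitInterval × Power (Fin n) Z =>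
        moore L χ N (James.word ⟨n, p.2⟩).1 (p.1 * mooreLen L (James.word ⟨n, p.2⟩).1)) =
        fun p : unitInterval × Power (Fin n) Z =>
          moore L χ N (List.ofFn p.2.out) (p.1 * mooreLen L (List.ofFn p.2.out)) := by
      funext p
      have h1 : mooreLen L (James.word ⟨n, p.2⟩).1 = mooreLen L (List.ofFn p.2.out) :=
        mooreLen_filter hL0 _
      rw [h1]
      exact moore_filter hL hL0 hN1 hN hχ _ _
    have hx : ∀ i : Fin n, Continuous fun p : unitInterval × Power (Fin n) Z => p.2.out i :=
      fun i => (Power.continuous_apply i).comp continuous_snd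
    have key : Continuous fun p : unitInterval × Power (Fin n) Z =>
        moore L χ N (List.ofFn p.2.out) (p.1 * mooreLen L (List.ofFn p.2.out)) :=
      continuous_moore hLc hL hL0 hχc hNc hN0 hN1 hN hχ hx
        ((continuous_subtype_val.comp continuous_fst).mul (continuous_mooreLen hLc hx))
    rw [← e] at key
    exact key
  · change moore L χ N g.1 ((0 : unitInterval) * mooreLen L g.1) = g * mooreInv χ g.1
    rw [Icc.coe_zero, zero_mul, moore_zero hL, James.prod_incl]
  · change moore L χ N g.1 ((1 : unitInterval) * mooreLen L g.1) = 1
    exact moore_of_le hL hL0 hN1 hN hχ (by simp)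

end Moore

theorem RightInv.nonempty_smash {X : Type u} [TopologicalSpace X] [CompactlyGeneratedSpace X]
    [BasePoint X] (hX : NondegenerateBasePoint X) (hcat : WeakCatLtTwo X) {k : ℕ} (hk : 1 ≤ k) :
    Nonempty (RightInv (Smash k X)) := by
  obtain ⟨χ, N, hχ, hN, hN0, hN1, hχp, hNp⟩ := exists_rightInverse_incl hX hcat hk
  obtain ⟨v, h, hv, -⟩ := hX
  refine RightInv.nonempty_of_incl (L := Smash.wt v hv) (Smash.continuous_wt v hv) ?_ ?_ hχ hN hN0
    hN1 hNp hχp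
  · rintro ⟨x⟩
    exact wt_nonneg v x
  · rintro ⟨x⟩
    exact (wt_eq_zero_iff hv).trans (Smash.mk_eq_pt_iff hk).symm

/-! ### Groups of homotopy classes and strict representatives -/

theorem PClass.mk_eq_of_homotopy {A B : Type u} [TopologicalSpace A] [BasePoint A]
    [TopologicalSpace B] [BasePoint B] {f g : PMap A B} {H : unitInterval × A → B}
    (hH : Continuous H) (h0 : ∀ a, H (0, a) = f.1 a) (h1 : ∀ a, H (1, a) = g.1 a)
    (hp : ∀ t, H (t, pt) = pt) : PClass.mk f = PClass.mk g := by
  refine PClass.mk_eq_mk_iff.2 ⟨⟨⟨⟨H, hH⟩, h0, h1⟩, ?_⟩⟩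
  intro t a ha
  rw [mem_singleton_iff.1 ha]
  exact (hp t).trans f.2.symm

section RightInv

variable {A Z : Type u} [TopologicalSpace A] [BasePoint A] [CompactlyGeneratedSpace A]
  [TopologicalSpace Z] [BasePoint Z]

theorem RightInv.χ_one (R : RightInv Z) : R.χ 1 = 1 := by
  rw [← one_mul (R.χ 1), ← R.N_zero, R.N_unit]

/-- The composite of a pointed map with the inverse of `J(Z)`. -/
def RightInv.comp (R : RightInv Z) (f : PMap A (James Z)) : PMap A (James Z) :=
  ⟨R.χ.comp f.1, by
    change R.χ (f.1 pt) = pt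
    rw [f.2]
    exact R.χ_one⟩

theorem RightInv.mul_comp (R : RightInv Z) (f : PMap A (James Z)) :
    PClass.mk f * PClass.mk (R.comp f) = 1 := by
  refine PClass.mk_eq_of_homotopy (H := fun p => R.N (p.1, f.1 p.2)) (by fun_prop)
    (fun a => R.N_zero _) (fun a => R.N_one _) fun t => ?_
  rw [f.2]
  exact R.N_unit t

/-- A monoid in which every element has a right inverse is a group. -/
theorem RightInv.isUnit (R : RightInv Z) (a : PClass A (James Z)) : IsUnit a := by
  have h : ∀ a : PClass A (James Z), ∃ b, a * b = 1 := fun a => by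
    obtain ⟨f, rfl⟩ := a.exists_mk
    exact ⟨_, R.mul_comp f⟩
  obtain ⟨b, hb⟩ := h a
  obtain ⟨c, hc⟩ := h b
  have : a = c := by rw [← mul_one a, ← hc, ← mul_assoc, hb, one_mul]
  exact ⟨⟨a, b, hb, this ▸ hc⟩, rfl⟩

/-- A class as an element of the group of invertible classes. -/
def RightInv.unit (R : RightInv Z) (a : PClass A (James Z)) : HGroup A Z := (R.isUnit a).unit

end RightInv

/-- A representation of the base point as a neighbourhood deformation retract. -/
structure NDR (X : Type u) [TopologicalSpace X] [BasePoint X] where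
  /-- The function cutting out the base point. -/
  v : C(X, unitInterval)
  /-- The deformation. -/
  h : C(unitInterval × X, X)
  v_eq_zero : ∀ x, v x = 0 ↔ x = pt
  h_zero : ∀ x, h (0, x) = x
  h_pt : ∀ t, h (t, pt) = pt
  h_one : ∀ x, v x < 1 → h (1, x) = pt

theorem NondegenerateBasePoint.nonempty_ndr {X : Type u} [TopologicalSpace X] [BasePoint X]
    (hX : NondegenerateBasePoint X) : Nonempty (NDR X) := by
  obtain ⟨v, h, hv, h0, hpt, h1⟩ := hX
  exact ⟨⟨v, h, hv, h0, hpt, h1⟩⟩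

/-! ### Making maps strictly trivial on coordinate subspaces -/

section Strictify

variable {ι : Type} {X Z : Type u} [TopologicalSpace X] [BasePoint X] [TopologicalSpace Z]
  [BasePoint Z] (D : NDR X) (R : RightInv Z)

open Classical in
/-- The deformation of the base point neighbourhood, applied to the coordinates in `S`. -/
def NDR.push (S : Set ι) (t : unitInterval) (x : Power ι X) : Power ι X :=
  KIfy.of fun i => if i ∈ S then D.h (t, x.out i) else x.out i

theorem NDR.push_apply (S : Set ι) (t : unitInterval) (x : Power ι X) (i : ι) [Decidable (i ∈ S)] :
    (D.push S t x).out i = if i ∈ S then D.h (t, x.out i) else x.out i := by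
  classical
  unfold NDR.push KIfy.of KIfy.out
  beta_reduce
  congr

theorem NDR.continuous_push {B : Type u} [TopologicalSpace B] [CompactlyGeneratedSpace B]
    (S : Set ι) {t : B → unitInterval} {x : B → Power ι X} (ht : Continuous t)
    (hx : Continuous x) : Continuous fun b => D.push S (t b) (x b) := by
  refine Power.continuous_mk fun i => ?_
  have h1 := (Power.continuous_apply i).comp hx
  by_cases hi : i ∈ S
  · simp only [if_pos hi]
    exact D.h.continuous.comp (ht.prodMk h1)
  · simp only [if_neg hi]
    exact h1

theorem NDR.push_zero (S : Set ι) (x : Power ι X) : D.push S 0 x = x := by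
  classical
  funext i
  refine (NDR.push_apply D S 0 x i).trans ?_
  rw [D.h_zero, ite_self]
  rfl

theorem NDR.push_apply_eq_pt (S : Set ι) (t : unitInterval) {x : Power ι X} {i : ι}
    (hx : x.out i = pt) : (D.push S t x).out i = pt := by
  classical
  rw [NDR.push_apply, hx, D.h_pt, ite_self]

theorem NDR.push_one_apply_eq_pt {S : Set ι} {x : Power ι X} {i : ι} (hi : i ∈ S)
    (hx : D.v (x.out i) < 1) : (D.push S 1 x).out i = pt := by
  classical
  rw [NDR.push_apply, if_pos hi, D.h_one _ hx]

theorem NDR.push_pt (S : Set ι) (t : unitInterval) : D.push S t (pt : Power ι X) = pt :=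
  funext fun _ => D.push_apply_eq_pt S t rfl

theorem kill_of_mem {T : Set ι} {i : ι} (hi : i ∈ T) : kill T i = none := if_pos hi

theorem insertPt_kill_apply (T : Set ι) (x : Power ι X) (i : ι) [Decidable (i ∈ T)] :
    ((insertPt X (kill T)).1 x).out i = if i ∈ T then pt else x.out i := by
  classical
  change (kill T i).elim pt x.out = _
  unfold kill
  split_ifs <;> rfl

theorem insertPt_kill_singleton_eq_self {i : ι} {x : Power ι X} (hx : x.out i = pt) :
    (insertPt X (kill {i})).1 x = x := by
  classical
  funext j
  refine (insertPt_kill_apply {i} x j).trans ?_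
  split_ifs with h
  · rw [mem_singleton_iff.1 h]
    exact hx.symm
  · rfl

theorem insertPt_kill_apply_eq_pt (T : Set ι) {i : ι} {x : Power ι X} (hx : x.out i = pt) :
    ((insertPt X (kill T)).1 x).out i = pt := by
  classical
  rw [insertPt_kill_apply, hx, ite_self]

/-- For `r = 1`, the modification of `x ↦ f x * χ (f (x with i-th coordinate killed))` that is
strictly trivial where the `i`-th coordinate is the base point. -/
def strictify (r : unitInterval) (i : ι) (f : Power ι X → James Z) (x : Power ι X) : James Z :=
  if (D.v (x.out i) : ℝ) ≤ 1 / 2 then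
    R.N (projIcc 0 1 zero_le_one (r * (1 - 2 * D.v (x.out i))), f (D.push {i} 1 x))
  else f (D.push {i} 1 x) * R.χ (f ((insertPt X (kill {i})).1 (D.push {i} 1 x)))

variable {D R}

/-- For `v ≤ 1 / 2 < 1` the deformation has already moved coordinate `i` to the base point. The
product in `strictify` is then of the form `g * χ g`, which is where `N` starts, so the two branches
meet. -/
theorem insertPt_kill_push {i : ι} {x : Power ι X} (hx : (D.v (x.out i) : ℝ) ≤ 1 / 2) :
    (insertPt X (kill {i})).1 (D.push {i} 1 x) = D.push {i} 1 x :=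
  insertPt_kill_singleton_eq_self (D.push_one_apply_eq_pt (mem_singleton i)
    (Subtype.coe_lt_coe.1 (show (D.v (x.out i) : ℝ) < 1 by linarith)))

theorem continuous_strictify {B : Type u} [TopologicalSpace B] [CompactlyGeneratedSpace B]
    {r : B → unitInterval} {i : ι} {F : B → Power ι X → James Z} {y : B → Power ι X}
    (hr : Continuous r)
    (hF : ∀ z : B → Power ι X, Continuous z → Continuous fun b => F b (z b))
    (hy : Continuous y) : Continuous fun b => strictify D R (r b) i (F b) (y b) := by
  have hv : Continuous fun b => (D.v ((y b).out i) : ℝ) :=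
    continuous_subtype_val.comp (D.v.continuous.comp ((Power.continuous_apply i).comp hy))
  have hp : Continuous fun b => D.push {i} 1 (y b) := D.continuous_push _ continuous_const hy
  have h1 := hF _ hp
  have h2 := hF _ ((insertPt X (kill {i})).1.continuous.comp hp)
  refine Continuous.if_le (R.N.continuous.comp (Continuous.prodMk
    (continuous_projIcc.comp (by fun_prop)) h1))
    (James.continuous_mul h1 (R.χ.continuous.comp h2)) hv continuous_const fun b hb => ?_
  have e := insertPt_kill_push (D := D) hb.le
  have e2 : projIcc (0 : ℝ) 1 zero_le_one (r b * (1 - 2 * D.v ((y b).out i))) = 0 :=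
    projIcc_of_le_left _ (by rw [hb]; simp)
  change R.N (projIcc (0 : ℝ) 1 zero_le_one (r b * (1 - 2 * D.v ((y b).out i))), _) =
    _ * R.χ (F b ((insertPt X (kill {i})).1 (D.push {i} 1 (y b))))
  rw [e2, e]
  exact R.N_zero _

theorem strictify_one_of_eq_pt {i : ι} (f : Power ι X → James Z) {x : Power ι X}
    (hx : x.out i = pt) : strictify D R 1 i f x = 1 := by
  have hv : D.v (x.out i) = 0 := (D.v_eq_zero _).2 hx
  rw [strictify, hv, if_pos (by simp), projIcc_of_right_le _ (by simp)]
  exact R.N_one _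

theorem strictify_eq_one {r : unitInterval} {i : ι} {f : Power ι X → James Z} {x : Power ι X}
    (h1 : f (D.push {i} 1 x) = 1) (h2 : f ((insertPt X (kill {i})).1 (D.push {i} 1 x)) = 1) :
    strictify D R r i f x = 1 := by
  rw [strictify, h1, h2, R.χ_one, mul_one, R.N_unit, ite_self]

/-- Both the deformation and killing coordinate `i` keep coordinate `j` at the base point; hence
coordinates can be treated one after another. -/
theorem strictify_eq_one_of_eq_pt {r : unitInterval} {i j : ι} {f : Power ι X → James Z}
    (hf : ∀ x : Power ι X, x.out j = pt → f x = 1) {x : Power ι X} (hx : x.out j = pt) :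
    strictify D R r i f x = 1 :=
  strictify_eq_one (hf _ (D.push_apply_eq_pt _ _ hx))
    (hf _ (insertPt_kill_apply_eq_pt _ (D.push_apply_eq_pt _ _ hx)))

theorem strictify_of_strict {r : unitInterval} {i : ι} {f : Power ι X → James Z}
    (hf : ∀ x : Power ι X, x.out i = pt → f x = 1) (x : Power ι X) :
    strictify D R r i f x = f (D.push {i} 1 x) := by
  rw [strictify]
  split_ifs with h
  · have : f (D.push {i} 1 x) = 1 := hf _ (D.push_one_apply_eq_pt (mem_singleton i)
      (Subtype.coe_lt_coe.1 (show (D.v (x.out i) : ℝ) < 1 by linarith)))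
    rw [this, R.N_unit]
  · classical
    rw [hf _ ((insertPt_kill_apply {i} _ i).trans (if_pos rfl)), R.χ_one, mul_one]

theorem strictify_zero (i : ι) (f : Power ι X → James Z) (x : Power ι X) :
    strictify D R 0 i f x =
      f (D.push {i} 1 x) * R.χ (f ((insertPt X (kill {i})).1 (D.push {i} 1 x))) := by
  rw [strictify]
  split_ifs with h
  · rw [insertPt_kill_push h, Icc.coe_zero, zero_mul, projIcc_of_le_left _ le_rfl]
    exact R.N_zero _
  · rfl

variable (D R)

/-- The strictification of a pointed map. -/
def strictifyMap (i : ι) (f : PMap (Power ι X) (James Z)) : PMap (Power ι X) (James Z) :=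
  ⟨⟨strictify D R 1 i f.1, continuous_strictify continuous_const
    (fun _ hz => f.1.continuous.comp hz) continuous_id⟩, strictify_one_of_eq_pt _ rfl⟩

/-- Moving `r` from `1` to `0` undoes the modification near the base point, and running the
deformation backwards then removes `D.push`. -/
theorem mk_strictifyMap (i : ι) (f : PMap (Power ι X) (James Z)) :
    PClass.mk (strictifyMap D R i f) =
      PClass.mk f * PClass.mk (R.comp (f.comp (insertPt X (kill {i})))) := by
  have hpt : ∀ r, strictify D R r i f.1 pt = 1 := fun r => by
    refine strictify_eq_one ?_ ?_ <;> rw [D.push_pt]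
    · exact f.2
    · rw [(insertPt X (kill {i})).2]
      exact f.2
  let f₀ : PMap (Power ι X) (James Z) := ⟨⟨strictify D R 0 i f.1, continuous_strictify
    continuous_const (fun _ hz => f.1.continuous.comp hz) continuous_id⟩, hpt 0⟩
  have e1 : PClass.mk f₀ = PClass.mk (strictifyMap D R i f) :=
    PClass.mk_eq_of_homotopy (H := fun p => strictify D R p.1 i f.1 p.2)
      (continuous_strictify continuous_fst (fun _ hz => f.1.continuous.comp hz) continuous_snd)
      (fun _ => rfl) (fun _ => rfl) hpt
  rw [← e1, PClass.mk_mul]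
  let g : PMap (Power ι X) (James Z) := f.mul (R.comp (f.comp (insertPt X (kill {i}))))
  refine (PClass.mk_eq_of_homotopy (H := fun p => g.1 (D.push {i} p.1 p.2))
    (g.1.continuous.comp (D.continuous_push _ continuous_fst continuous_snd)) (fun x => ?_)
    (fun x => ?_) fun t => ?_).symm
  · rw [D.push_zero]
  · exact (strictify_zero i _ x).symm
  · rw [D.push_pt]
    exact g.2

/-- A class that becomes trivial when any one of the coordinates in `S` is killed has a
representative that is trivial wherever one of these coordinates is the base point. -/
theorem exists_strict_representative (D : NDR X) (R : RightInv Z) (S : Finset ι)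
    (a : PClass (Power ι X) (James Z)) (ha : ∀ i ∈ S, pullback (insertPt X (kill {i})) a = 1) :
    ∃ f, PClass.mk f = a ∧ ∀ i ∈ S, ∀ x : Power ι X, x.out i = pt → f.1 x = 1 := by
  classical
  induction S using Finset.induction_on with
  | empty =>
    obtain ⟨f, rfl⟩ := a.exists_mk
    exact ⟨f, rfl, by simp⟩
  | insert i S hi ih =>
    obtain ⟨f, rfl, hf⟩ := ih fun j hj => ha j (Finset.mem_insert_of_mem hj)
    refine ⟨strictifyMap D R i f, ?_, fun j hj x hx => ?_⟩
    · rw [mk_strictifyMap]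
      -- Killing coordinate `i` makes the class trivial, so the correcting factor is trivial and the
      -- class is unchanged.
      have h := R.mul_comp (f.comp (insertPt X (kill {i})))
      have h' := ha i (Finset.mem_insert_self i S)
      rw [pullback_mk] at h'
      rw [h', one_mul] at h
      rw [h, mul_one]
    · rcases Finset.mem_insert.1 hj with rfl | hj
      · exact strictify_one_of_eq_pt _ hx
      · exact strictify_eq_one_of_eq_pt (hf j hj) hx

end Strictify

/-! ### Consequences of the null homotopic diagonal -/

section Diagonal

variable {ι κ : Type} {X Z : Type u} [TopologicalSpace X] [BasePoint X]
  [CompactlyGeneratedSpace X] [TopologicalSpace Z] [BasePoint Z]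

/-- A class that becomes trivial when either of two coordinates is killed becomes trivial when the
two coordinates are identified. -/
theorem pullback_insertPt_eq_one (D : NDR X) (R : RightInv Z) (hcat : WeakCatLtTwo X) {i j : κ}
    (hij : i ≠ j) {c : PClass (Power κ X) (James Z)}
    (hi : pullback (insertPt X (kill {i})) c = 1) (hj : pullback (insertPt X (kill {j})) c = 1)
    {d : κ → ι} (hd : d i = d j) : pullback (insertPt X fun m => some (d m)) c = 1 := by
  classical
  obtain ⟨f, rfl, hf⟩ := exists_strict_representative D R {i, j} c (by simp [hi, hj])
  obtain ⟨F⟩ := hcat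
  -- Replace the coordinates `i` and `j` by a pair. The strict representative is trivial on the fat
  -- wedge of such pairs, so it depends only on their smash product.
  let P : Power (Fin 2) X → Power κ X → Power κ X := fun p y =>
    KIfy.of fun m => if m = i then p.out 0 else if m = j then p.out 1 else y.out m
  have hP : ∀ y p, (∃ b, p.out b = pt) → f.1 (P p y) = 1 := by
    rintro y p ⟨b, hb⟩
    fin_cases b
    · exact hf i (by simp) _ ((if_pos rfl).trans hb)
    · exact hf j (by simp) _ ((if_neg hij.symm).trans ((if_pos rfl).trans hb))
  let g : Smash 2 X × Power κ X → James Z := fun q =>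
    Smash.lift (fun p => f.1 (P p q.2)) 1 (hP q.2) q.1
  have hg : ∀ (K : Type u) [TopologicalSpace K] [CompactSpace K] [T2Space K] (z : K → Smash 2 X)
      (y : K → Power κ X), Continuous z → Continuous y → Continuous fun k => g (z k, y k) := by
    intro K _ _ _ z y hz hy
    have : Continuous fun q : Smash 2 X × K => g (q.1, y q.2) := by
      refine Smash.isQuotientMap_mk.continuous_lift_prod_left ?_
      have : CompactlyGeneratedSpace (Power (Fin 2) X × K) := cg_prod
      refine f.1.continuous.comp (Power.continuous_mk fun m => ?_)
      by_cases hmi : m = i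
      · simp only [if_pos hmi]
        exact (Power.continuous_apply 0).comp continuous_fst
      · by_cases hmj : m = j
        · simp only [if_neg hmi, if_pos hmj]
          exact (Power.continuous_apply 1).comp continuous_fst
        · simp only [if_neg hmi, if_neg hmj]
          exact (Power.continuous_apply m).comp (hy.comp continuous_snd)
    exact this.comp (hz.prodMk continuous_id)
  rw [pullback_mk, PClass.one_def]
  -- After identification both coordinates equal `x.out (d i)`, so the pair is diagonal and `F`
  -- contracts it.
  refine PClass.mk_eq_of_homotopy (H := fun q : unitInterval × Power ι X =>
    g (F (q.1, q.2.out (d i)), (insertPt X fun m => some (d m)).1 q.2)) ?_ (fun x => ?_)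
    (fun x => ?_) fun t => ?_
  · refine continuous_from_compactlyGeneratedSpace _ fun K _ _ _ q hq => hg K _ _ ?_ ?_
    · have := (Power.continuous_apply (d i)).comp (continuous_snd.comp hq)
      exact F.continuous.comp ((continuous_fst.comp hq).prodMk this)
    · exact (insertPt X fun m => some (d m)).1.continuous.comp (continuous_snd.comp hq)
  · rw [F.apply_zero]
    change f.1 (P (KIfy.of fun _ => x.out (d i)) _) = f.1 ((insertPt X fun m => some (d m)).1 x)
    refine congrArg f.1 (funext fun m => ?_)
    change (if m = i then x.out (d i) else if m = j then x.out (d i) else x.out (d m)) =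
      x.out (d m)
    split_ifs with h1 h2
    · rw [h1]
    · rw [h2, hd]
    · rfl
  · rw [F.apply_one]
    exact hP _ pt ⟨0, rfl⟩
  · have : F (t, (pt : Power ι X).out (d i)) = pt := F.eq_fst t rfl
    rw [this]
    exact hP _ pt ⟨0, rfl⟩

/-- Classes that become trivial when a given coordinate is killed commute with each other. -/
theorem commute_of_kill_eq_one (D : NDR X) (R : RightInv Z) (hcat : WeakCatLtTwo X) (i : ι)
    {a b : HGroup (Power ι X) Z} (ha : gpullback (insertPt X (kill {i})) a = 1)
    (hb : gpullback (insertPt X (kill {i})) b = 1) : Commute a b := by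
  classical
  -- Double the coordinate `i`: `a` reads the copy `some i`, `b` reads `none`, and `d` identifies
  -- the two. The commutator dies when either copy is killed, since then `a'` or `b'` does.
  let fa : ι → Option (Option ι) := fun j => some (some j)
  let fb : ι → Option (Option ι) := fun j => if j = i then some none else some (some j)
  let d : Option ι → ι := fun o => o.getD i
  have eta : ∀ j, (kill {some i} (some j) : Option (Option ι)) = (kill {i} j).bind fa := fun j => by
    by_cases h : j = i <;> simp [kill, h, fa]
  have hfa : (fun j => (fa j).bind (kill {some i})) = fun j => (kill {i} j).bind fa :=
    funext fun j => eta j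
  have hfb : (fun j => (fb j).bind (kill {none})) = fun j => (kill {i} j).bind fa := by
    funext j
    by_cases h : j = i <;> simp [kill, h, fa, fb]
  have hda : (fun j => (fa j).bind fun m => some (d m)) = some := funext fun j => rfl
  have hdb : (fun j => (fb j).bind fun m => some (d m)) = some := by
    funext j
    by_cases h : j = i <;> simp [fb, d, h]
  let a' := gpullback (insertPt X fa) a
  let b' := gpullback (insertPt X fb) b
  have ha' : gpullback (insertPt X (kill {some i})) a' = 1 := by
    rw [gpullback_gpullback, insertPt_comp, hfa, ← insertPt_comp, ← gpullback_gpullback, ha,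
      map_one]
  have hb' : gpullback (insertPt X (kill {none})) b' = 1 := by
    rw [gpullback_gpullback, insertPt_comp, hfb, ← insertPt_comp, ← gpullback_gpullback, hb,
      map_one]
  have h1 : gpullback (insertPt X (kill {some i})) (a' * b' * a'⁻¹ * b'⁻¹) = 1 := by
    simp only [map_mul, map_inv, ha']
    simp
  have h2 : gpullback (insertPt X (kill {none})) (a' * b' * a'⁻¹ * b'⁻¹) = 1 := by
    simp only [map_mul, map_inv, hb']
    simp
  have key := pullback_insertPt_eq_one D R hcat (Option.some_ne_none i) (congrArg Units.val h1)
    (congrArg Units.val h2) (d := d) rfl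
  have key' : gpullback (insertPt X fun m => some (d m)) (a' * b' * a'⁻¹ * b'⁻¹) = 1 :=
    Units.ext key
  have ea : gpullback (insertPt X fun m => some (d m)) a' = a := by
    rw [gpullback_gpullback, insertPt_comp, hda]
    exact Units.ext (insertPt_some X a.1)
  have eb : gpullback (insertPt X fun m => some (d m)) b' = b := by
    rw [gpullback_gpullback, insertPt_comp, hdb]
    exact Units.ext (insertPt_some X b.1)
  rw [map_mul, map_mul, map_mul, map_inv, map_inv, ea, eb] at key'
  exact mul_inv_eq_iff_eq_mul.1 (by simpa [mul_inv_eq_one, mul_inv_eq_iff_eq_mul] using key')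

end Diagonal

/-! ### The relations of the combinatorial groups -/

section Algebra

variable {H : Type*} [Group H]

theorem comm_mem_left {K : Subgroup H} [K.Normal] {a : H} (ha : a ∈ K) (b : H) : comm a b ∈ K := by
  have : comm a b = a⁻¹ * (b⁻¹ * a * b⁻¹⁻¹) := by simp [comm, mul_assoc]
  rw [this]
  exact K.mul_mem (K.inv_mem ha) (Subgroup.Normal.conj_mem inferInstance a ha b⁻¹)

theorem comm_mem_right {K : Subgroup H} [K.Normal] (a : H) {b : H} (hb : b ∈ K) :
    comm a b ∈ K := by
  have : comm a b = a⁻¹ * b⁻¹ * a⁻¹⁻¹ * b := by simp [comm, mul_assoc]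
  rw [this]
  exact K.mul_mem (Subgroup.Normal.conj_mem inferInstance _ (K.inv_mem hb) a⁻¹) hb

/-- The commutator is the product of `a⁻¹` and a conjugate of `a`, which commute because both lie in
the abelian normal subgroup `K`. -/
theorem comm_zpow_left {K : Subgroup H} [K.Normal] (hK : ∀ x ∈ K, ∀ y ∈ K, Commute x y) {a : H}
    (ha : a ∈ K) (b : H) (m : ℤ) : comm (a ^ m) b = comm a b ^ m := by
  have e : ∀ x : H, comm x b = x⁻¹ * (b⁻¹ * x * b⁻¹⁻¹) := fun x => by simp [comm, mul_assoc]
  have hc : Commute a⁻¹ (b⁻¹ * a * b⁻¹⁻¹) :=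
    hK _ (K.inv_mem ha) _ (Subgroup.Normal.conj_mem inferInstance a ha b⁻¹)
  rw [e, e, hc.mul_zpow, conj_zpow, inv_zpow]

theorem comm_zpow_right {K : Subgroup H} [K.Normal] (hK : ∀ x ∈ K, ∀ y ∈ K, Commute x y) (a : H)
    {b : H} (hb : b ∈ K) (m : ℤ) : comm a (b ^ m) = comm a b ^ m := by
  have e : ∀ x : H, comm a x = a⁻¹ * x⁻¹ * a⁻¹⁻¹ * x := fun x => by simp [comm, mul_assoc]
  have hc : Commute (a⁻¹ * b⁻¹ * a⁻¹⁻¹) b :=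
    hK _ (Subgroup.Normal.conj_mem inferInstance _ (K.inv_mem hb) a⁻¹) _ hb
  rw [e, e, hc.mul_zpow, conj_zpow, inv_zpow]

variable {ι : Type} {k : ℕ} {g : (Fin k → ι) → H} {K : ι → Subgroup H} [∀ i, (K i).Normal]

/-- `s` records the indices met so far, and normality keeps the running commutator in `K i` for
every `i ∈ s`. At the first repeated index the next commutator is taken inside an abelian `K i`. -/
theorem iterComm_eq_one_of_not_nodup (hK : ∀ i, ∀ x ∈ K i, ∀ y ∈ K i, Commute x y)
    (hg : ∀ I j, g I ∈ K (I j)) (hinj : ∀ I, ¬ Function.Injective I → g I = 1)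
    (w : List (Fin k → ι)) (a : H) (s : List ι) (hs : s.Nodup) (ha : ∀ i ∈ s, a ∈ K i)
    (hn : ¬ (s ++ w.flatMap List.ofFn).Nodup) : iterComm a (w.map g) = 1 := by
  induction w generalizing a s with
  | nil => exact absurd hs (by simpa using hn)
  | cons J w ih =>
    by_cases hJ : Function.Injective J
    · by_cases hd : ∃ i ∈ s, i ∈ List.ofFn J
      · obtain ⟨i, his, hiJ⟩ := hd
        obtain ⟨j, rfl⟩ := (List.mem_ofFn' _ _).1 hiJ
        refine iterComm_eq_one (w.map g) (comm a (g J)) (Or.inl ?_)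
        have hc : a * g J = g J * a := hK _ a (ha _ his) (g J) (hg J j)
        unfold comm
        rw [mul_assoc, hc]
        group
      · push Not at hd
        refine ih (comm a (g J)) (s ++ List.ofFn J) ?_ (fun i hi => ?_) ?_
        · exact hs.append (List.nodup_ofFn.2 hJ) fun i h1 h2 => hd i h1 h2
        · rcases List.mem_append.1 hi with h | h
          · exact comm_mem_left (ha i h) _
          · obtain ⟨j, rfl⟩ := (List.mem_ofFn' _ _).1 h
            exact comm_mem_right _ (hg J j)
        · simpa using hn
    · exact iterComm_eq_one _ _ (Or.inr (by simp [hinj J hJ]))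

/-- Each commutator is bilinear on powers because both of its entries lie in abelian normal
subgroups; `1 ≤ k` ensures that every generator lies in some `K i`. -/
theorem iterComm_zpow (hK : ∀ i, ∀ x ∈ K i, ∀ y ∈ K i, Commute x y) (hg : ∀ I j, g I ∈ K (I j))
    (hk : 1 ≤ k) (w : List ((Fin k → ι) × ℤ)) (a : H) (i : ι) (ha : a ∈ K i) (m : ℤ) :
    iterComm (a ^ m) (w.map fun p => g p.1 ^ p.2) =
      iterComm a (w.map fun p => g p.1) ^ (m * (w.map Prod.snd).prod) := by
  induction w generalizing a m with
  | nil => simp [iterComm]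
  | cons p w ih =>
    have e : comm (a ^ m) (g p.1 ^ p.2) = comm a (g p.1) ^ (m * p.2) := by
      rw [comm_zpow_left (hK i) ha, comm_zpow_right (hK _) a (hg p.1 ⟨0, hk⟩), ← zpow_mul,
        mul_comm]
    have := ih (comm a (g p.1)) (comm_mem_left ha _) (m * p.2)
    rw [← e] at this
    rw [List.map_cons, List.map_cons, List.map_cons, List.prod_cons, ← mul_assoc]
    exact this

end Algebra

/-! ### Realizing the combinatorial group -/

section Geometric

variable {ι κ : Type} {k : ℕ} {X : Type u} [TopologicalSpace X] [BasePoint X]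

theorem pullback_geoGen {f : ι → Option κ} {I : Fin k → ι} {I' : Fin k → κ}
    (h : ∀ j, f (I j) = some (I' j)) : pullback (insertPt X f) (geoGen X I) = geoGen X I' := by
  refine congrArg PClass.mk (PMap.ext fun x => ?_)
  refine congrArg James.incl (congrArg Smash.mk (funext fun j => ?_))
  change (f (I j)).elim pt x.out = x.out (I' j)
  rw [h j]
  rfl

theorem pullback_geoGen_eq_one {f : ι → Option κ} {I : Fin k → ι} (h : ∃ j, f (I j) = none) :
    pullback (insertPt X f) (geoGen X I) = 1 := by
  obtain ⟨j, hj⟩ := h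
  refine congrArg PClass.mk (PMap.ext fun x => ?_)
  have : Smash.mk (KIfy.of fun j => ((insertPt X f).1 x).out (I j)) = (pt : Smash k X) := by
    refine Smash.mk_eq_pt ⟨j, ?_⟩
    change (f (I j)).elim pt x.out = pt
    rw [hj]
    rfl
  exact (congrArg James.incl this).trans James.incl_pt

variable [CompactlyGeneratedSpace X]

/-- The universal generator on `X ^ k` dies when any coordinate is killed, and pulling it back along
`I` identifies two coordinates. -/
theorem geoGen_eq_one (D : NDR X) (R : RightInv (Smash k X)) (hcat : WeakCatLtTwo X)
    {I : Fin k → ι} (hI : ¬ Function.Injective I) : geoGen X I = 1 := by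
  simp only [Function.Injective, not_forall] at hI
  obtain ⟨a, b, hab, hne⟩ := hI
  have hkill : ∀ a : Fin k, pullback (insertPt X (kill {a})) (geoGen X (id : Fin k → Fin k)) = 1 :=
    fun a => pullback_geoGen_eq_one ⟨a, kill_of_mem rfl⟩
  have e : pullback (insertPt X fun m => some (I m)) (geoGen X (id : Fin k → Fin k)) =
    geoGen X I := pullback_geoGen fun j => rfl
  rw [← e]
  exact pullback_insertPt_eq_one D R hcat hne (hkill a) (hkill b) hab

/-- The subgroups `K i` are the kernels of killing coordinate `i`: normal as kernels, abelian by
`commute_of_kill_eq_one`. The rest is algebra. -/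
theorem lift_geoGen_eq_one (D : NDR X) (R : RightInv (Smash k X)) (hcat : WeakCatLtTwo X)
    (hk : 1 ≤ k) {r : FreeGroup (Fin k → ι)} (hr : CohenRel ι k r) :
    FreeGroup.lift (fun I : Fin k → ι => R.unit (geoGen X I)) r = 1 := by
  let g : (Fin k → ι) → HGroup (Power ι X) (Smash k X) := fun I => R.unit (geoGen X I)
  let K : ι → Subgroup (HGroup (Power ι X) (Smash k X)) := fun i =>
    (gpullback (X := Smash k X) (insertPt X (kill {i}))).ker
  have hK : ∀ i, ∀ x ∈ K i, ∀ y ∈ K i, Commute x y := fun i x hx y hy =>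
    commute_of_kill_eq_one D R hcat i hx hy
  have hg : ∀ I j, g I ∈ K (I j) := fun I j =>
    Units.ext (pullback_geoGen_eq_one ⟨j, kill_of_mem rfl⟩)
  have hinj : ∀ I, ¬ Function.Injective I → g I = 1 := fun I hI =>
    Units.ext (geoGen_eq_one D R hcat hI)
  have : ∀ i, (K i).Normal := fun i => MonoidHom.normal_ker _
  change FreeGroup.lift g r = 1
  induction hr with
  | gen I h => rw [FreeGroup.lift_apply_of, hinj I h]
  | comm I w h =>
    rw [map_iterComm, FreeGroup.lift_apply_of, List.map_map]
    have e : ⇑(FreeGroup.lift g) ∘ FreeGroup.of = g := funext fun _ => FreeGroup.lift_apply_of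
    rw [e]
    by_cases hI : Function.Injective I
    · refine iterComm_eq_one_of_not_nodup hK hg hinj w _ (List.ofFn I) (List.nodup_ofFn.2 hI)
        (fun i hi => ?_) (by simpa using h)
      obtain ⟨j, rfl⟩ := (List.mem_ofFn' _ _).1 hi
      exact hg I j
    · exact iterComm_eq_one _ _ (Or.inl (hinj I hI))
  | pow I m w =>
    rw [map_mul, map_inv, map_zpow, map_iterComm, map_iterComm, map_zpow, FreeGroup.lift_apply_of,
      mul_inv_eq_one]
    simp only [List.map_map, Function.comp_def, map_zpow, FreeGroup.lift_apply_of]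
    exact iterComm_zpow hK hg hk w _ _ (hg I ⟨0, hk⟩) m

/-- The homomorphism from the combinatorial group to the group of homotopy classes. -/
def realize (D : NDR X) (R : RightInv (Smash k X)) (hcat : WeakCatLtTwo X) (hk : 1 ≤ k)
    (ι : Type) : CohenGroup ι k →* HGroup (Power ι X) (Smash k X) :=
  PresentedGroup.toGroup (f := fun I : Fin k → ι => R.unit (geoGen X I)) fun _ hr =>
    lift_geoGen_eq_one D R hcat hk hr

variable (D : NDR X) (R : RightInv (Smash k X)) (hcat : WeakCatLtTwo X) (hk : 1 ≤ k)

theorem realize_cgen (I : Fin k → ι) : realize D R hcat hk ι (cgen I) = R.unit (geoGen X I) :=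
  PresentedGroup.toGroup.of _

/-- Coordinate insertions act on generators as renamings of indices do, so the conditions of `HComb`
become those of `HGeo`. -/
theorem realize_rename (f : ι → Option κ) (a : CohenGroup ι k) :
    realize D R hcat hk κ (rename f a) = gpullback (insertPt X f) (realize D R hcat hk ι a) := by
  classical
  have : (realize D R hcat hk κ).comp (rename f) =
      (gpullback (insertPt X f)).comp (realize D R hcat hk ι) := by
    refine PresentedGroup.ext fun I => ?_
    change realize D R hcat hk κ (rename f (cgen I)) =
      gpullback (insertPt X f) (realize D R hcat hk ι (cgen I))
    have e : rename f (cgen I) = (renameGen f I : CohenGroup κ k) := PresentedGroup.toGroup.of _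
    rw [e, realize_cgen, renameGen]
    split_ifs with h
    · rw [realize_cgen]
      exact Units.ext (pullback_geoGen fun j => by simp).symm
    · rw [map_one]
      push Not at h
      obtain ⟨j, hj⟩ := h
      exact Units.ext (pullback_geoGen_eq_one ⟨j, by simpa using hj⟩).symm
  exact DFunLike.congr_fun this a

theorem realize_mem_KGeo (a : CohenGroup ι k) : realize D R hcat hk ι a ∈ KGeo ι k X := by
  have h : Subgroup.closure (range (PresentedGroup.of (rels := {r | CohenRel ι k r}))) ≤
      (KGeo ι k X).comap (realize D R hcat hk ι) := by
    rw [Subgroup.closure_le]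
    rintro _ ⟨I, rfl⟩
    exact Subgroup.subset_closure ⟨I, congrArg Units.val (realize_cgen D R hcat hk I)⟩
  rw [PresentedGroup.closure_range_of] at h
  exact h (Subgroup.mem_top a)

end Geometric

/-! ### The quotient map to the James filtration -/

section ReduceWord

variable {Y : Type u} [BasePoint Y]

theorem reduceWord_succAbove {n : ℕ} (x : Fin (n + 1) → Y) (s : Fin (n + 1)) (hs : x s = pt) :
    reduceWord x = reduceWord fun t => x (s.succAbove t) := by
  classical
  unfold reduceWord
  induction n with
  | zero =>
    obtain rfl : s = 0 := Fin.fin_one_eq_zero s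
    simp [hs]
  | succ n ih =>
    refine Fin.cases (fun hs => ?_) (fun s hs => ?_) s hs
    · simp [hs]
    · rw [List.ofFn_succ (f := x), List.ofFn_succ (f := fun t => x (s.succ.succAbove t)),
        List.filter_cons, List.filter_cons, ih (fun i => x i.succ) s hs]
      simp

theorem reduceWord_eq_ofFn {n : ℕ} {x : Fin n → Y} (hx : ∀ s, x s ≠ pt) :
    reduceWord x = List.ofFn x := by
  classical
  unfold reduceWord
  rw [List.filter_eq_self]
  intro a ha
  obtain ⟨s, rfl⟩ := (List.mem_ofFn' _ _).1 ha
  simpa using hx s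

theorem exists_eq_pt_of_length_lt {n : ℕ} {x : Fin n → Y} (h : (reduceWord x).length < n) :
    ∃ s, x s = pt := by
  by_contra! hc
  rw [reduceWord_eq_ofFn hc] at h
  simp at h

theorem length_reduceWord_lt {n : ℕ} {x : Fin n → Y} (h : ∃ s, x s = pt) :
    (reduceWord x).length < n := by
  obtain ⟨s, hs⟩ := h
  cases n with
  | zero => exact s.elim0
  | succ n =>
    rw [reduceWord_succAbove x s hs]
    exact Nat.lt_succ_of_le ((List.length_filter_le _ _).trans (by simp))

end ReduceWord

section Filtration

variable {n l : ℕ} {X : Type u} [TopologicalSpace X] [BasePoint X]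

/-- The inclusion of a stage of the James filtration into the James construction. -/
def jamesIncl (n : ℕ) (Y : Type u) [TopologicalSpace Y] [BasePoint Y] :
    PMap (JamesFil n Y) (James Y) :=
  ⟨⟨fun a => ⟨a.1, a.2.1⟩, JamesFil.isQuotientMap_word.continuous_iff.2
    (James.continuous_word.comp (continuous_sigmaMk (σ := fun n => Power (Fin n) Y) (i := n)))⟩,
    rfl⟩

/-- The inclusion of a stage of the James filtration into the next one. -/
def jamesSucc (n : ℕ) (Y : Type u) [TopologicalSpace Y] [BasePoint Y] :
    PMap (JamesFil n Y) (JamesFil (n + 1) Y) :=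
  ⟨⟨fun a => ⟨a.1, a.2.1, a.2.2.trans n.le_succ⟩, by
    refine JamesFil.isQuotientMap_word.continuous_iff.2 ?_
    have e (x : Power (Fin n) Y) :
        reduceWord (Fin.cons pt x.out : Fin (n + 1) → Y) = reduceWord x.out :=
      reduceWord_succAbove (Fin.cons pt x.out : Fin (n + 1) → Y) 0 rfl
    refine Continuous.congr (f := fun x : Power (Fin n) Y =>
      JamesFil.word (KIfy.of (Fin.cons pt x.out : Fin (n + 1) → Y))) ?_ fun x => Subtype.ext (e x)
    refine JamesFil.continuous_word.comp (Power.continuous_mk fun i => ?_)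
    refine Fin.cases ?_ (fun i => ?_) i
    · simpa using continuous_const
    · simpa using Power.continuous_apply i⟩, rfl⟩

/-- The projection of `X^{l(n+1)}` that forgets a block. -/
def forgetBlock (s : Fin (n + 1)) (p : Fin n × Fin l) : Option (Fin (n + 1) × Fin l) :=
  some (s.succAbove p.1, p.2)

theorem dropBlock_self (s : Fin (n + 1)) (j : Fin l) : dropBlock s (s, j) = none := by
  simp [dropBlock]

theorem dropBlock_succAbove (s : Fin (n + 1)) (t : Fin n) (j : Fin l) :
    dropBlock s (s.succAbove t, j) = some (t, j) := by
  unfold dropBlock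
  rcases lt_or_ge t.castSucc s with h | h
  · rw [Fin.succAbove_of_castSucc_lt _ _ h, dif_pos h]
    rfl
  · rw [Fin.succAbove_of_le_castSucc _ _ h]
    have h1 : s < t.succ := Fin.lt_def.2 (Nat.lt_succ_of_le (Fin.le_def.1 h))
    rw [dif_neg (not_lt.2 h1.le), dif_neg (ne_of_gt h1)]
    rfl

/-- Killing a block factors through dropping it, so a class with trivial image under `dropBlock s`
also dies when the block `s` is killed. -/
theorem kill_block_eq (s : Fin (n + 1)) :
    (kill (block s) : Fin (n + 1) × Fin l → Option (Fin (n + 1) × Fin l)) =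
      fun i => (dropBlock s i).bind (forgetBlock s) := by
  funext ⟨t, j⟩
  rcases Fin.eq_self_or_eq_succAbove s t with rfl | ⟨t, rfl⟩
  · rw [dropBlock_self]
    exact kill_of_mem rfl
  · rw [dropBlock_succAbove]
    exact if_neg (Fin.succAbove_ne s t)

theorem quotMap_val (x : Power (Fin n × Fin l) X) :
    ((quotMap n l X).1 x).1 = reduceWord (blockMap (Fin n) l X x).out := rfl

theorem quotMap_forgetBlock {x : Power (Fin (n + 1) × Fin l) X} {p : Fin (n + 1) × Fin l}
    (hp : x.out p = pt) :
    ((quotMap n l X).1 ((insertPt X (forgetBlock p.1)).1 x)).1 =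
      ((quotMap (n + 1) l X).1 x).1 := by
  rw [quotMap_val, quotMap_val, reduceWord_succAbove _ p.1 (Smash.mk_eq_pt ⟨p.2, hp⟩)]
  rfl

theorem quotMap_dropBlock (s : Fin (n + 1)) (y : Power (Fin n × Fin l) X) (hl : 1 ≤ l) :
    ((quotMap (n + 1) l X).1 ((insertPt X (dropBlock s)).1 y)).1 = ((quotMap n l X).1 y).1 := by
  have h1 : ((insertPt X (dropBlock s)).1 y).out (s, ⟨0, hl⟩) = pt := by
    change (dropBlock s (s, _)).elim pt y.out = pt
    rw [dropBlock_self]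
    rfl
  rw [← quotMap_forgetBlock h1]
  congr 2
  funext ⟨t, j⟩
  change (dropBlock s (s.succAbove t, j)).elim pt y.out = y (t, j)
  rw [dropBlock_succAbove]
  rfl

/-- One base-point coordinate already makes the smash product of its block trivial. Classes pulled
back along `q` therefore satisfy the first condition of `HGeo`. -/
theorem quotMap_kill (p : Fin n × Fin l) (x : Power (Fin n × Fin l) X) :
    (quotMap n l X).1 ((insertPt X (kill {p})).1 x) =
      (quotMap n l X).1 ((insertPt X (kill (block p.1))).1 x) := by
  classical
  refine congrArg JamesFil.word (funext fun s => ?_)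
  by_cases hs : s = p.1
  · subst hs
    refine (Smash.mk_eq_pt ⟨p.2, ?_⟩).trans (Smash.mk_eq_pt ⟨p.2, ?_⟩).symm
    · exact (insertPt_kill_apply {p} x p).trans (if_pos rfl)
    · exact (insertPt_kill_apply (block p.1) x p).trans (if_pos rfl)
  · refine congrArg Smash.mk (funext fun j => ?_)
    refine (insertPt_kill_apply {p} x (s, j)).trans
      (Eq.trans ?_ (insertPt_kill_apply (block p.1) x (s, j)).symm)
    exact (if_neg fun h : (s, j) ∈ ({p} : Set _) =>
      hs (congrArg Prod.fst (mem_singleton_iff.1 h))).trans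
        (if_neg fun h : (s, j) ∈ block p.1 => hs h).symm

theorem blockMap_eq_iff {ι : Type} {x x' : Power (ι × Fin l) X}
    (h : blockMap ι l X x = blockMap ι l X x') :
    x = x' ∨ (∃ p, x.out p = pt) ∧ ∃ p, x'.out p = pt := by
  by_cases hx : ∀ s, (KIfy.of fun j => x.out (s, j) : Power (Fin l) X) =
      KIfy.of fun j => x'.out (s, j)
  · exact Or.inl (funext fun p => congrFun (hx p.1) p.2)
  · push Not at hx
    obtain ⟨s, hs⟩ := hx
    rcases Smash.mk_eq_mk_iff.1 (congrFun h s) with h | ⟨⟨j, hj⟩, ⟨j', hj'⟩⟩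
    · exact absurd h hs
    · exact Or.inr ⟨⟨(s, j), hj⟩, ⟨(s, j'), hj'⟩⟩

/-- A word of full length determines its letters, and a shorter word can only come from the fat
wedge. Hence a map constant on the fat wedge descends along `q`. -/
theorem quotMap_eq_iff (hl : 1 ≤ l) {x x' : Power (Fin n × Fin l) X}
    (h : (quotMap n l X).1 x = (quotMap n l X).1 x') :
    x = x' ∨ (∃ p, x.out p = pt) ∧ ∃ p, x'.out p = pt := by
  have hw : reduceWord (blockMap (Fin n) l X x).out = reduceWord (blockMap (Fin n) l X x').out :=
    congrArg Subtype.val h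
  have key : ∀ x : Power (Fin n × Fin l) X, (∃ s, (blockMap (Fin n) l X x).out s = pt) →
      ∃ p, x.out p = pt := by
    rintro x ⟨s, hs⟩
    obtain ⟨j, hj⟩ := (Smash.mk_eq_pt_iff hl).1 hs
    exact ⟨(s, j), hj⟩
  by_cases hx : ∃ s, (blockMap (Fin n) l X x).out s = pt
  · have hlt := length_reduceWord_lt hx
    rw [hw] at hlt
    exact Or.inr ⟨key x hx, key x' (exists_eq_pt_of_length_lt hlt)⟩
  · by_cases hx' : ∃ s, (blockMap (Fin n) l X x').out s = pt
    · have hlt := length_reduceWord_lt hx'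
      rw [← hw] at hlt
      exact absurd (exists_eq_pt_of_length_lt hlt) hx
    · push Not at hx hx'
      rw [reduceWord_eq_ofFn hx, reduceWord_eq_ofFn hx'] at hw
      exact blockMap_eq_iff (List.ofFn_injective hw)

variable (D : NDR X)

open Classical in
/-- The action of `D.push` on words. -/
def pushWord (t : unitInterval) (w : List (Smash l X)) : List (Smash l X) :=
  (w.map (Smash.lift (fun x => Smash.mk (D.push univ t x)) pt fun _ hx =>
    Smash.mk_eq_pt (hx.imp fun _ hi => D.push_apply_eq_pt _ _ hi))).filter fun a => a ≠ pt

/-- The deformation preserves base-point letters, so its effect after `q` depends only on the word;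
this lets it descend to `J_n`. -/
theorem quotMap_push (t : unitInterval) (x : Power (Fin n × Fin l) X) :
    ((quotMap n l X).1 (D.push univ t x)).1 = pushWord D t ((quotMap n l X).1 x).1 := by
  classical
  rw [quotMap_val, quotMap_val]
  unfold reduceWord pushWord
  set P : Smash l X → Smash l X := Smash.lift (fun x => Smash.mk (D.push univ t x)) pt fun _ hx =>
    Smash.mk_eq_pt (hx.imp fun _ hi => D.push_apply_eq_pt _ _ hi) with hP
  have hPpt : 1 ≤ l → P pt = pt := fun hl => Smash.mk_eq_pt ⟨⟨0, hl⟩, D.push_apply_eq_pt _ _ rfl⟩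
  have e : List.ofFn (blockMap (Fin n) l X (D.push univ t x)).out =
      (List.ofFn (blockMap (Fin n) l X x).out).map P := by
    rw [List.map_ofFn]
    refine congrArg List.ofFn (funext fun s => ?_)
    refine congrArg Smash.mk (funext fun j => ?_)
    exact ((D.push_apply univ t x (s, j)).trans (if_pos trivial)).trans
      ((D.push_apply univ t (KIfy.of fun j => x.out (s, j)) j).trans (if_pos trivial)).symm
  rw [e]
  generalize List.ofFn (blockMap (Fin n) l X x).out = w
  induction w with
  | nil => rfl
  | cons z w ih =>
    by_cases hz : z = pt
    · rcases Nat.eq_zero_or_pos l with hl | hl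
      · subst hl
        have hs : ∀ a : Smash 0 X, a = pt := by
          rintro ⟨a⟩
          exact congrArg Smash.mk (funext fun i => i.elim0)
        exact (List.filter_eq_nil_iff.2 fun a _ => by simpa using hs a).trans
          (List.filter_eq_nil_iff.2 fun a _ => by simpa using hs a).symm
      · rw [List.map_cons, List.filter_cons_of_neg (by simp [hz, hPpt hl]),
          List.filter_cons_of_neg (by simp [hz]), ih]
    · rw [List.map_cons, List.filter_cons, List.filter_cons_of_pos (by simpa using hz),
        List.map_cons, List.filter_cons, ih]

/-- A function on `X^{ln}` that is compatible with the quotient map descends to `J_n(X^{(l)})`,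
continuously in families over the interval. -/
theorem exists_descend {B : Type u} [TopologicalSpace B]
    {H : unitInterval × Power (Fin n × Fin l) X → B} (hH : Continuous H)
    (h : ∀ t x x', (quotMap n l X).1 x = (quotMap n l X).1 x' → H (t, x) = H (t, x')) :
    ∃ G : unitInterval × JamesFil n (Smash l X) → B, Continuous G ∧
      ∀ t x, G (t, (quotMap n l X).1 x) = H (t, x) := by
  have hq := isQuotientMap_quotMap l X n
  refine ⟨fun p => H (p.1, Function.surjInv hq.surjective p.2), ?_, fun t x =>
    h t _ _ (Function.surjInv_eq hq.surjective _)⟩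
  refine hq.continuous_lift_prod_right ?_
  refine hH.congr fun p => ?_
  exact h p.1 _ _ (Function.surjInv_eq hq.surjective _).symm

end Filtration

/-! ### Injectivity of the map induced by the quotient map -/

section Injectivity

variable {X Z : Type u} [TopologicalSpace X] [BasePoint X] [TopologicalSpace Z] [BasePoint Z]

/-- A map that is trivial on the fat wedge and null homotopic is null homotopic relative to any
union of coordinate subspaces. -/
theorem homotopicRel_of_homotopic (D : NDR X) (R : RightInv Z) {ι : Type}
    {f : C(Power ι X, James Z)} (hf : ∀ i (x : Power ι X), x.out i = pt → f x = 1)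
    (hn : f.Homotopic (ContinuousMap.const _ 1)) (S : Finset ι) :
    f.HomotopicRel (ContinuousMap.const _ 1) {x | ∃ i ∈ S, x.out i = pt} := by
  classical
  induction S using Finset.induction_on with
  | empty =>
    obtain ⟨H⟩ := hn
    exact ⟨⟨H, by rintro t x ⟨i, hi, -⟩; simp at hi⟩⟩
  | insert i S hi ih =>
    obtain ⟨H⟩ := ih
    let f' : C(Power ι X, James Z) :=
      ⟨fun x => f (D.push {i} 1 x), f.continuous.comp
        (D.continuous_push _ continuous_const continuous_id)⟩
    -- First push coordinate `i`, then strictify each stage of `H` in that coordinate. The second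
    -- homotopy starts at `f'` because `f` is already strict at `i`, and triviality along `S`
    -- survives.
    refine ContinuousMap.HomotopicRel.trans (g := f') ⟨⟨⟨⟨fun p => f (D.push {i} p.1 p.2),
      f.continuous.comp (D.continuous_push _ continuous_fst continuous_snd)⟩, fun x => ?_,
      fun x => rfl⟩, ?_⟩⟩ ⟨⟨⟨⟨fun p => strictify D R 1 i (fun x => H (p.1, x)) p.2,
      continuous_strictify continuous_const (fun z hz => H.continuous.comp
        (continuous_fst.prodMk hz)) continuous_snd⟩, fun x => ?_, fun x => ?_⟩, ?_⟩⟩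
    · change f (D.push {i} 0 x) = f x
      rw [D.push_zero]
    · rintro t x ⟨j, -, hj⟩
      exact (hf j _ (D.push_apply_eq_pt _ _ hj)).trans (hf j x hj).symm
    · change strictify D R 1 i (fun x => H (0, x)) x = f (D.push {i} 1 x)
      simp only [H.apply_zero]
      exact strictify_of_strict (hf i) x
    · change strictify D R 1 i (fun x => H (1, x)) x = 1
      exact strictify_eq_one (H.apply_one _) (H.apply_one _)
    · rintro t x ⟨j, hjS, hj⟩
      change strictify D R 1 i (fun x => H (t, x)) x = _
      refine Eq.trans ?_ (hf j _ (D.push_apply_eq_pt _ _ hj)).symm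
      rcases Finset.mem_insert.1 hjS with rfl | hjS
      · exact strictify_one_of_eq_pt _ hj
      · refine strictify_eq_one_of_eq_pt (j := j) (fun y hy => ?_) hj
        exact (H.eq_fst t ⟨j, hjS, hy⟩).trans (hf j y hy)

/-- The word of a point of the fat wedge, as an element of the previous stage. -/
def truncate (n : ℕ) {Y : Type u} [BasePoint Y] (w : JamesFil (n + 1) Y) : JamesFil n Y :=
  if h : w.1.length ≤ n then ⟨w.1, w.2.1, h⟩ else pt

theorem truncate_eq {n : ℕ} {Y : Type u} [BasePoint Y] {w : JamesFil (n + 1) Y}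
    {w' : JamesFil n Y} (h : w'.1 = w.1) : truncate n w = w' := by
  have : w.1.length ≤ n := h ▸ w'.2.2
  exact (dif_pos this).trans (Subtype.ext h.symm)

/-- A class on `J_{n+1}(X^{(l)})` whose restriction to `J_n(X^{(l)})` is trivial is represented by a
map that is trivial on the image of the fat wedge. -/
theorem exists_rep_trivial_on_jamesSucc (D : NDR X) {n l : ℕ} (hl : 1 ≤ l)
    {f : PMap (JamesFil (n + 1) (Smash l X)) (James Z)}
    (hf : PClass.mk (f.comp (jamesSucc n (Smash l X))) = 1) :
    ∃ g : PMap (JamesFil (n + 1) (Smash l X)) (James Z), PClass.mk g = PClass.mk f ∧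
      ∀ p (x : Power (Fin (n + 1) × Fin l) X), x.out p = pt →
        g.1 ((quotMap (n + 1) l X).1 x) = 1 := by
  obtain ⟨F⟩ := PClass.mk_eq_mk_iff.1 (hf.trans PClass.one_def)
  let q := (quotMap (n + 1) l X).1
  let u : Power (Fin (n + 1) × Fin l) X → ℝ := wt D.v
  have hu : Continuous u := continuous_wt D.v
  let P : Power (Fin (n + 1) × Fin l) X → Power (Fin (n + 1) × Fin l) X := D.push univ 1
  have hP : Continuous P := D.continuous_push _ continuous_const continuous_id
  -- Where `u < 1` the deformation sends some coordinate to the base point, so the word of `P x` has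
  -- length at most `n`. Elsewhere `truncate` may return its default, and no continuity is claimed
  -- there.
  let r : Power (Fin (n + 1) × Fin l) X → JamesFil n (Smash l X) := fun x => truncate n (q (P x))
  have hr : ∀ p x, D.v (x.out p) < 1 →
      r x = (quotMap n l X).1 ((insertPt X (forgetBlock p.1)).1 (P x)) := fun p x hx =>
    truncate_eq (quotMap_forgetBlock (D.push_one_apply_eq_pt (mem_univ p) hx))
  have hsucc : ∀ x, u x < 1 → (jamesSucc n (Smash l X)).1 (r x) = q (P x) := by
    intro x hx
    obtain ⟨p, hp⟩ := exists_lt_one_of_wt hx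
    rw [hr p x hp]
    exact Subtype.ext (quotMap_forgetBlock (D.push_one_apply_eq_pt (mem_univ p) hp))
  have hrc : Continuous fun x : {x | u x < 1} => r x := by
    refine continuous_of_local fun x => ?_
    obtain ⟨p, hp⟩ := exists_lt_one_of_wt x.2
    have hv : Continuous fun x : {x | u x < 1} => D.v (x.1.out p) :=
      D.v.continuous.comp ((Power.continuous_apply p).comp continuous_subtype_val)
    -- Locally one block `p.1` has become trivial, and `r` is the continuous map that forgets it.
    refine ⟨{x | D.v (x.1.out p) < 1}, isOpen_lt hv continuous_const, hp, ?_⟩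
    refine Continuous.congr (f := fun x : {x : {x | u x < 1} | D.v (x.1.out p) < 1} =>
      (quotMap n l X).1 ((insertPt X (forgetBlock p.1)).1 (P x.1.1))) ?_
      fun x => (hr p _ x.2).symm
    exact (quotMap n l X).1.continuous.comp ((insertPt X (forgetBlock p.1)).1.continuous.comp
      (hP.comp (continuous_subtype_val.comp continuous_subtype_val)))
  -- The null homotopy on `J_n` is run for time `p.1 * (1 - 2 * u)`: all the way on the fat wedge,
  -- not at all at `u = 1 / 2`.
  let K : unitInterval × Power (Fin (n + 1) × Fin l) X → James Z := fun p =>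
    if u p.2 ≤ 1 / 2 then F (projIcc 0 1 zero_le_one (p.1 * (1 - 2 * u p.2)), r p.2)
    else f.1 (q (P p.2))
  have hF0 : ∀ x, u x < 1 → F (0, r x) = f.1 (q (P x)) := fun x hx => by
    rw [F.apply_zero]
    exact congrArg f.1 (hsucc x hx)
  have hK : Continuous K := by
    refine continuous_of_local fun p => ?_
    rcases lt_or_ge (u p.2) 1 with h | h
    · refine ⟨{p | u p.2 < 1}, isOpen_lt (by fun_prop) continuous_const, h, ?_⟩
      have hu' : Continuous
          fun p : {p : unitInterval × Power (Fin (n + 1) × Fin l) X | u p.2 < 1} => u p.1.2 := by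
        fun_prop
      have h1 : Continuous fun p : {p : unitInterval × Power (Fin (n + 1) × Fin l) X | u p.2 < 1} =>
          r p.1.2 :=
        hrc.comp (f := fun p : {p : unitInterval × Power (Fin (n + 1) × Fin l) X | u p.2 < 1} =>
          (⟨p.1.2, p.2⟩ : {x | u x < 1})) (by fun_prop)
      refine Continuous.if_le (F.continuous.comp (Continuous.prodMk
        (continuous_projIcc.comp (by fun_prop)) h1))
        (f.1.continuous.comp (q.continuous.comp (hP.comp (by fun_prop)))) hu' continuous_const
        fun p hp => ?_
      have e : projIcc (0 : ℝ) 1 zero_le_one (p.1.1 * (1 - 2 * u p.1.2)) = 0 :=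
        projIcc_of_le_left _ (by rw [hp]; simp)
      change F (projIcc (0 : ℝ) 1 zero_le_one (p.1.1 * (1 - 2 * u p.1.2)), r p.1.2) = _
      rw [e]
      exact hF0 _ p.2
    · refine ⟨{p | 1 / 2 < u p.2}, isOpen_lt continuous_const (by fun_prop),
        lt_of_lt_of_le (by norm_num) h, ?_⟩
      refine Continuous.congr (f := fun p : {p : unitInterval × Power (Fin (n + 1) × Fin l) X |
        1 / 2 < u p.2} => f.1 (q (P p.1.2))) (f.1.continuous.comp (q.continuous.comp
          (hP.comp (by fun_prop)))) fun p => (if_neg (not_le.2 p.2)).symm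
  have hq : ∀ x x', q x = q x' → u x = u x' ∧ ∀ t, q (D.push univ t x) = q (D.push univ t x') := by
    refine fun x x' hxx => ⟨?_, fun t => Subtype.ext ?_⟩
    · rcases quotMap_eq_iff hl hxx with rfl | ⟨h, h'⟩
      · rfl
      · exact ((wt_eq_zero_iff D.v_eq_zero).2 h).trans ((wt_eq_zero_iff D.v_eq_zero).2 h').symm
    · rw [quotMap_push, quotMap_push]
      exact congrArg (pushWord D t) (congrArg Subtype.val hxx)
  obtain ⟨G, hG, hGK⟩ := exists_descend hK fun t x x' hxx => by
    obtain ⟨h1, h2⟩ := hq x x' hxx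
    have h3 : q (P x) = q (P x') := h2 1
    simp only [K, r, h1, h3]
  obtain ⟨G', hG', hGf⟩ := exists_descend (n := n + 1) (l := l)
    (H := fun p => f.1 (q (D.push univ p.1 p.2)))
    (f.1.continuous.comp (q.continuous.comp (D.continuous_push _ continuous_fst continuous_snd)))
    fun t x x' hxx => congrArg f.1 ((hq x x' hxx).2 t)
  have hsurj := (isQuotientMap_quotMap l X (n + 1)).surjective
  have hqpt : (quotMap (n + 1) l X).1 pt = pt := (quotMap (n + 1) l X).2
  have hupt : u pt = 0 := (wt_eq_zero_iff D.v_eq_zero).2 ⟨(0, ⟨0, hl⟩), rfl⟩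
  have hrpt : r pt = pt := by
    have : P pt = pt := D.push_pt _ _
    change truncate n (q (P pt)) = pt
    rw [this]
    exact truncate_eq (congrArg Subtype.val hqpt).symm
  have hGpt : ∀ t, G (t, pt) = 1 := by
    intro t
    rw [← hqpt, hGK]
    change (if u pt ≤ 1 / 2 then _ else _) = _
    rw [hupt, if_pos (by norm_num), hrpt]
    exact (F.eq_fst _ rfl).trans (f.comp (jamesSucc n (Smash l X))).2
  have hG'pt : ∀ t, G' (t, pt) = 1 := by
    intro t
    rw [← hqpt, hGf, D.push_pt]
    exact (congrArg f.1 hqpt).trans f.2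
  refine ⟨⟨⟨fun z => G (1, z), by fun_prop⟩, hGpt 1⟩, ?_, fun p x hx => ?_⟩
  · refine Eq.trans (b := PClass.mk ⟨⟨fun z => G (0, z), by fun_prop⟩, hGpt 0⟩)
      (PClass.mk_eq_of_homotopy (H := G) hG (fun _ => rfl) (fun _ => rfl) hGpt).symm
      (PClass.mk_eq_of_homotopy (H := G') hG' (fun z => ?_) (fun z => ?_) hG'pt).symm
    · obtain ⟨x, rfl⟩ := hsurj z
      rw [hGf, D.push_zero]
    · obtain ⟨x, rfl⟩ := hsurj z
      rw [hGf]
      refine Eq.trans ?_ (hGK 0 x).symm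
      change f.1 (q (P x)) = if u x ≤ 1 / 2 then _ else _
      split_ifs with h
      · rw [Icc.coe_zero, zero_mul, projIcc_of_le_left _ le_rfl]
        exact (hF0 x (by linarith)).symm
      · rfl
  · refine (hGK 1 x).trans ?_
    have hux : u x = 0 := (wt_eq_zero_iff D.v_eq_zero).2 ⟨p, hx⟩
    change (if u x ≤ 1 / 2 then _ else _) = _
    rw [hux, if_pos (by norm_num), mul_zero, sub_zero, mul_one, Icc.coe_one,
      projIcc_of_right_le _ le_rfl]
    exact F.apply_one _

/-- The quotient map `X^{ln} → J_n(X^{(l)})` has trivial kernel on classes of maps to `J(Z)`. -/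
theorem eq_one_of_pullback_quotMap (D : NDR X) (R : RightInv Z) {l : ℕ} (hl : 1 ≤ l) (n : ℕ)
    (a : PClass (JamesFil n (Smash l X)) (James Z)) (ha : pullback (quotMap n l X) a = 1) :
    a = 1 := by
  induction n with
  | zero =>
    obtain ⟨f, rfl⟩ := a.exists_mk
    refine congrArg PClass.mk (PMap.ext fun z => ?_)
    have : z = pt := Subtype.ext (List.length_eq_zero_iff.1 (Nat.le_zero.1 z.2.2))
    rw [this]
    exact f.2
  | succ n ih =>
    obtain ⟨f, rfl⟩ := a.exists_mk
    -- Inserting a trivial block and then taking the word gives the shorter word, so the restriction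
    -- to `J_n` also dies upstairs and induction applies.
    have e : (quotMap (n + 1) l X).comp (insertPt X (dropBlock 0)) =
        (jamesSucc n (Smash l X)).comp (quotMap n l X) :=
      PMap.ext fun y => Subtype.ext (quotMap_dropBlock 0 y hl)
    have h1 : pullback (quotMap n l X) (PClass.mk (f.comp (jamesSucc n (Smash l X)))) = 1 := by
      rw [← pullback_mk, pullback_pullback, ← e, ← pullback_pullback, ha, map_one]
    obtain ⟨g, hgf, hg⟩ := exists_rep_trivial_on_jamesSucc D hl (ih _ h1)
    rw [← hgf] at ha ⊢
    have h2 := (PClass.mk_eq_mk_iff.1 (ha.trans PClass.one_def)).homotopic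
    obtain ⟨H⟩ := homotopicRel_of_homotopic D R hg h2 Finset.univ
    have hH : ∀ t (x : Power (Fin (n + 1) × Fin l) X), (∃ p, x.out p = pt) → H (t, x) = 1 := by
      rintro t x ⟨p, hp⟩
      exact (H.eq_fst t ⟨p, Finset.mem_univ p, hp⟩).trans (hg p x hp)
    obtain ⟨G, hG, hGH⟩ := exists_descend H.continuous fun t x x' hxx => by
      rcases quotMap_eq_iff hl hxx with rfl | ⟨h, h'⟩
      · rfl
      · exact (hH t x h).trans (hH t x' h').symm
    have hsurj := (isQuotientMap_quotMap l X (n + 1)).surjective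
    refine PClass.mk_eq_of_homotopy hG (fun z => ?_) (fun z => ?_) fun t => ?_
    · obtain ⟨x, rfl⟩ := hsurj z
      exact (hGH 0 x).trans (H.apply_zero x)
    · obtain ⟨x, rfl⟩ := hsurj z
      exact (hGH 1 x).trans (H.apply_one x)
    · have hqpt : (quotMap (n + 1) l X).1 pt = pt := (quotMap (n + 1) l X).2
      rw [← hqpt, hGH]
      exact hH t _ ⟨(0, ⟨0, hl⟩), rfl⟩

theorem gpullback_quotMap_injective (D : NDR X) (R : RightInv Z) {l : ℕ} (hl : 1 ≤ l) (n : ℕ) :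
    Function.Injective (gpullback (X := Z) (quotMap n l X)) :=
  (injective_iff_map_eq_one _).2 fun a ha =>
    Units.ext (eq_one_of_pullback_quotMap D R hl n a.1 (congrArg Units.val ha))

end Injectivity

/-! ### Extension of maps along the James filtration -/

section SublistProd

variable {Y M : Type*} [Monoid M] (y₀ : Y)

-- Subwords containing `y₀` contribute the factor `1`, so inserting or deleting `y₀` does not change
-- the ordered product; with `y₀` the base point it is well defined on `J(Y)`.
open Classical in
theorem prod_sublistsLen_filter (L : List Y) (m : ℕ) (g : List Y → M)
    (hg : ∀ w, y₀ ∈ w → g w = 1) :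
    (((L.filter fun a => a ≠ y₀).sublistsLen m).map g).prod = ((L.sublistsLen m).map g).prod := by
  induction L generalizing m g with
  | nil => rfl
  | cons a L ih =>
    cases m with
    | zero => simp
    | succ m =>
      have h1 := ih m (g ∘ List.cons a) fun w hw => hg _ (List.mem_cons_of_mem _ hw)
      by_cases ha : a = y₀
      · have h2 : ((L.sublistsLen m).map (g ∘ List.cons a)).prod = 1 :=
          List.prod_eq_one fun x hx => by
            obtain ⟨w, -, rfl⟩ := List.mem_map.1 hx
            exact hg _ (by simp [ha])
        rw [List.filter_cons_of_neg (by simpa using ha), ih _ g hg, List.sublistsLen_succ_cons,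
          List.map_append, List.prod_append, List.map_map, h2, mul_one]
      · rw [List.filter_cons_of_pos (by simpa using ha), List.sublistsLen_succ_cons,
          List.sublistsLen_succ_cons, List.map_append, List.prod_append, List.map_append,
          List.prod_append, ih _ g hg, List.map_map, List.map_map, h1]

theorem sublistsLen_map {α β : Type*} (f : α → β) (m : ℕ) (L : List α) :
    (L.map f).sublistsLen m = (L.sublistsLen m).map (List.map f) := by
  induction L generalizing m with
  | nil => cases m <;> simp
  | cons a L ih =>
    cases m with
    | zero => simp
    | succ m => simp [List.sublistsLen_succ_cons, ih, Function.comp_def]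

end SublistProd

section Extension

variable {Y Z : Type u} [TopologicalSpace Y] [BasePoint Y] [CompactlyGeneratedSpace Y]
  [TopologicalSpace Z] [BasePoint Z]

theorem James.continuous_list_prod {β : Type*} {A : Type u} [TopologicalSpace A]
    [CompactlyGeneratedSpace A] (F : β → A → James Z) (hF : ∀ b, Continuous (F b)) (L : List β) :
    Continuous fun a => (L.map fun b => F b a).prod := by
  induction L with
  | nil => exact continuous_const
  | cons b L ih =>
    simp only [List.map_cons, List.prod_cons]
    exact James.continuous_mul (hF b) ih

/-- A map on `Y^m` that is trivial on the fat wedge extends over `J(Y)`: take the ordered product of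
its values on the subwords of length `m`. -/
theorem James.exists_extension {m : ℕ} (hm : m ≠ 0) (f : C(Power (Fin m) Y, James Z))
    (hf : ∀ (y : Power (Fin m) Y) i, y.out i = pt → f y = 1) :
    ∃ Γ : PMap (James Y) (James Z), ∀ y, Γ.1 (James.word ⟨m, y⟩) = f y := by
  classical
  let g : List Y → James Z := fun w =>
    if h : w.length = m then f (KIfy.of fun i => w.get (i.cast h.symm)) else 1
  have hg : ∀ w, pt ∈ w → g w = 1 := fun w hw => by
    by_cases h : w.length = m
    · obtain ⟨i, hi⟩ := List.get_of_mem hw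
      exact (dif_pos h).trans (hf _ (i.cast h) hi)
    · exact dif_neg h
  have hgf : ∀ y : Power (Fin m) Y, g (List.ofFn y.out) = f y := fun y => by
    refine (dif_pos (List.length_ofFn)).trans (congrArg f (funext fun i => ?_))
    change (List.ofFn y.out).get _ = y i
    rw [List.get_ofFn]
    rfl
  have hgc : ∀ (N : ℕ) (w : List (Fin N)),
      Continuous fun x : Power (Fin N) Y => g (w.map x.out) := fun N w => by
    by_cases h : w.length = m
    · refine Continuous.congr (f := fun x : Power (Fin N) Y =>
        f (KIfy.of fun i => x.out (w.get (i.cast h.symm)))) (f.continuous.comp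
          (Power.continuous_mk fun i => Power.continuous_apply _)) fun x => ?_
      refine ((dif_pos ((List.length_map _).trans h)).trans (congrArg f (funext fun i => ?_))).symm
      change (w.map x.out).get _ = x.out _
      simp
    · refine Continuous.congr (f := fun _ => (1 : James Z)) continuous_const
        fun x => ?_
      have h' : (w.map x.out).length ≠ m := by rwa [List.length_map]
      exact (show g (w.map x.out) = 1 from dif_neg h').symm
  let H : List Y → James Z := fun w => ((w.sublistsLen m).map g).prod
  have hH : ∀ {N : ℕ} (x : Fin N → Y), H (reduceWord x) = H (List.ofFn x) := fun x =>
    prod_sublistsLen_filter pt (List.ofFn x) m g hg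
  refine ⟨⟨⟨fun w => H w.1, James.isQuotientMap_word.continuous_iff.2
    (continuous_sigma fun N => ?_)⟩, ?_⟩, fun y => ?_⟩
  · refine Continuous.congr (James.continuous_list_prod (fun w (x : Power (Fin N) Y) =>
      g (w.map x.out)) (hgc N) ((List.finRange N).sublistsLen m)) fun x => ?_
    refine Eq.trans ?_ (hH x.out).symm
    change _ = (((List.ofFn x.out).sublistsLen m).map g).prod
    rw [List.ofFn_eq_map, sublistsLen_map, List.map_map]
    rfl
  -- The empty word has no subword of positive length, so the product is empty; for `m = 0` it would
  -- be the value of `f` at the empty tuple.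
  · obtain ⟨m, rfl⟩ := Nat.exists_eq_succ_of_ne_zero hm
    rfl
  · refine (hH y.out).trans ?_
    -- A word of length `m`, base points included, is its only subword of length `m`.
    have : (List.ofFn y.out).sublistsLen m = [List.ofFn y.out] := by
      have := List.sublistsLen_length (List.ofFn y.out)
      rwa [List.length_ofFn] at this
    change (((List.ofFn y.out).sublistsLen m).map g).prod = _
    rw [this, List.map_singleton, List.prod_singleton, hgf]

end Extension

/-! ### Classes that descend along the quotient map -/

section Surjectivity

variable {X Z : Type u} [TopologicalSpace X] [BasePoint X] [TopologicalSpace Z] [BasePoint Z]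

/-- The map `X^{ln} → J(X^{(l)})`. -/
def jamesQuot (n l : ℕ) (X : Type u) [TopologicalSpace X] [BasePoint X] :
    PMap (Power (Fin n × Fin l) X) (James (Smash l X)) :=
  (jamesIncl n (Smash l X)).comp (quotMap n l X)

theorem jamesQuot_comp_dropBlock {n l : ℕ} (hl : 1 ≤ l) (s : Fin (n + 1)) :
    (jamesQuot (n + 1) l X).comp (insertPt X (dropBlock s)) = jamesQuot n l X :=
  PMap.ext fun y => Subtype.ext (quotMap_dropBlock s y hl)

theorem jamesQuot_comp_kill {n l : ℕ} (p : Fin n × Fin l) :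
    (jamesQuot n l X).comp (insertPt X (kill {p})) =
      (jamesQuot n l X).comp (insertPt X (kill (block p.1))) :=
  PMap.ext fun y => congrArg (jamesIncl n (Smash l X)).1 (quotMap_kill p y)

/-- A simplicial identity; it passes the second condition from a class to its restriction along
`dropBlock 0`. -/
theorem dropBlock_zero_bind_dropBlock {n l : ℕ} (s : Fin (n + 1)) (i : Fin (n + 2) × Fin l) :
    (dropBlock 0 i).bind (dropBlock s) =
      (dropBlock s.succ i).bind (dropBlock (0 : Fin (n + 1))) := by
  obtain ⟨t, j⟩ := i
  have h0 : ∀ {n : ℕ} (t : Fin n) (j : Fin l), dropBlock 0 (t.succ, j) = some (t, j) := fun t j =>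
    dropBlock_succAbove 0 t j
  refine Fin.cases ?_ (fun t => ?_) t
  · have h1 : dropBlock s.succ ((0 : Fin (n + 2)), j) = some ((0 : Fin (n + 1)), j) := by
      have := dropBlock_succAbove s.succ 0 j
      rwa [Fin.succ_succAbove_zero] at this
    rw [dropBlock_self, h1]
    exact (dropBlock_self 0 j).symm
  · rw [h0]
    change dropBlock s (t, j) = _
    rcases Fin.eq_self_or_eq_succAbove s t with rfl | ⟨t, rfl⟩
    · rw [dropBlock_self, dropBlock_self]
      rfl
    · rw [dropBlock_succAbove, ← Fin.succ_succAbove_succ, dropBlock_succAbove]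
      exact (h0 t j).symm

/-- Passes the first condition from a class to its restriction along `dropBlock 0`, the indices
being shifted by one block. -/
theorem dropBlock_zero_bind_kill {n l : ℕ} {T : Set (Fin (n + 1) × Fin l)}
    {T' : Set (Fin n × Fin l)}
    (hT : ∀ p : Fin n × Fin l, (p.1.succ, p.2) ∈ T ↔ p ∈ T') (i : Fin (n + 1) × Fin l) :
    (dropBlock 0 i).bind (kill T') = (kill T i).bind (dropBlock 0) := by
  classical
  obtain ⟨t, j⟩ := i
  refine Fin.cases ?_ (fun t => ?_) t
  · rw [dropBlock_self]
    by_cases h : ((0 : Fin (n + 1)), j) ∈ T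
    · rw [kill_of_mem h]
      rfl
    · rw [show kill T ((0 : Fin (n + 1)), j) = some (0, j) from if_neg h]
      exact (dropBlock_self 0 j).symm
  · have h0 : dropBlock 0 (t.succ, j) = some (t, j) := dropBlock_succAbove 0 t j
    rw [h0]
    change kill T' (t, j) = _
    by_cases h : (t, j) ∈ T'
    · rw [kill_of_mem h, kill_of_mem ((hT (t, j)).2 h)]
      rfl
    · rw [show kill T' (t, j) = some (t, j) from if_neg h,
        show kill T (t.succ, j) = some (t.succ, j) from if_neg fun h' => h ((hT (t, j)).1 h')]
      exact h0.symm

theorem gpullback_insertPt_comm {ι κ κ' μ : Type} {f : ι → Option κ} {g : κ → Option μ}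
    {f' : ι → Option κ'} {g' : κ' → Option μ} (h : ∀ i, (f i).bind g = (f' i).bind g')
    (a : HGroup (Power ι X) Z) :
    gpullback (insertPt X g) (gpullback (insertPt X f) a) =
      gpullback (insertPt X g') (gpullback (insertPt X f') a) := by
  rw [gpullback_gpullback, gpullback_gpullback, insertPt_comp, insertPt_comp, funext h]

/-- A class that is trivial on the fat wedge of `X^{lm}` comes from `J(X^{(l)})`. -/
theorem exists_gpullback_jamesQuot_of_kill_eq_one (D : NDR X) (R : RightInv Z) {m l : ℕ}
    (hl : 1 ≤ l) (hm : m ≠ 0) (a : HGroup (Power (Fin m × Fin l) X) Z)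
    (ha : ∀ p, gpullback (insertPt X (kill {p})) a = 1) :
    ∃ b : HGroup (James (Smash l X)) Z, gpullback (jamesQuot m l X) b = a := by
  obtain ⟨f, hfa, hf⟩ := exists_strict_representative D R Finset.univ a.1 fun p _ =>
    congrArg Units.val (ha p)
  have hq := isQuotientMap_blockMap (Fin m) l X
  obtain ⟨f', hf'⟩ : ∃ f' : C(Power (Fin m) (Smash l X), James Z),
      ∀ x, f' (blockMap (Fin m) l X x) = f.1 x := by
    have key : ∀ x, f.1 (Function.surjInv hq.surjective (blockMap (Fin m) l X x)) = f.1 x := by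
      intro x
      rcases blockMap_eq_iff (Function.surjInv_eq hq.surjective (blockMap (Fin m) l X x)) with
        h | ⟨⟨p, hp⟩, ⟨p', hp'⟩⟩
      · rw [h]
      · exact (hf p (Finset.mem_univ _) _ hp).trans (hf p' (Finset.mem_univ _) x hp').symm
    exact ⟨⟨fun y => f.1 (Function.surjInv hq.surjective y), hq.continuous_iff.2
      (f.1.continuous.congr fun x => (key x).symm)⟩, key⟩
  obtain ⟨Γ, hΓ⟩ := James.exists_extension hm f' fun y s hs => by
    obtain ⟨x, rfl⟩ := hq.surjective y
    obtain ⟨j, hj⟩ := (Smash.mk_eq_pt_iff hl).1 hs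
    exact (hf' x).trans (hf (s, j) (Finset.mem_univ _) x hj)
  refine ⟨R.unit (PClass.mk Γ), Units.ext ?_⟩
  refine Eq.trans (congrArg PClass.mk (PMap.ext fun x => ?_)) hfa
  exact (hΓ _).trans (hf' x)

/-- A class on `X^{ln}` that satisfies the compatibility conditions of `HGeo` comes from
`J(X^{(l)})`. -/
theorem exists_gpullback_jamesQuot (D : NDR X) (R : RightInv Z) {l : ℕ} (hl : 1 ≤ l) (n : ℕ)
    (a : HGroup (Power (Fin n × Fin l) X) Z)
    (h1 : ∀ p, gpullback (insertPt X (kill {p})) a = gpullback (insertPt X (kill (block p.1))) a)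
    (h2 : ∀ s t : Fin n, gpullback (insertPt X (dropBlock s)) a =
      gpullback (insertPt X (dropBlock t)) a) :
    ∃ b : HGroup (James (Smash l X)) Z, gpullback (jamesQuot n l X) b = a := by
  induction n with
  | zero =>
    refine ⟨1, (map_one _).trans (Units.ext ?_)⟩
    obtain ⟨f, hf⟩ := a.1.exists_mk
    rw [← hf]
    refine congrArg PClass.mk (PMap.ext fun x => ?_)
    have : x = pt := funext fun p => p.1.elim0
    rw [this]
    exact f.2.symm
  | succ n ih =>
    let a' : HGroup (Power (Fin n × Fin l) X) Z :=
      gpullback (insertPt X (dropBlock (0 : Fin (n + 1)))) a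
    obtain ⟨b', hb'⟩ := ih a'
      (fun p => by
        refine (gpullback_insertPt_comm (dropBlock_zero_bind_kill (T := {(p.1.succ, p.2)})
          fun q => ?_) a).trans ((congrArg (gpullback (insertPt X (dropBlock (0 : Fin (n + 1)))))
          (h1 (p.1.succ, p.2))).trans (gpullback_insertPt_comm
            (dropBlock_zero_bind_kill fun q => ?_) a).symm)
        · simp [Prod.ext_iff]
        · simp [block])
      (fun s t => by
        cases n with
        | zero => exact s.elim0
        | succ n =>
          have key : ∀ s : Fin (n + 1), gpullback (insertPt X (dropBlock s)) a' =
              gpullback (insertPt X (dropBlock (0 : Fin (n + 1)))) a' := fun s =>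
            (gpullback_insertPt_comm (dropBlock_zero_bind_dropBlock s) a).trans
              (congrArg (gpullback (insertPt X (dropBlock (0 : Fin (n + 1))))) (h2 s.succ 0))
          exact (key s).trans (key t).symm)
    -- `b'` restricts to the common value of all `D_s a`, so the quotient `d` is killed by every
    -- `D_s`. Since `d` satisfies the first condition too, it dies when any single coordinate is
    -- killed.
    let d := a * (gpullback (jamesQuot (n + 1) l X) b')⁻¹
    have hd : ∀ s : Fin (n + 1), gpullback (insertPt X (dropBlock s)) d =
        (1 : HGroup (Power (Fin n × Fin l) X) Z) := fun s => by
      have e : gpullback (insertPt X (dropBlock s)) (gpullback (jamesQuot (n + 1) l X) b') =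
          gpullback (jamesQuot n l X) b' := by
        rw [gpullback_gpullback, jamesQuot_comp_dropBlock hl]
      rw [map_mul, map_inv, e, hb']
      exact mul_inv_eq_one.2 (h2 s 0)
    obtain ⟨c, hc⟩ := exists_gpullback_jamesQuot_of_kill_eq_one D R hl n.succ_ne_zero d fun p => by
      have e : gpullback (insertPt X (kill {p})) d =
          gpullback (insertPt X (kill (block p.1))) d := by
        rw [map_mul, map_mul, h1 p, map_inv, map_inv, gpullback_gpullback, gpullback_gpullback,
          jamesQuot_comp_kill]
      rw [e, kill_block_eq, ← insertPt_comp, ← gpullback_gpullback]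
      exact (congrArg _ (hd p.1)).trans (map_one _)
    exact ⟨c * b', by rw [map_mul, hc]; exact inv_mul_cancel_right _ _⟩

end Surjectivity

/-! ### Assembling the homomorphism on the James filtration -/

theorem mem_HComb_iff {n l k : ℕ} {a : CohenGroup (Fin n × Fin l) k} :
    a ∈ HComb n l k ↔ (∀ p, rename (kill {p}) a = rename (kill (block p.1)) a) ∧
      ∀ s t : Fin n, rename (dropBlock s) a = rename (dropBlock t) a := by
  simp only [HComb, Subgroup.mem_inf, Subgroup.mem_iInf]
  rfl

theorem mem_HGeo_iff {k n l : ℕ} {X : Type u} [TopologicalSpace X] [BasePoint X]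
    {b : HGroup (JamesFil n (Smash l X)) (Smash k X)} :
    b ∈ HGeo k n l X ↔ (gpullback (quotMap n l X) b ∈ KGeo (Fin n × Fin l) k X ∧
      ∀ p, gpullback (insertPt X (kill {p})) (gpullback (quotMap n l X) b) =
        gpullback (insertPt X (kill (block p.1))) (gpullback (quotMap n l X) b)) ∧
      ∀ s t : Fin n, gpullback (insertPt X (dropBlock s)) (gpullback (quotMap n l X) b) =
        gpullback (insertPt X (dropBlock t)) (gpullback (quotMap n l X) b) := by
  simp only [HGeo, Subgroup.mem_comap, Subgroup.mem_inf, Subgroup.mem_iInf]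
  rfl

end
end GeoReal

open GeoReal in
theorem proposition2p14 {X : Type u} [TopologicalSpace X] [CompactlyGeneratedSpace X]
    [BasePoint X] [PathConnectedSpace X] (hX : NondegenerateBasePoint X)
    (hcat : WeakCatLtTwo X) (n l k : ℕ) (hl : 1 ≤ l) (hk : 1 ≤ k) :
    (∀ a : PClass (Power (Fin n × Fin l) X) (James (Smash k X)), IsUnit a) ∧
    (∀ a : PClass (JamesFil n (Smash l X)) (James (Smash k X)), IsUnit a) ∧
    Function.Injective (gpullback (X := Smash k X) (quotMap n l X)) ∧
    ∃ eK : CohenGroup (Fin n × Fin l) k →* HGroup (Power (Fin n × Fin l) X) (Smash k X),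
      (∀ I : Fin k → Fin n × Fin l,
        (eK (cgen I) : PClass (Power (Fin n × Fin l) X) (James (Smash k X))) = geoGen X I) ∧
      ∃ eH : HComb n l k →* HGeo k n l X,
        (∀ a : HComb n l k,
          gpullback (quotMap n l X) (eH a : HGroup (JamesFil n (Smash l X)) (Smash k X)) =
            eK (a : CohenGroup (Fin n × Fin l) k)) ∧
        ∀ a : HComb n l k,
          (∀ p, rename (kill {p}) (a : CohenGroup (Fin n × Fin l) k) = 1) →
            ∀ p, gpullback (insertPt X (kill {p})) (gpullback (quotMap n l X)
              (eH a : HGroup (JamesFil n (Smash l X)) (Smash k X))) = 1 := by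
  obtain ⟨D⟩ := hX.nonempty_ndr
  obtain ⟨R⟩ := RightInv.nonempty_smash hX hcat hk
  have hinj := gpullback_quotMap_injective D R hl n
  let eK := realize D R hcat hk (Fin n × Fin l)
  have hkill : ∀ a ∈ HComb n l k, ∀ p, gpullback (insertPt X (kill {p})) (eK a) =
      gpullback (insertPt X (kill (block p.1))) (eK a) := fun a ha p => by
    rw [← realize_rename, ← realize_rename, (mem_HComb_iff.1 ha).1 p]
  have hdrop : ∀ a ∈ HComb n l k, ∀ s t : Fin n, gpullback (insertPt X (dropBlock s)) (eK a) =
      gpullback (insertPt X (dropBlock t)) (eK a) := fun a ha s t => by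
    rw [← realize_rename, ← realize_rename, (mem_HComb_iff.1 ha).2 s t]
  -- The extension is built on all of `J(X^{(l)})` and then restricted to `J_n`.
  have hlift : ∀ a : HComb n l k, ∃ b : HGroup (JamesFil n (Smash l X)) (Smash k X),
      gpullback (quotMap n l X) b = eK a := fun a => by
    obtain ⟨b, hb⟩ := exists_gpullback_jamesQuot D R hl n (eK a) (hkill a a.2) (hdrop a a.2)
    exact ⟨gpullback (jamesIncl n (Smash l X)) b, by rw [gpullback_gpullback]; exact hb⟩
  choose e he using hlift
  have hmem : ∀ a, e a ∈ HGeo k n l X := fun a => by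
    rw [mem_HGeo_iff, he a]
    exact ⟨⟨realize_mem_KGeo D R hcat hk _, hkill a a.2⟩, hdrop a a.2⟩
  -- The lifts `e a` are chosen one by one, but injectivity makes them unique, hence multiplicative.
  refine ⟨R.isUnit, R.isUnit, hinj, eK, fun I => congrArg Units.val (realize_cgen D R hcat hk I),
    MonoidHom.mk' (fun a => ⟨e a, hmem a⟩) fun a b => Subtype.ext (hinj ?_), he,
    fun a ha p => ?_⟩
  · change gpullback (quotMap n l X) (e (a * b)) = gpullback (quotMap n l X) (e a * e b)
    rw [map_mul, he, he, he]
    exact map_mul eK _ _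
  · refine (congrArg (gpullback (insertPt X (kill {p}))) (he a)).trans ?_
    rw [← realize_rename, ha p, map_one]
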